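/- **Setting.** Manifolds are smooth, finite-dimensional, Hausdorff and without boundary. Let $G\rightrightarrows M$ be a Lie groupoid with source $\alpha$, target $\beta$ (smooth submersions), identity section $\epsilon$, inversion $i$ and multiplication defined on the set $G_2=\{(g,h):\beta(g)=\alpha(h)\}$ of composable pairs; $l_g(k)=gk$ and $r_h(k)=kh$ denote translations. Let $\tau:AG\to M$ be its Lie algebroid, $A_xG=\ker T_{\epsilon(x)}\alpha$, and let $A^*G$ be the dual vector bundle. The vector bundle $\mathcal P^\tau G\equiv V\beta\oplus_G V\alpha\to G$, with $V\beta=\ker T\beta$ and $V\alpha=\ker T\alpha$, is a Lie algebroid whose anchor is $(X,Y)\mapsto X+Y$ and whose bracket is determined by the Leibniz rule and by $$[\![(\overrightarrow{X},\overleftarrow{Y}),(\overrightarrow{X'},\overleftarrow{Y'})]\!]=([\overrightarrow{X},\overrightarrow{X'}],[\overleftarrow{Y},\overleftarrow{Y'}])$$ for right-invariant vector fields $\overrightarrow{X},\overrightarrow{X'}$ and left-invariant vector fields $\overleftarrow{Y},\overleftarrow{Y'}$; let $d$ be its differential. Let $L:G\to\mathbb R$ be a smooth function (a discrete Lagrangian).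 Put $\Theta_L^+(X,Y)=Y(L)$ and $\Omega_L=-d\Theta_L^+$. The Lagrangian $L$ is *regular* if $\Omega_L$ is symplectic, i.e. nondegenerate at every point of $G$ and closed with respect to $d$. The discrete Legendre transformations $\mathbb F^-L,\mathbb F^+L:G\to A^*G$ are $$(\mathbb F^-L)(h)(v)=-v(L\circ r_h\circ i)\quad(v\in A_{\alpha(h)}G),\qquad(\mathbb F^+L)(g)(v)=v(L\circ l_g)\quad(v\in A_{\beta(g)}G).$$ A pair $(g,h)\in G_2$, with $x=\beta(g)=\alpha(h)$, is a *solution of the discrete Euler–Lagrange equations* if $d(L\circ l_g+L\circ r_h\circ i)(\epsilon(x))$ vanishes on $A_xG$. A *local discrete Lagrangian evolution operator* on an open set $U\subseteq G$ is a smooth map $\xi:U\to G$ such that, for all $g\in U$, $(g,\xi(g))\in G_2$ and $(g,\xi(g))$ is a solution of the discrete Euler–Lagrange equations. **Theorem.** **(a)** The following conditions are equivalent: (1) $L$ is regular; (2) $\mathbb F^-L$ is a local diffeomorphism; (3) $\mathbb F^+L$ is a local diffeomorphism. **(b)** If $L$ is regular and $(g_0,h_0)\in G_2$ is a solution of the discrete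 Euler–Lagrange equations, then there are open sets $U_0\ni g_0$ and $V_0\ni h_0$ of $G$ and a local discrete Lagrangian evolution operator $\xi_L:U_0\to V_0$ such that 1. $\xi_L(g_0)=h_0$; 2. $\xi_L:U_0\to V_0$ is a diffeomorphism; 3. $\xi_L$ is unique in the following sense. (i) If $U_0'$ is an open neighbourhood of $g_0$ and $\xi'_L:U_0'\to G$ is a local discrete Lagrangian evolution operator with $\xi'_L(g_0)=h_0$, then $\xi'_L=\xi_L$ on the connected component of $U_0\cap U_0'$ that contains $g_0$. (ii) If $U_0'\subseteq G$ is open and $\xi'_L:U_0'\to G$ is a local discrete Lagrangian evolution operator with $\xi'_L(U_0\cap U_0')\subseteq V_0$, then $\xi'_L=\xi_L$ on $U_0\cap U_0'$. -/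

import Mathlib

open Set Bundle Manifold
open scoped ContDiff Topology

noncomputable section
set_option linter.unusedSectionVars false

/-- A Lie groupoid `G ⇉ M` between finite-dimensional smooth manifolds without boundary, modelled
on `EG` and `EM`: source `src` (`α`), target `tgt` (`β`), identity section `unit` (`ε`), inversion
`inv` (`i`) and multiplication `mul` (`m`). The product `mul g h` is only meaningful on the set
`G₂ = {(g, h) | tgt g = src h}` of composable pairs: all laws, and the smoothness of `mul`, are
required on that set only. -/
structure LieGroupoid (EG EM G M : Type*)
    [NormedAddCommGroup EG] [NormedSpace ℝ EG] [NormedAddCommGroup EM] [NormedSpace ℝ EM]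
    [TopologicalSpace G] [ChartedSpace EG G] [TopologicalSpace M] [ChartedSpace EM M] where
  src : G → M
  tgt : G → M
  unit : M → G
  inv : G → G
  mul : G → G → G
  src_unit : ∀ x, src (unit x) = x
  tgt_unit : ∀ x, tgt (unit x) = x
  src_mul : ∀ g h, tgt g = src h → src (mul g h) = src g
  tgt_mul : ∀ g h, tgt g = src h → tgt (mul g h) = tgt h
  mul_assoc : ∀ g h k, tgt g = src h → tgt h = src k → mul g (mul h k) = mul (mul g h) k
  unit_mul : ∀ g, mul (unit (src g)) g = g
  mul_unit : ∀ g, mul g (unit (tgt g)) = g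
  src_inv : ∀ g, src (inv g) = tgt g
  tgt_inv : ∀ g, tgt (inv g) = src g
  inv_mul : ∀ g, mul (inv g) g = unit (tgt g)
  mul_inv : ∀ g, mul g (inv g) = unit (src g)
  isSubmersion_src : IsSubmersion 𝓘(ℝ, EG) 𝓘(ℝ, EM) ∞ src
  isSubmersion_tgt : IsSubmersion 𝓘(ℝ, EG) 𝓘(ℝ, EM) ∞ tgt
  contMDiff_unit : ContMDiff 𝓘(ℝ, EM) 𝓘(ℝ, EG) ∞ unit
  contMDiff_inv : ContMDiff 𝓘(ℝ, EG) 𝓘(ℝ, EG) ∞ inv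
  contMDiffOn_mul : ContMDiffOn (𝓘(ℝ, EG).prod 𝓘(ℝ, EG)) 𝓘(ℝ, EG) ∞
    (fun p : G × G => mul p.1 p.2) {p | tgt p.1 = src p.2}

namespace LieGroupoid

variable {EG EM G M : Type*}
  [NormedAddCommGroup EG] [NormedSpace ℝ EG] [FiniteDimensional ℝ EG]
  [NormedAddCommGroup EM] [NormedSpace ℝ EM] [FiniteDimensional ℝ EM]
  [TopologicalSpace G] [ChartedSpace EG G] [IsManifold 𝓘(ℝ, EG) ∞ G]
  [TopologicalSpace M] [ChartedSpace EM M] [IsManifold 𝓘(ℝ, EM) ∞ M]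

theorem contMDiff_src (𝒢 : LieGroupoid EG EM G M) :
    ContMDiff 𝓘(ℝ, EG) 𝓘(ℝ, EM) ∞ 𝒢.src := 𝒢.isSubmersion_src.contMDiff

/-- The fibre `A_x G = Ker (T_{ε(x)} α)` of the Lie algebroid `AG` of the groupoid, a subspace of
`T_{ε(x)} G`. -/
def Alg (𝒢 : LieGroupoid EG EM G M) (x : M) : Type _ :=
  LinearMap.ker (mfderiv 𝓘(ℝ, EG) 𝓘(ℝ, EM) 𝒢.src (𝒢.unit x)).toLinearMap

variable (EG EM) in
/-- The model fibre of `AG`: a Euclidean space of dimension `dim G - dim M`. -/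
abbrev AlgModel : Type :=
  EuclideanSpace ℝ (Fin (Module.finrank ℝ EG - Module.finrank ℝ EM))

instance algAddCommGroup (𝒢 : LieGroupoid EG EM G M) (x : M) : AddCommGroup (𝒢.Alg x) :=
  inferInstanceAs (AddCommGroup (LinearMap.ker _))
instance algModule (𝒢 : LieGroupoid EG EM G M) (x : M) : Module ℝ (𝒢.Alg x) :=
  inferInstanceAs (Module ℝ (LinearMap.ker _))
instance algTopologicalSpace (𝒢 : LieGroupoid EG EM G M) (x : M) : TopologicalSpace (𝒢.Alg x) :=
  inferInstanceAs (TopologicalSpace (LinearMap.ker _))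

variable (𝒢 : LieGroupoid EG EM G M)
/-- The inclusion `A_x G ⊆ T_{ε(x)} G`. -/
def incl (x : M) : 𝒢.Alg x →L[ℝ] TangentSpace 𝓘(ℝ, EG) (𝒢.unit x) :=
  (LinearMap.ker (mfderiv 𝓘(ℝ, EG) 𝓘(ℝ, EM) 𝒢.src (𝒢.unit x)).toLinearMap).subtypeL

/-! ### The smooth vector bundle structure of `AG`

Around `i : M`, use the charts of `G` at `ε(i)` and of `M` at `i`. In these charts the derivative of
`α` along `ε` is a smooth family `dsrc i x` of linear maps `EG → EM`, surjective at `x = i`. Together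
with a linear map `proj i` which restricts to an isomorphism on the kernel at `x = i`, it gives a
smooth family of linear maps `split i x`, invertible for `x` near `i`, and `proj i` identifies the
kernel `A_x G` with the model fibre for those `x`. These are the local trivializations of `AG`. -/

/-- Coordinates of a tangent vector to `G` in the chart at `ε(i)`. -/
def tcoord (i : M) (y : G) : TangentSpace 𝓘(ℝ, EG) y →L[ℝ] EG :=
  (trivializationAt EG (TangentSpace 𝓘(ℝ, EG) : G → Type _) (𝒢.unit i)).continuousLinearMapAt ℝ y

/-- The source map, read in the charts at `ε(i)` and `i`. -/
def srcHat (i : M) : EG → EM :=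
  extChartAt 𝓘(ℝ, EM) i ∘ 𝒢.src ∘ (extChartAt 𝓘(ℝ, EG) (𝒢.unit i)).symm

/-- The points of `M` near `i` at which both charts can be used. -/
def chartDom (i : M) : Set M :=
  {x | 𝒢.unit x ∈ (chartAt EG (𝒢.unit i)).source ∧ x ∈ (chartAt EM i).source}

/-- The derivative of the source map at `ε(x)`, read in the charts at `ε(i)` and `i`. -/
def dsrc (i x : M) : EG →L[ℝ] EM :=
  fderiv ℝ (𝒢.srcHat i) (extChartAt 𝓘(ℝ, EG) (𝒢.unit i) (𝒢.unit x))

theorem isOpen_chartDom (i : M) : IsOpen (𝒢.chartDom i) :=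
  ((chartAt EG (𝒢.unit i)).open_source.preimage 𝒢.contMDiff_unit.continuous).inter
    (chartAt EM i).open_source

theorem mem_chartDom (i : M) : i ∈ 𝒢.chartDom i :=
  ⟨mem_chart_source _ _, mem_chart_source _ _⟩

theorem contMDiffOn_dsrc (i : M) :
    ContMDiffOn 𝓘(ℝ, EM) 𝓘(ℝ, EG →L[ℝ] EM) ∞ (𝒢.dsrc i) (𝒢.chartDom i) := by
  set φ := extChartAt 𝓘(ℝ, EG) (𝒢.unit i)
  set ψ := extChartAt 𝓘(ℝ, EM) i
  have h1 : ContinuousOn (𝒢.src ∘ φ.symm) φ.target :=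
    𝒢.contMDiff_src.continuous.comp_continuousOn (continuousOn_extChartAt_symm _)
  set Ω : Set EG := φ.target ∩ (𝒢.src ∘ φ.symm) ⁻¹' (chartAt EM i).source
  have hΩ : IsOpen Ω := h1.isOpen_inter_preimage (isOpen_extChartAt_target _)
    (chartAt EM i).open_source
  have h2 : ContMDiffOn 𝓘(ℝ, EG) 𝓘(ℝ, EM) ∞ (𝒢.srcHat i) Ω := by
    refine (contMDiffOn_extChartAt (x := i)).comp (t := (chartAt EM i).source) ?_ (fun y hy => hy.2)
    exact 𝒢.contMDiff_src.comp_contMDiffOn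
      ((contMDiffOn_extChartAt_symm (𝒢.unit i)).mono inter_subset_left)
  have h3 : ContDiffOn ℝ ∞ (fun y => fderiv ℝ (𝒢.srcHat i) y) Ω :=
    (contMDiffOn_iff_contDiffOn.1 h2).fderiv_of_isOpen hΩ (by simp)
  refine (contMDiffOn_iff_contDiffOn.2 h3).comp (t := Ω) (s := 𝒢.chartDom i)
    (f := fun x => φ (𝒢.unit x)) ?_ ?_
  · exact (contMDiffOn_extChartAt (x := 𝒢.unit i)).comp 𝒢.contMDiff_unit.contMDiffOn
      (fun x hx => hx.1)
  · intro x hx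
    have hx1 : 𝒢.unit x ∈ φ.source := by simpa [φ] using hx.1
    refine ⟨φ.map_source hx1, ?_⟩
    simp only [mem_preimage, Function.comp_apply, φ.left_inv hx1, 𝒢.src_unit]
    exact hx.2


theorem tcoord_eq {i : M} {y : G} (hy : y ∈ (chartAt EG (𝒢.unit i)).source) :
    𝒢.tcoord i y = mfderiv 𝓘(ℝ, EG) 𝓘(ℝ, EG) (extChartAt 𝓘(ℝ, EG) (𝒢.unit i)) y :=
  TangentBundle.continuousLinearMapAt_trivializationAt hy

theorem dsrc_tcoord {i x : M} (hx : x ∈ 𝒢.chartDom i) (v : TangentSpace 𝓘(ℝ, EG) (𝒢.unit x)) :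
    𝒢.dsrc i x (𝒢.tcoord i (𝒢.unit x) v) =
      mfderiv 𝓘(ℝ, EM) 𝓘(ℝ, EM) (extChartAt 𝓘(ℝ, EM) i) (𝒢.src (𝒢.unit x))
        (mfderiv 𝓘(ℝ, EG) 𝓘(ℝ, EM) 𝒢.src (𝒢.unit x) v) := by
  set φ := extChartAt 𝓘(ℝ, EG) (𝒢.unit i) with hφ
  set ψ := extChartAt 𝓘(ℝ, EM) i with hψ
  have hx1 : 𝒢.unit x ∈ φ.source := by simpa [φ] using hx.1
  have hsx : 𝒢.src (𝒢.unit x) ∈ (chartAt EM i).source := by rw [𝒢.src_unit]; exact hx.2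
  have hsrc : MDifferentiableAt 𝓘(ℝ, EG) 𝓘(ℝ, EM) 𝒢.src (𝒢.unit x) :=
    𝒢.contMDiff_src.mdifferentiableAt (by simp)
  have hφd : MDifferentiableAt 𝓘(ℝ, EG) 𝓘(ℝ, EG) φ (𝒢.unit x) := mdifferentiableAt_extChartAt hx.1
  have hψd : MDifferentiableAt 𝓘(ℝ, EM) 𝓘(ℝ, EM) ψ (𝒢.src (𝒢.unit x)) :=
    mdifferentiableAt_extChartAt hsx
  have hsymm : MDifferentiableAt 𝓘(ℝ, EG) 𝓘(ℝ, EG) φ.symm (φ (𝒢.unit x)) :=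
    mdifferentiableOn_extChartAt_symm.mdifferentiableAt
      ((isOpen_extChartAt_target _).mem_nhds (φ.map_source hx1))
  have hhat : MDifferentiableAt 𝓘(ℝ, EG) 𝓘(ℝ, EM) (𝒢.srcHat i) (φ (𝒢.unit x)) := by
    have e : φ.symm (φ (𝒢.unit x)) = 𝒢.unit x := φ.left_inv hx1
    refine MDifferentiableAt.comp (I' := 𝓘(ℝ, EM)) (φ (𝒢.unit x)) (f := 𝒢.src ∘ φ.symm) (g := ψ) ?_ ?_
    · simpa only [Function.comp_apply, e] using hψd
    · refine MDifferentiableAt.comp (I' := 𝓘(ℝ, EG)) (φ (𝒢.unit x)) (f := φ.symm) (g := 𝒢.src) ?_ hsymm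
      simpa only [e] using hsrc
  have hEq : (𝒢.srcHat i ∘ φ) =ᶠ[𝓝 (𝒢.unit x)] (ψ ∘ 𝒢.src) := by
    filter_upwards [(isOpen_extChartAt_source (I := 𝓘(ℝ, EG)) (𝒢.unit i)).mem_nhds hx1] with y hy
    simp only [srcHat, Function.comp_apply, ← hφ, φ.left_inv hy, ← hψ]
  have key := hEq.mfderiv_eq (I := 𝓘(ℝ, EG)) (I' := 𝓘(ℝ, EM))
  rw [mfderiv_comp (I' := 𝓘(ℝ, EG)) _ hhat hφd, mfderiv_comp (I' := 𝓘(ℝ, EM)) _ hψd hsrc] at key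
  have key2 := congrArg (fun A => A v) key
  rw [mfderiv_eq_fderiv] at key2
  rw [𝒢.tcoord_eq hx.1]
  exact key2

theorem dsrc_tcoord_eq_zero_iff {i x : M} (hx : x ∈ 𝒢.chartDom i)
    (v : TangentSpace 𝓘(ℝ, EG) (𝒢.unit x)) :
    𝒢.dsrc i x (𝒢.tcoord i (𝒢.unit x) v) = 0 ↔
      mfderiv 𝓘(ℝ, EG) 𝓘(ℝ, EM) 𝒢.src (𝒢.unit x) v = 0 := by
  rw [𝒢.dsrc_tcoord hx]
  have hsx : 𝒢.src (𝒢.unit x) ∈ (extChartAt 𝓘(ℝ, EM) i).source := by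
    rw [𝒢.src_unit]; simpa using hx.2
  have hinj := (isInvertible_mfderiv_extChartAt (I := 𝓘(ℝ, EM)) hsx).injective
  exact ⟨fun h => hinj (h.trans (map_zero _).symm), fun h => by rw [h]; exact map_zero _⟩

theorem mfderiv_src_surjective (x : M) :
    Function.Surjective (mfderiv 𝓘(ℝ, EG) 𝓘(ℝ, EM) 𝒢.src (𝒢.unit x)) := by
  intro w
  have hsrc : MDifferentiableAt 𝓘(ℝ, EG) 𝓘(ℝ, EM) 𝒢.src (𝒢.unit x) :=
    𝒢.contMDiff_src.mdifferentiableAt (by simp)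
  have hunit : MDifferentiableAt 𝓘(ℝ, EM) 𝓘(ℝ, EG) 𝒢.unit x :=
    𝒢.contMDiff_unit.mdifferentiableAt (by simp)
  have key := mfderiv_comp (I' := 𝓘(ℝ, EG)) x hsrc hunit
  have hid : 𝒢.src ∘ 𝒢.unit = id := funext 𝒢.src_unit
  rw [hid, mfderiv_id] at key
  exact ⟨mfderiv 𝓘(ℝ, EM) 𝓘(ℝ, EG) 𝒢.unit x w, (congrArg (fun A => A w) key).symm⟩

theorem dsrc_surjective (i : M) : Function.Surjective (𝒢.dsrc i i) := by
  intro w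
  have hsx : 𝒢.src (𝒢.unit i) ∈ (extChartAt 𝓘(ℝ, EM) i).source := by
    rw [𝒢.src_unit]; exact mem_extChartAt_source i
  obtain ⟨u, hu⟩ := (isInvertible_mfderiv_extChartAt (I := 𝓘(ℝ, EM)) hsx).surjective w
  obtain ⟨v, hv⟩ := 𝒢.mfderiv_src_surjective i u
  exact ⟨𝒢.tcoord i (𝒢.unit i) v, by rw [𝒢.dsrc_tcoord (𝒢.mem_chartDom i), hv]; exact hu⟩

theorem exists_proj (i : M) : ∃ Q : EG →L[ℝ] AlgModel EG EM,
    ((𝒢.dsrc i i).prod Q).IsInvertible := by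
  set D : EG →ₗ[ℝ] EM := (𝒢.dsrc i i).toLinearMap with hD
  have hs : LinearMap.range D = ⊤ := LinearMap.range_eq_top.2 (𝒢.dsrc_surjective i)
  have hrank := D.finrank_range_add_finrank_ker
  rw [hs, finrank_top] at hrank
  have hk : Module.finrank ℝ (LinearMap.ker D) = Module.finrank ℝ (AlgModel EG EM) := by
    rw [finrank_euclideanSpace_fin]; omega
  obtain ⟨P, hP⟩ := (LinearMap.ker D).subtype.exists_leftInverse_of_injective
    (LinearMap.ker_eq_bot.2 (LinearMap.ker D).injective_subtype)
  let c : LinearMap.ker D ≃ₗ[ℝ] AlgModel EG EM := LinearEquiv.ofFinrankEq _ _ hk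
  let Q : EG →L[ℝ] AlgModel EG EM := LinearMap.toContinuousLinearMap (c.toLinearMap ∘ₗ P)
  refine ⟨Q, ?_⟩
  have hinj : Function.Injective ((𝒢.dsrc i i).prod Q) := by
    rw [injective_iff_map_eq_zero]
    intro v hv
    have h1 : D v = 0 := congrArg Prod.fst hv
    have h2 : c (P v) = 0 := congrArg Prod.snd hv
    have h3 : P v = ⟨v, h1⟩ := congrArg (fun A => A ⟨v, h1⟩) hP
    rw [LinearEquiv.map_eq_zero_iff, h3] at h2
    exact congrArg Subtype.val h2
  have hfr : Module.finrank ℝ EG = Module.finrank ℝ (EM × AlgModel EG EM) := by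
    rw [Module.finrank_prod, ← hk, hrank]
  exact ⟨(LinearEquiv.ofInjectiveOfFinrankEq ((𝒢.dsrc i i).prod Q).toLinearMap
    hinj hfr).toContinuousLinearEquiv, by ext <;> rfl⟩

/-- A linear map that identifies the kernel of `dsrc i i` with the model fibre. -/
def proj (i : M) : EG →L[ℝ] AlgModel EG EM := Classical.choose (𝒢.exists_proj i)

/-- The map `(dsrc i x, proj i)`. -/
def split (i x : M) : EG →L[ℝ] EM × AlgModel EG EM := (𝒢.dsrc i x).prod (𝒢.proj i)

theorem contMDiffOn_split (i : M) :
    ContMDiffOn 𝓘(ℝ, EM) 𝓘(ℝ, EG →L[ℝ] EM × AlgModel EG EM) ∞ (𝒢.split i) (𝒢.chartDom i) := by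
  have h : ContDiff ℝ ∞ (fun A : EG →L[ℝ] EM => A.prod (𝒢.proj i)) := by
    have : (fun A : EG →L[ℝ] EM => A.prod (𝒢.proj i)) = fun A =>
        (ContinuousLinearMap.inl ℝ EM (AlgModel EG EM)).comp A +
          (ContinuousLinearMap.inr ℝ EM (AlgModel EG EM)).comp (𝒢.proj i) := by
      funext A; ext v <;> simp
    rw [this]
    fun_prop
  exact h.contMDiff.comp_contMDiffOn (𝒢.contMDiffOn_dsrc i)

/-- The domain of the trivialization of `AG` around `i`. -/
def baseSet (i : M) : Set M := {x | x ∈ 𝒢.chartDom i ∧ (𝒢.split i x).IsInvertible}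

theorem isOpen_baseSet (i : M) : IsOpen (𝒢.baseSet i) :=
  (𝒢.contMDiffOn_split i).continuousOn.isOpen_inter_preimage (𝒢.isOpen_chartDom i)
    (ContinuousLinearEquiv.isOpen (𝕜 := ℝ) (E := EG) (F := EM × AlgModel EG EM))

theorem mem_baseSet (i : M) : i ∈ 𝒢.baseSet i :=
  ⟨𝒢.mem_chartDom i, Classical.choose_spec (𝒢.exists_proj i)⟩

/-- The coordinates on `A_x G` given by the trivialization around `i`. -/
def fwd (i x : M) : 𝒢.Alg x →L[ℝ] AlgModel EG EM :=
  ((𝒢.proj i).comp (𝒢.tcoord i (𝒢.unit x))).comp (𝒢.incl x)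

/-- inverse of `fwd`, before restriction to the kernel -/
def bwd (i x : M) : AlgModel EG EM →L[ℝ] TangentSpace 𝓘(ℝ, EG) (𝒢.unit x) :=
  ((trivializationAt EG (TangentSpace 𝓘(ℝ, EG) : G → Type _) (𝒢.unit i)).symmL ℝ (𝒢.unit x)).comp
    ((𝒢.split i x).inverse.comp (ContinuousLinearMap.inr ℝ EM (AlgModel EG EM)))

theorem unit_mem_baseSet {i x : M} (hx : x ∈ 𝒢.chartDom i) :
    𝒢.unit x ∈ (trivializationAt EG (TangentSpace 𝓘(ℝ, EG) : G → Type _) (𝒢.unit i)).baseSet :=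
  hx.1

theorem tcoord_bwd {i x : M} (hx : x ∈ 𝒢.baseSet i) (w : AlgModel EG EM) :
    𝒢.tcoord i (𝒢.unit x) (𝒢.bwd i x w) = (𝒢.split i x).inverse (0, w) :=
  Trivialization.continuousLinearMapAt_symmL _ (𝒢.unit_mem_baseSet hx.1) _

theorem split_inverse {i x : M} (hx : x ∈ 𝒢.baseSet i) (w : AlgModel EG EM) :
    𝒢.dsrc i x ((𝒢.split i x).inverse (0, w)) = 0 ∧
      𝒢.proj i ((𝒢.split i x).inverse (0, w)) = w := by
  have h := hx.2.self_apply_inverse (0, w)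
  exact ⟨congrArg Prod.fst h, congrArg Prod.snd h⟩

theorem bwd_mem {i x : M} (hx : x ∈ 𝒢.baseSet i) (w : AlgModel EG EM) :
    mfderiv 𝓘(ℝ, EG) 𝓘(ℝ, EM) 𝒢.src (𝒢.unit x) (𝒢.bwd i x w) = 0 := by
  rw [← 𝒢.dsrc_tcoord_eq_zero_iff hx.1, 𝒢.tcoord_bwd hx]
  exact (𝒢.split_inverse hx w).1

theorem bwd_fwd {i x : M} (hx : x ∈ 𝒢.baseSet i) (v : 𝒢.Alg x) :
    𝒢.bwd i x (𝒢.fwd i x v) = 𝒢.incl x v := by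
  have h1 : 𝒢.split i x (𝒢.tcoord i (𝒢.unit x) (𝒢.incl x v)) = (0, 𝒢.fwd i x v) :=
    Prod.ext ((𝒢.dsrc_tcoord_eq_zero_iff hx.1 _).2 v.2) rfl
  have h2 : (𝒢.split i x).inverse (0, 𝒢.fwd i x v) = 𝒢.tcoord i (𝒢.unit x) (𝒢.incl x v) := by
    rw [← h1, hx.2.inverse_apply_self]
  exact (congrArg _ h2).trans
    (Trivialization.symmL_continuousLinearMapAt _ (𝒢.unit_mem_baseSet hx.1) _)

/-- The fibre coordinates over the base set. -/
def fiberEquiv {i x : M} (hx : x ∈ 𝒢.baseSet i) : 𝒢.Alg x ≃L[ℝ] AlgModel EG EM :=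
  ContinuousLinearEquiv.equivOfInverse (𝒢.fwd i x)
    ((𝒢.bwd i x).codRestrict _ (fun w => 𝒢.bwd_mem hx w))
    (fun v => Subtype.ext (𝒢.bwd_fwd hx v))
    (fun w => (congrArg (𝒢.proj i) (𝒢.tcoord_bwd hx w)).trans (𝒢.split_inverse hx w).2)

open Classical in
/-- The local trivialization of `AG` around `i`. -/
def pretriv (i : M) : Pretrivialization (AlgModel EG EM) (π (AlgModel EG EM) 𝒢.Alg) where
  toFun p := (p.1, 𝒢.fwd i p.1 p.2)
  invFun p := ⟨p.1, if h : p.1 ∈ 𝒢.baseSet i then (𝒢.fiberEquiv h).symm p.2 else 0⟩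
  source := TotalSpace.proj ⁻¹' 𝒢.baseSet i
  target := 𝒢.baseSet i ×ˢ univ
  map_source' _ h := ⟨h, mem_univ _⟩
  map_target' _ h := h.1
  left_inv' := by
    rintro ⟨x, v⟩ h
    have h' : x ∈ 𝒢.baseSet i := h
    simp only [h', dite_true]
    exact congrArg (TotalSpace.mk x) ((𝒢.fiberEquiv h').symm_apply_apply v)
  right_inv' := by
    rintro ⟨x, w⟩ h
    have h' : x ∈ 𝒢.baseSet i := h.1
    simp only [h', dite_true]
    exact congrArg (Prod.mk x) ((𝒢.fiberEquiv h').apply_symm_apply w)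
  open_target := (𝒢.isOpen_baseSet i).prod isOpen_univ
  baseSet := 𝒢.baseSet i
  open_baseSet := 𝒢.isOpen_baseSet i
  source_eq := rfl
  target_eq := rfl
  proj_toFun _ _ := rfl

/-- The transition functions of `AG`. -/
def coordChange (i j x : M) : AlgModel EG EM →L[ℝ] AlgModel EG EM :=
  ((𝒢.proj j).comp ((trivializationAt EG (TangentSpace 𝓘(ℝ, EG) : G → Type _)
    (𝒢.unit i)).coordChangeL ℝ (trivializationAt EG (TangentSpace 𝓘(ℝ, EG) : G → Type _)
    (𝒢.unit j)) (𝒢.unit x) : EG →L[ℝ] EG)).comp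
    ((𝒢.split i x).inverse.comp (ContinuousLinearMap.inr ℝ EM (AlgModel EG EM)))

theorem contMDiffOn_coordChange (i j : M) :
    ContMDiffOn 𝓘(ℝ, EM) 𝓘(ℝ, AlgModel EG EM →L[ℝ] AlgModel EG EM) ∞ (𝒢.coordChange i j)
      (𝒢.baseSet i ∩ 𝒢.baseSet j) := by
  have h1 : ContMDiffOn 𝓘(ℝ, EM) 𝓘(ℝ, EG →L[ℝ] EG) ∞ (fun x =>
      ((trivializationAt EG (TangentSpace 𝓘(ℝ, EG) : G → Type _)
        (𝒢.unit i)).coordChangeL ℝ (trivializationAt EG (TangentSpace 𝓘(ℝ, EG) : G → Type _)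
        (𝒢.unit j)) (𝒢.unit x) : EG →L[ℝ] EG)) (𝒢.baseSet i ∩ 𝒢.baseSet j) :=
    (contMDiffOn_coordChangeL (IB := 𝓘(ℝ, EG)) (n := ∞) _ _).comp
      𝒢.contMDiff_unit.contMDiffOn
      (fun x hx => ⟨𝒢.unit_mem_baseSet hx.1.1, 𝒢.unit_mem_baseSet hx.2.1⟩)
  have h2 : ContMDiffOn 𝓘(ℝ, EM) 𝓘(ℝ, EM × AlgModel EG EM →L[ℝ] EG) ∞
      (fun x => (𝒢.split i x).inverse) (𝒢.baseSet i ∩ 𝒢.baseSet j) := by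
    intro x hx
    have ha : ContMDiffAt 𝓘(ℝ, EM) 𝓘(ℝ, EG →L[ℝ] EM × AlgModel EG EM) ∞ (𝒢.split i) x :=
      (𝒢.contMDiffOn_split i).contMDiffAt ((𝒢.isOpen_chartDom i).mem_nhds hx.1.1)
    exact ((hx.1.2.contDiffAt_map_inverse (n := ∞)).contMDiffAt.comp x ha).contMDiffWithinAt
  exact (contMDiffOn_const.clm_comp h1).clm_comp (h2.clm_comp contMDiffOn_const)

theorem coordChange_apply {i j x : M} (hx : x ∈ 𝒢.baseSet i ∩ 𝒢.baseSet j)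
    (w : AlgModel EG EM) :
    𝒢.coordChange i j x w = (𝒢.pretriv j ⟨x, (𝒢.pretriv i).symm x w⟩).2 := by
  have e1 : (⟨x, (𝒢.pretriv i).symm x w⟩ : TotalSpace (AlgModel EG EM) 𝒢.Alg) =
      ⟨x, (𝒢.fiberEquiv hx.1).symm w⟩ := by
    rw [Pretrivialization.mk_symm _ (show x ∈ (𝒢.pretriv i).baseSet from hx.1)]
    exact congrArg (TotalSpace.mk x) (dif_pos hx.1)
  rw [e1]
  refine congrArg (𝒢.proj j) ?_
  change _ = 𝒢.tcoord j (𝒢.unit x) (𝒢.bwd i x w)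
  have h1 := 𝒢.unit_mem_baseSet hx.1.1
  have h2 := 𝒢.unit_mem_baseSet hx.2.1
  have h3 := Trivialization.coordChangeL_apply (R := ℝ)
    (trivializationAt EG (TangentSpace 𝓘(ℝ, EG) : G → Type _) (𝒢.unit i))
    (trivializationAt EG (TangentSpace 𝓘(ℝ, EG) : G → Type _) (𝒢.unit j)) ⟨h1, h2⟩
    ((𝒢.split i x).inverse (0, w))
  refine h3.trans ?_
  have h4 : 𝒢.bwd i x w = (trivializationAt EG (TangentSpace 𝓘(ℝ, EG) : G → Type _)
      (𝒢.unit i)).symm (𝒢.unit x) ((𝒢.split i x).inverse (0, w)) :=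
    Trivialization.symmL_apply (R := ℝ) _ h1 _
  rw [← h4]
  exact (Trivialization.continuousLinearMapAt_apply_of_mem ℝ
    (trivializationAt EG (TangentSpace 𝓘(ℝ, EG) : G → Type _) (𝒢.unit j)) h2 _).symm

/-- The local trivializations form a vector prebundle. -/
def vectorPrebundle : VectorPrebundle ℝ (AlgModel EG EM) 𝒢.Alg where
  pretrivializationAtlas := range 𝒢.pretriv
  pretrivialization_linear' := by
    rintro _ ⟨i, rfl⟩
    exact ⟨fun x _ => (𝒢.fwd i x).toLinearMap.isLinear⟩
  pretrivializationAt := 𝒢.pretriv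
  mem_base_pretrivializationAt := 𝒢.mem_baseSet
  pretrivialization_mem_atlas i := ⟨i, rfl⟩
  exists_coordChange := by
    rintro _ ⟨i, rfl⟩ _ ⟨j, rfl⟩
    exact ⟨𝒢.coordChange i j, (𝒢.contMDiffOn_coordChange i j).continuousOn,
      fun x hx w => 𝒢.coordChange_apply hx w⟩
  totalSpaceMk_isInducing x := Topology.isInducing_const_prod.mpr
    (𝒢.fiberEquiv (𝒢.mem_baseSet x)).toHomeomorph.isInducing

instance vectorPrebundle_isContMDiff : 𝒢.vectorPrebundle.IsContMDiff 𝓘(ℝ, EM) ∞ where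
  exists_contMDiffCoordChange := by
    rintro _ ⟨i, rfl⟩ _ ⟨j, rfl⟩
    exact ⟨𝒢.coordChange i j, 𝒢.contMDiffOn_coordChange i j,
      fun x hx w => 𝒢.coordChange_apply hx w⟩

instance algTotalTopology : TopologicalSpace (TotalSpace (AlgModel EG EM) 𝒢.Alg) :=
  𝒢.vectorPrebundle.totalSpaceTopology
instance algFiberBundle : FiberBundle (AlgModel EG EM) 𝒢.Alg := 𝒢.vectorPrebundle.toFiberBundle
instance algVectorBundle : VectorBundle ℝ (AlgModel EG EM) 𝒢.Alg := 𝒢.vectorPrebundle.toVectorBundle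
instance algContMDiffVectorBundle : ContMDiffVectorBundle ∞ (AlgModel EG EM) 𝒢.Alg 𝓘(ℝ, EM) :=
  𝒢.vectorPrebundle.contMDiffVectorBundle (IB := 𝓘(ℝ, EM))

/-- The fibre `A*_x G` of the dual bundle: linear forms on `A_x G`. -/
abbrev DualAlg (x : M) : Type _ := 𝒢.Alg x →L[ℝ] Bundle.Trivial M ℝ x

/-- The manifold `A*G`, the total space of the dual vector bundle of `AG`. -/
abbrev DualTotal : Type _ := TotalSpace (AlgModel EG EM →L[ℝ] ℝ) 𝒢.DualAlg

/-! ### Translations -/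

/-- The derivative at `k` of the left translation `l_g : α⁻¹(β(g)) → G`, `l_g(k) = g k`. It is a
derivative within the fibre, so it is meaningful on the vectors tangent to the fibre, which are the
elements of `Ker (T_k α)`. -/
def leftT (g k : G) : TangentSpace 𝓘(ℝ, EG) k →L[ℝ] TangentSpace 𝓘(ℝ, EG) (𝒢.mul g k) :=
  mfderivWithin 𝓘(ℝ, EG) 𝓘(ℝ, EG) (fun k' => 𝒢.mul g k') (𝒢.src ⁻¹' {𝒢.src k}) k

/-- The derivative at `k` of the right translation `r_h : β⁻¹(α(h)) → G`, `r_h(k) = k h`, meaningful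
on the elements of `Ker (T_k β)`. -/
def rightT (h k : G) : TangentSpace 𝓘(ℝ, EG) k →L[ℝ] TangentSpace 𝓘(ℝ, EG) (𝒢.mul k h) :=
  mfderivWithin 𝓘(ℝ, EG) 𝓘(ℝ, EG) (fun k' => 𝒢.mul k' h) (𝒢.tgt ⁻¹' {𝒢.tgt k}) k

/-! ### The Lie algebroid `𝒫^τ G ≅ Vβ ⊕ Vα → G`

Its fibre at `g` consists of the pairs `(X, Y)` with `X ∈ V_g β = Ker (T_g β)` and
`Y ∈ V_g α = Ker (T_g α)`. -/

variable (EG G) in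
/-- Vector fields on `G` (not necessarily smooth). -/
abbrev VField : Type _ := ∀ g : G, TangentSpace 𝓘(ℝ, EG) g

variable (EG G) in
/-- Pairs of vector fields on `G`; the sections of `Vβ ⊕ Vα` are singled out by `IsSection`. -/
@[ext]
structure FieldPair where
  /-- The component in `Vβ`. -/
  bPart : VField EG G
  /-- The component in `Vα`. -/
  aPart : VField EG G

/-- `Z` is a smooth section of `Vβ ⊕ Vα → G`. -/
structure IsSection (Z : FieldPair EG G) : Prop where
  contMDiff_bPart : ContMDiff 𝓘(ℝ, EG) (𝓘(ℝ, EG).prod 𝓘(ℝ, EG)) ∞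
    (fun g => (⟨g, Z.bPart g⟩ : TangentBundle 𝓘(ℝ, EG) G))
  contMDiff_aPart : ContMDiff 𝓘(ℝ, EG) (𝓘(ℝ, EG).prod 𝓘(ℝ, EG)) ∞
    (fun g => (⟨g, Z.aPart g⟩ : TangentBundle 𝓘(ℝ, EG) G))
  tgt_bPart : ∀ g, mfderiv 𝓘(ℝ, EG) 𝓘(ℝ, EM) 𝒢.tgt g (Z.bPart g) = 0
  src_aPart : ∀ g, mfderiv 𝓘(ℝ, EG) 𝓘(ℝ, EM) 𝒢.src g (Z.aPart g) = 0

/-- The vector `T l_{h⁻¹} (Y_h)` at `h⁻¹ h = ε(β(h))`, for `Y_h ∈ V_h α`; it lies in `A_{β(h)} G`. -/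
def leftToUnit (Y : VField EG G) (h : G) : TangentSpace 𝓘(ℝ, EG) (𝒢.unit (𝒢.tgt h)) :=
  𝒢.leftT (𝒢.inv h) h (Y h)

/-- The vector `T r_{h⁻¹} (X_h)` at `h h⁻¹ = ε(α(h))`, for `X_h ∈ V_h β`; it lies in
`Ker (T_{ε(α(h))} β)`. -/
def rightToUnit (X : VField EG G) (h : G) : TangentSpace 𝓘(ℝ, EG) (𝒢.unit (𝒢.src h)) :=
  𝒢.rightT (𝒢.inv h) h (X h)

/-- The derivative `∇_X Y` of a section `Y` of `Vα` along a section `X` of `Vβ`. Left translation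
identifies `V_h α` with `A_{β(h)} G`, which is one and the same vector space for all `h` in a fibre
of `β`. As `X` is tangent to the fibres of `β`, the function `h ↦ T l_{h⁻¹} (Y_h)` can be
differentiated along `X`; its derivative at `g` is translated back by `l_g`. (The coordinates of the
tangent bundle of `G` near `ε(β(g))` serve to write this function, as a function on a neighbourhood
of `g`, with values in a fixed vector space.) In particular `∇_X Y = 0` if `Y` is left-invariant. -/
def leftConn (X Y : VField EG G) : VField EG G := fun g =>
  𝒢.leftT g (𝒢.unit (𝒢.tgt g))
    ((trivializationAt EG (TangentSpace 𝓘(ℝ, EG) : G → Type _) (𝒢.unit (𝒢.tgt g))).symmL ℝ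
      (𝒢.unit (𝒢.tgt g))
      (mfderiv 𝓘(ℝ, EG) 𝓘(ℝ, EG)
        (fun h => (trivializationAt EG (TangentSpace 𝓘(ℝ, EG) : G → Type _)
          (𝒢.unit (𝒢.tgt g))).continuousLinearMapAt ℝ (𝒢.unit (𝒢.tgt h)) (𝒢.leftToUnit Y h))
        g (X g)))

/-- The derivative `∇_Y X` of a section `X` of `Vβ` along a section `Y` of `Vα`, defined as
`leftConn` with the roles of left and right translations exchanged. In particular `∇_Y X = 0` if `X`
is right-invariant. -/
def rightConn (Y X : VField EG G) : VField EG G := fun g =>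
  𝒢.rightT g (𝒢.unit (𝒢.src g))
    ((trivializationAt EG (TangentSpace 𝓘(ℝ, EG) : G → Type _) (𝒢.unit (𝒢.src g))).symmL ℝ
      (𝒢.unit (𝒢.src g))
      (mfderiv 𝓘(ℝ, EG) 𝓘(ℝ, EG)
        (fun h => (trivializationAt EG (TangentSpace 𝓘(ℝ, EG) : G → Type _)
          (𝒢.unit (𝒢.src g))).continuousLinearMapAt ℝ (𝒢.unit (𝒢.src h)) (𝒢.rightToUnit X h))
        g (Y g)))

/-- The Lie algebroid bracket on the sections of `Vβ ⊕ Vα`: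
`⟦(X, Y), (X', Y')⟧ = ([X, X'] + ∇_Y X' - ∇_{Y'} X, [Y, Y'] + ∇_X Y' - ∇_{X'} Y)`.
It satisfies the Leibniz rule for the anchor `(X, Y) ↦ X + Y`, and on pairs of a right-invariant
field `X→` and a left-invariant field `Y←` it is given by
`⟦(X→, Y←), (X'→, Y'←)⟧ = ([X→, X'→], [Y←, Y'←])`; such pairs span `Vβ ⊕ Vα` locally, so these two
properties determine the bracket. -/
def prolBracket (Z W : FieldPair EG G) : FieldPair EG G where
  bPart := VectorField.mlieBracket 𝓘(ℝ, EG) Z.bPart W.bPart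
    + 𝒢.rightConn Z.aPart W.bPart - 𝒢.rightConn W.aPart Z.bPart
  aPart := VectorField.mlieBracket 𝓘(ℝ, EG) Z.aPart W.aPart
    + 𝒢.leftConn Z.bPart W.aPart - 𝒢.leftConn W.bPart Z.aPart

/-- The derivative of a function `f` on `G` along the vector field `X + Y`, the image of the section
`Z = (X, Y)` under the anchor. -/
def anchorDeriv (Z : FieldPair EG G) (f : G → ℝ) (g : G) : ℝ :=
  mfderiv 𝓘(ℝ, EG) 𝓘(ℝ, ℝ) f g (Z.bPart g + Z.aPart g)

/-- The differential of the Lie algebroid `Vβ ⊕ Vα` on 1-sections of its dual. -/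
def dOne (μ : FieldPair EG G → G → ℝ) (Z₀ Z₁ : FieldPair EG G) (g : G) : ℝ :=
  anchorDeriv Z₀ (μ Z₁) g - anchorDeriv Z₁ (μ Z₀) g - μ (𝒢.prolBracket Z₀ Z₁) g

/-- The differential of the Lie algebroid `Vβ ⊕ Vα` on 2-sections of its dual. -/
def dTwo (Ω : FieldPair EG G → FieldPair EG G → G → ℝ) (Z₀ Z₁ Z₂ : FieldPair EG G) (g : G) : ℝ :=
  anchorDeriv Z₀ (Ω Z₁ Z₂) g - anchorDeriv Z₁ (Ω Z₀ Z₂) g + anchorDeriv Z₂ (Ω Z₀ Z₁) g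
    - Ω (𝒢.prolBracket Z₀ Z₁) Z₂ g + Ω (𝒢.prolBracket Z₀ Z₂) Z₁ g
    - Ω (𝒢.prolBracket Z₁ Z₂) Z₀ g

/-- A 2-section `Ω` of the dual of `Vβ ⊕ Vα` is symplectic: it is nondegenerate at every point of
`G`, and closed for the differential of the Lie algebroid. (Through every point of `Vβ ⊕ Vα` there
is a smooth section.) -/
def IsSymplectic (Ω : FieldPair EG G → FieldPair EG G → G → ℝ) : Prop :=
  (∀ (g : G) (Z : FieldPair EG G), 𝒢.IsSection Z →
    (∀ W : FieldPair EG G, 𝒢.IsSection W → Ω Z W g = 0) → Z.bPart g = 0 ∧ Z.aPart g = 0) ∧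
  (∀ Z₀ Z₁ Z₂ : FieldPair EG G, 𝒢.IsSection Z₀ → 𝒢.IsSection Z₁ → 𝒢.IsSection Z₂ →
    ∀ g, 𝒢.dTwo Ω Z₀ Z₁ Z₂ g = 0)

/-! ### Discrete mechanics for a discrete Lagrangian `L : G → ℝ` -/

/-- The Poincaré-Cartan 1-section `Θ_L^+ (X, Y) = Y(L)`. -/
def thetaPlus (L : G → ℝ) (Z : FieldPair EG G) (g : G) : ℝ :=
  mfderiv 𝓘(ℝ, EG) 𝓘(ℝ, ℝ) L g (Z.aPart g)

/-- The Poincaré-Cartan 2-section `Ω_L = - d Θ_L^+`. -/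
def omegaL (L : G → ℝ) (Z W : FieldPair EG G) (g : G) : ℝ :=
  -𝒢.dOne (thetaPlus L) Z W g

/-- `L` is regular: `Ω_L` is symplectic on the Lie algebroid `𝒫^τ G ≅ Vβ ⊕ Vα → G`. -/
def IsRegular (L : G → ℝ) : Prop := 𝒢.IsSymplectic (𝒢.omegaL L)

/-- The discrete Legendre transformation `F⁻L : G → A*G`,
`(F⁻L)(h)(v) = - v(L ∘ r_h ∘ i)` for `v ∈ A_{α(h)} G`. -/
def legendreMinus (L : G → ℝ) (h : G) : 𝒢.DualTotal :=
  ⟨𝒢.src h, -((mfderivWithin 𝓘(ℝ, EG) 𝓘(ℝ, ℝ) (fun k => L (𝒢.mul (𝒢.inv k) h))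
    (𝒢.src ⁻¹' {𝒢.src h}) (𝒢.unit (𝒢.src h))).comp (𝒢.incl (𝒢.src h)))⟩

/-- The discrete Legendre transformation `F⁺L : G → A*G`,
`(F⁺L)(g)(v) = v(L ∘ l_g)` for `v ∈ A_{β(g)} G`. -/
def legendrePlus (L : G → ℝ) (g : G) : 𝒢.DualTotal :=
  ⟨𝒢.tgt g, (mfderivWithin 𝓘(ℝ, EG) 𝓘(ℝ, ℝ) (fun k => L (𝒢.mul g k))
    (𝒢.src ⁻¹' {𝒢.tgt g}) (𝒢.unit (𝒢.tgt g))).comp (𝒢.incl (𝒢.tgt g))⟩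

/-- The discrete Euler-Lagrange operator: for a composable pair `(g, h)` with `x = β(g) = α(h)`,
the restriction to `A_x G` of the differential of `L ∘ l_g + L ∘ r_h ∘ i : α⁻¹(x) → ℝ` at `ε(x)`. -/
def delOperator (L : G → ℝ) (g h : G) : 𝒢.Alg (𝒢.tgt g) →L[ℝ] ℝ :=
  (mfderivWithin 𝓘(ℝ, EG) 𝓘(ℝ, ℝ) (fun k => L (𝒢.mul g k) + L (𝒢.mul (𝒢.inv k) h))
    (𝒢.src ⁻¹' {𝒢.tgt g}) (𝒢.unit (𝒢.tgt g))).comp (𝒢.incl (𝒢.tgt g))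

/-- `(g, h)` is composable and solves the discrete Euler-Lagrange equations for `L`. -/
def IsDELSolution (L : G → ℝ) (g h : G) : Prop :=
  𝒢.tgt g = 𝒢.src h ∧ 𝒢.delOperator L g h = 0

/-- `ξ` is a (local) discrete Lagrangian evolution operator for `L` on the set `U`: it is smooth on
`U`, and `(g, ξ(g))` is composable and solves the discrete Euler-Lagrange equations for all
`g ∈ U`. -/
def IsEvolutionOperatorOn (L : G → ℝ) (U : Set G) (ξ : G → G) : Prop :=
  ContMDiffOn 𝓘(ℝ, EG) 𝓘(ℝ, EG) ∞ ξ U ∧ ∀ g ∈ U, 𝒢.IsDELSolution L g (ξ g)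

end LieGroupoid

end

noncomputable section
set_option linter.unusedSectionVars false

/-! ### Calculus on manifolds: partial derivatives, related vector fields, the inverse function
theorem. -/

section Calculus

variable {EG EN : Type*} [NormedAddCommGroup EG] [NormedSpace ℝ EG]
  [NormedAddCommGroup EN] [NormedSpace ℝ EN]
  {HN : Type*} [TopologicalSpace HN] {J : ModelWithCorners ℝ EN HN}
  {G N : Type*} [TopologicalSpace G] [ChartedSpace EG G] [IsManifold 𝓘(ℝ, EG) ∞ G]
  [TopologicalSpace N] [ChartedSpace HN N] [IsManifold J ∞ N]
  {V W : Type*} [NormedAddCommGroup V] [NormedSpace ℝ V] [NormedAddCommGroup W] [NormedSpace ℝ W]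

/-! Through `h` in `G` choose parametrizations `P` of the `β`-fibre and `Q` of the `α`-fibre by the
same vector space `V`, and put `F(p, q) = P(p) h⁻¹ Q(q)` (`triMap`). Moving `p` stays in a `β`-fibre
and moving `q` stays in an `α`-fibre, so the two partial derivatives of `F` land in `Vβ` and `Vα`.
In this way `F` carries the tangent Lie algebroid of `V × V` to `Vβ ⊕ Vα`. The anchor becomes the
identity. Since `P(p)⁻¹ F(p, q) = h⁻¹ Q(q)` is independent of `p`, the connection terms of the
bracket merely differentiate coefficients, and the bracket becomes the ordinary Lie bracket on `V ×
V` (`aPart_prolBracket_eq`, `PullsBack.prolBracket`). The map `F` is in general not a chart of `G`,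
but every section lifts through it (`BiparamFamily.exists_pullsBack`).

With `ℓ = L ∘ F`, the form `Θ_L^+` becomes the partial differential of `ℓ` in `q`, and `Ω_L` becomes
`-∂_p ∂_q ℓ dp ∧ dq` (`omegaL_eq`). Such a form is exact on a vector space, so `Ω_L` is closed
whatever `L` is (`dTwo_omegaL_eq_zero`). At `h` it consists of two off-diagonal blocks given by the
mixed Hessian `V → V*`, so `L` is regular exactly when the mixed Hessian is injective at every point
(`isRegular_iff`).

The map `F⁺L` covers the submersion `β`, so the kernel of its differential lies in `Vβ`. Along a
`β`-fibre the base point is fixed and `F⁺L` is, up to a fixed linear isomorphism, `p ↦ ∂_q ℓ(p, 0)`,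
whose derivative is again the mixed Hessian. As `A*G` and `G` have the same dimension, the inverse
function theorem gives the equivalence with regularity (`isRegular_iff_legendrePlus`). Inversion
turns `F⁻L` into `-F⁺(L ∘ i)` and transposes the mixed Hessian, which settles `F⁻L`
(`isRegular_iff_legendreMinus`).

Finally `(g, h)` solves the discrete Euler–Lagrange equations if and only if `F⁺L(g) = F⁻L(h)`
(`isDELSolution_iff`). Hence the evolution operator is `(F⁻L)⁻¹ ∘ F⁺L`, formed with local inverses,
and its uniqueness is the injectivity of `F⁻L` near `h₀`, combined for (i) with a connectedness
argument that uses that `G` is Hausdorff.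

Two devices recur. Statements about `β` follow from those about `α` in the opposite groupoid.
Smoothness on `G` of brackets and of `Ω_L` is obtained by letting the centre `h` vary in smooth
families (`BiparamFamily`). -/

theorem contMDiffAt_fderiv_snd {f : N × V → W} {p : N × V}
    (hf : ContMDiffAt (J.prod 𝓘(ℝ, V)) 𝓘(ℝ, W) ∞ f p) :
    ContMDiffAt (J.prod 𝓘(ℝ, V)) 𝓘(ℝ, V →L[ℝ] W) ∞
      (fun p : N × V => fderiv ℝ (fun u => f (p.1, u)) p.2) p := by
  have h := ContMDiffAt.mfderiv (J := J.prod 𝓘(ℝ, V)) (I := 𝓘(ℝ, V)) (I' := 𝓘(ℝ, W)) (m := ∞)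
    (n := ∞) (x₀ := p) (fun (p : N × V) (u : V) => f (p.1, u)) Prod.snd
    (by
      refine ContMDiffAt.comp (I' := J.prod 𝓘(ℝ, V)) (p, p.2)
        (f := fun q : (N × V) × V => (q.1.1, q.2)) (g := f) hf ?_
      exact (contMDiffAt_fst.fst).prodMk contMDiffAt_snd)
    contMDiffAt_snd (by simp)
  simpa [inTangentCoordinates_model_space, mfderiv_eq_fderiv] using h

/-- Derivatives within a fibre of a submersion are not unique as linear maps on the whole tangent
space: `mfderivWithin` makes a choice in transverse directions. On velocities of maps that stay in
the set, every choice obeys the chain rule. This is what makes `leftT` and the Legendre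
transformations computable. -/
theorem mfderivWithin_apply_mfderiv {s : Set G} {f : G → N} {c : V → G} {v : V}
    (hf : MDifferentiableWithinAt 𝓘(ℝ, EG) J f s (c v))
    (hc : MDifferentiableAt 𝓘(ℝ, V) 𝓘(ℝ, EG) c v) (hs : ∀ᶠ u in 𝓝 v, c u ∈ s) (w : V) :
    mfderivWithin 𝓘(ℝ, EG) J f s (c v) (mfderiv 𝓘(ℝ, V) 𝓘(ℝ, EG) c v w) =
      mfderiv 𝓘(ℝ, V) J (f ∘ c) v w := by
  obtain ⟨t, hts, ht, hvt⟩ := eventually_nhds_iff.1 hs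
  have h1 := hf.hasMFDerivWithinAt.comp v (hc.hasMFDerivAt.hasMFDerivWithinAt (s := t))
    (fun u hu => hts u hu)
  have h2 := h1.hasMFDerivAt (ht.mem_nhds hvt)
  rw [h2.mfderiv]
  rfl

theorem contMDiffAt_mfderiv_apply_field {c : G → W} {g : G}
    {Y : ∀ x : G, TangentSpace 𝓘(ℝ, EG) x}
    (hY : ContMDiffAt 𝓘(ℝ, EG) (𝓘(ℝ, EG).prod 𝓘(ℝ, EG)) ∞
      (fun x => (⟨x, Y x⟩ : TangentBundle 𝓘(ℝ, EG) G)) g)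
    (hc : ContMDiffAt 𝓘(ℝ, EG) 𝓘(ℝ, W) ∞ c g) :
    ContMDiffAt 𝓘(ℝ, EG) 𝓘(ℝ, W) ∞ (fun x => (mfderiv 𝓘(ℝ, EG) 𝓘(ℝ, W) c x (Y x) : W)) g := by
  have h1 := hc.mfderiv_const (m := ∞) (by simp)
  have h2 := ContMDiffAt.clm_apply_of_inCoordinates (F₁ := EG) (F₂ := W)
    (E₁ := (TangentSpace 𝓘(ℝ, EG) : G → Type _)) (E₂ := (TangentSpace 𝓘(ℝ, W) : W → Type _))
    (b₁ := id) (b₂ := c) (v := Y) (ϕ := fun x => mfderiv 𝓘(ℝ, EG) 𝓘(ℝ, W) c x) h1 hY hc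
  rw [contMDiffAt_totalSpace] at h2
  simpa using h2.2

/-- Smoothness test for fields given as velocities of a smooth family of parametrizations with
smooth coefficients. The condition `S (h, v₀) = h` places the velocity at `h` itself. -/
theorem contMDiffAt_field_of_param {S : G × V → G} {g : G} {v₀ : V} {w : G → V}
    (hS : ContMDiffAt (𝓘(ℝ, EG).prod 𝓘(ℝ, V)) 𝓘(ℝ, EG) ∞ S (g, v₀))
    (hw : ContMDiffAt 𝓘(ℝ, EG) 𝓘(ℝ, V) ∞ w g)
    {Y : ∀ x : G, TangentSpace 𝓘(ℝ, EG) x}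
    (hid : ∀ᶠ h in 𝓝 g, S (h, v₀) = h)
    (hY : ∀ᶠ h in 𝓝 g, (Y h : EG) = mfderiv 𝓘(ℝ, V) 𝓘(ℝ, EG) (fun v => S (h, v)) v₀ (w h)) :
    ContMDiffAt 𝓘(ℝ, EG) (𝓘(ℝ, EG).prod 𝓘(ℝ, EG)) ∞
      (fun x => (⟨x, Y x⟩ : TangentBundle 𝓘(ℝ, EG) G)) g := by
  have h1 := ContMDiffAt.mfderiv (m := ∞) (fun (h : G) (v : V) => S (h, v)) (fun _ => v₀) hS
    contMDiffAt_const (by simp)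
  have hS0 : ContMDiffAt 𝓘(ℝ, EG) 𝓘(ℝ, EG) ∞ (fun h => S (h, v₀)) g :=
    hS.comp g (contMDiffAt_id.prodMk contMDiffAt_const)
  have h2 := ContMDiffAt.clm_apply_of_inCoordinates (F₁ := V) (F₂ := EG)
    (E₁ := (TangentSpace 𝓘(ℝ, V) : V → Type _)) (E₂ := (TangentSpace 𝓘(ℝ, EG) : G → Type _))
    (b₁ := fun _ : G => v₀) (b₂ := fun h => S (h, v₀)) (v := fun h => w h) (IM := 𝓘(ℝ, EG))
    (IB₁ := 𝓘(ℝ, V)) (IB₂ := 𝓘(ℝ, EG))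
    (ϕ := fun h => mfderiv 𝓘(ℝ, V) 𝓘(ℝ, EG) (fun v => S (h, v)) v₀) h1
    (contMDiffAt_totalSpace.2 ⟨contMDiffAt_const, by simpa using hw⟩) hS0
  refine h2.congr_of_eventuallyEq ?_
  filter_upwards [hid, hY] with h e1 e2
  exact TotalSpace.ext e1.symm (heq_of_eq e2)

/-- Lie brackets of vector fields which are related by a map from a vector space. -/
theorem mlieBracket_eq_of_related [CompleteSpace EG] {Q : V → G} {v : V}
    (hQ : ContMDiffAt 𝓘(ℝ, V) 𝓘(ℝ, EG) ∞ Q v) {Y Y' : ∀ x : G, TangentSpace 𝓘(ℝ, EG) x}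
    (hY : MDifferentiableAt 𝓘(ℝ, EG) (𝓘(ℝ, EG).prod 𝓘(ℝ, EG))
      (fun x => (⟨x, Y x⟩ : TangentBundle 𝓘(ℝ, EG) G)) (Q v))
    (hY' : MDifferentiableAt 𝓘(ℝ, EG) (𝓘(ℝ, EG).prod 𝓘(ℝ, EG))
      (fun x => (⟨x, Y' x⟩ : TangentBundle 𝓘(ℝ, EG) G)) (Q v))
    {b b' : V → V} (hb : DifferentiableAt ℝ b v) (hb' : DifferentiableAt ℝ b' v)
    (hYb : ∀ᶠ u in 𝓝 v, Y (Q u) = mfderiv 𝓘(ℝ, V) 𝓘(ℝ, EG) Q u (b u))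
    (hYb' : ∀ᶠ u in 𝓝 v, Y' (Q u) = mfderiv 𝓘(ℝ, V) 𝓘(ℝ, EG) Q u (b' u)) :
    VectorField.mlieBracket 𝓘(ℝ, EG) Y Y' (Q v) =
      mfderiv 𝓘(ℝ, V) 𝓘(ℝ, EG) Q v (fderiv ℝ b' v (b v) - fderiv ℝ b v (b' v)) := by
  set φ := extChartAt 𝓘(ℝ, EG) (Q v) with hφ
  set q : V → EG := φ ∘ Q with hq
  have hq2 : ContDiffAt ℝ ∞ q v :=
    ((contMDiffAt_extChartAt (x := Q v)).comp v hQ).contDiffAt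
  have hsrc : ∀ᶠ u in 𝓝 v, Q u ∈ φ.source :=
    hQ.continuousAt.eventually (extChartAt_source_mem_nhds (I := 𝓘(ℝ, EG)) (Q v))
  have hQe : ∀ᶠ u in 𝓝 v, MDifferentiableAt 𝓘(ℝ, V) 𝓘(ℝ, EG) Q u := by
    have h1 : ContMDiffAt 𝓘(ℝ, V) 𝓘(ℝ, EG) 1 Q v := hQ.of_le (by simp)
    exact ((contMDiffAt_iff_contMDiffAt_nhds (by simp)).1 h1).mono fun u hu => hu.mdifferentiableAt (by simp)
  -- In the chart at `Q v`, the field `Z` becomes a field on `EG` related to `a` by `q = φ ∘ Q`.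
  -- This reduces the claim to vector spaces.
  have key : ∀ (Z : ∀ x : G, TangentSpace 𝓘(ℝ, EG) x) (a : V → V),
      MDifferentiableAt 𝓘(ℝ, EG) (𝓘(ℝ, EG).prod 𝓘(ℝ, EG))
        (fun x => (⟨x, Z x⟩ : TangentBundle 𝓘(ℝ, EG) G)) (Q v) →
      (∀ᶠ u in 𝓝 v, Z (Q u) = mfderiv 𝓘(ℝ, V) 𝓘(ℝ, EG) Q u (a u)) →
      DifferentiableAt ℝ (VectorField.mpullbackWithin 𝓘(ℝ, EG) 𝓘(ℝ, EG) φ.symm Z univ) (q v) ∧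
      ∀ᶠ u in 𝓝 v, VectorField.mpullbackWithin 𝓘(ℝ, EG) 𝓘(ℝ, EG) φ.symm Z univ (q u) =
        fderiv ℝ q u (a u) := by
    intro Z a hZ hZa
    constructor
    · have h1 := MDifferentiableWithinAt.differentiableWithinAt_mpullbackWithin_vectorField
        (s := univ) hZ.mdifferentiableWithinAt
      simp only [preimage_univ, modelWithCornersSelf_coe, range_id, univ_inter] at h1
      exact differentiableWithinAt_univ.1 h1
    · filter_upwards [hsrc, hQe, hZa] with u hu hQu hZu
      have hu' : q u ∈ φ.target := φ.map_source hu
      have hs : MDifferentiableAt 𝓘(ℝ, EG) 𝓘(ℝ, EG) φ.symm (q u) :=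
        mdifferentiableOn_extChartAt_symm.mdifferentiableAt
          ((isOpen_extChartAt_target _).mem_nhds hu')
      have hqd : MDifferentiableAt 𝓘(ℝ, V) 𝓘(ℝ, EG) q u :=
        (mdifferentiableAt_extChartAt (by simpa [φ] using hu)).comp u hQu
      have e1 : φ.symm (q u) = Q u := φ.left_inv hu
      rw [VectorField.mpullbackWithin_apply, mfderivWithin_univ]
      have hinv : (mfderiv 𝓘(ℝ, EG) 𝓘(ℝ, EG) φ.symm (q u)).IsInvertible := by
        have := isInvertible_mfderivWithin_extChartAt_symm (I := 𝓘(ℝ, EG)) hu'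
        simpa only [modelWithCornersSelf_coe, range_id, mfderivWithin_univ] using this
      have hcomp : mfderiv 𝓘(ℝ, V) 𝓘(ℝ, EG) Q u =
          (mfderiv 𝓘(ℝ, EG) 𝓘(ℝ, EG) φ.symm (q u)).comp (mfderiv 𝓘(ℝ, V) 𝓘(ℝ, EG) q u) := by
        rw [← mfderiv_comp (I' := 𝓘(ℝ, EG)) u hs hqd]
        refine Filter.EventuallyEq.mfderiv_eq ?_
        filter_upwards [hQu.continuousAt.eventually
          ((isOpen_extChartAt_source (I := 𝓘(ℝ, EG)) (Q v)).mem_nhds hu)] with y hy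
        exact (φ.left_inv hy).symm
      have e2 : (Z (φ.symm (q u)) : EG) = mfderiv 𝓘(ℝ, V) 𝓘(ℝ, EG) Q u (a u) := by
        rw [e1]; exact hZu
      rw [← mfderiv_eq_fderiv]
      have e3 := hinv.inverse_apply_self (mfderiv 𝓘(ℝ, V) 𝓘(ℝ, EG) q u (a u))
      refine Eq.trans ?_ e3
      exact congrArg _ (e2.trans (congrArg (fun A => A (a u)) hcomp))
  obtain ⟨d1, k1⟩ := key Y b hY hYb
  obtain ⟨d2, k2⟩ := key Y' b' hY' hYb'
  set A : EG → EG := VectorField.mpullbackWithin 𝓘(ℝ, EG) 𝓘(ℝ, EG) φ.symm Y univ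
  set A' : EG → EG := VectorField.mpullbackWithin 𝓘(ℝ, EG) 𝓘(ℝ, EG) φ.symm Y' univ
  have hqd : DifferentiableAt ℝ q v := hq2.differentiableAt (by simp)
  have hdd : DifferentiableAt ℝ (fderiv ℝ q) v :=
    (hq2.fderiv_right (m := ∞) (by simp)).differentiableAt (by simp)
  -- Differentiate the relation `B ∘ q = Dq · a'` in the direction `a`. The second derivative of `q`
  -- that appears is symmetric in `a` and `a'`, so it drops out of the bracket.
  have half : ∀ (B : EG → EG) (a a' : V → V), DifferentiableAt ℝ B (q v) →
      DifferentiableAt ℝ a' v → (∀ᶠ u in 𝓝 v, B (q u) = fderiv ℝ q u (a' u)) →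
      fderiv ℝ B (q v) (fderiv ℝ q v (a v)) =
        fderiv ℝ (fderiv ℝ q) v (a v) (a' v) + fderiv ℝ q v (fderiv ℝ a' v (a v)) := by
    intro B a a' hB ha' hBa
    have h1 : fderiv ℝ (B ∘ q) v = fderiv ℝ (fun u => fderiv ℝ q u (a' u)) v :=
      Filter.EventuallyEq.fderiv_eq hBa
    rw [fderiv_comp v hB hqd, fderiv_clm_apply hdd ha'] at h1
    have h2 := congrArg (fun T => T (a v)) h1
    simpa [add_comm] using h2
  have hsymm : IsSymmSndFDerivAt ℝ q v := hq2.isSymmSndFDerivAt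
    (by rw [minSmoothness_of_isRCLikeNormedField]; exact ENat.LEInfty.out)
  have hlie : VectorField.lieBracketWithin ℝ A A' univ (q v) =
      fderiv ℝ q v (fderiv ℝ b' v (b v) - fderiv ℝ b v (b' v)) := by
    rw [VectorField.lieBracketWithin_univ, VectorField.lieBracket, k1.self_of_nhds, k2.self_of_nhds, half A' b b' d2 hb' k2, half A b' b d1 hb k1,
      hsymm.eq, map_sub]
    abel
  have hQd : MDifferentiableAt 𝓘(ℝ, V) 𝓘(ℝ, EG) Q v := hQ.mdifferentiableAt (by simp)
  have hφd : MDifferentiableAt 𝓘(ℝ, EG) 𝓘(ℝ, EG) φ (Q v) :=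
    mdifferentiableAt_extChartAt (mem_chart_source _ _)
  have hchain := mfderiv_comp (I' := 𝓘(ℝ, EG)) v hφd hQd
  have hinv : (mfderiv 𝓘(ℝ, EG) 𝓘(ℝ, EG) φ (Q v)).IsInvertible :=
    isInvertible_mfderiv_extChartAt (mem_extChartAt_source (Q v))
  have e1 := VectorField.mlieBracketWithin_apply (I := 𝓘(ℝ, EG)) (V := Y) (W := Y') (s := univ)
    (x₀ := Q v)
  rw [VectorField.mlieBracketWithin_univ] at e1
  rw [e1]
  simp only [preimage_univ, modelWithCornersSelf_coe, range_id, univ_inter]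
  have e2 := hinv.inverse_apply_self
    (mfderiv 𝓘(ℝ, V) 𝓘(ℝ, EG) Q v (fderiv ℝ b' v (b v) - fderiv ℝ b v (b' v)))
  refine Eq.trans ?_ e2
  refine congrArg _ (hlie.trans ?_)
  rw [← mfderiv_eq_fderiv]
  exact congrArg (fun T => T (fderiv ℝ b' v (b v) - fderiv ℝ b v (b' v))) hchain

/-- The inverse function theorem for `ψ ∘ f ∘ φ⁻¹`, carried back through the charts `φ` and `ψ`. -/
theorem isLocalDiffeomorphAt_of_bijective_mfderiv [CompleteSpace EG] [CompleteSpace EN]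
    [J.Boundaryless]
    {f : G → N} {x : G} (hf : ∀ᶠ y in 𝓝 x, ContMDiffAt 𝓘(ℝ, EG) J ∞ f y)
    (hbij : Function.Bijective (mfderiv 𝓘(ℝ, EG) J f x)) :
    IsLocalDiffeomorphAt 𝓘(ℝ, EG) J ∞ f x := by
  set φ := extChartAt 𝓘(ℝ, EG) x with hφ
  set ψ := extChartAt J (f x) with hψ
  set F : EG → EN := ψ ∘ f ∘ φ.symm with hF
  obtain ⟨N₀, hN₀, hN₀o, hxN⟩ := eventually_nhds_iff.1 hf
  have hcN : ContinuousOn f N₀ := fun y hy => (hN₀ y hy).continuousAt.continuousWithinAt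
  have hN₁o : IsOpen (N₀ ∩ f ⁻¹' ψ.source) := hcN.isOpen_inter_preimage hN₀o
    (isOpen_extChartAt_source (I := J) (f x))
  set N₁ := N₀ ∩ f ⁻¹' ψ.source
  set Ω : Set EG := φ.target ∩ φ.symm ⁻¹' N₁
  have hΩ : IsOpen Ω := (continuousOn_extChartAt_symm x).isOpen_inter_preimage
    (isOpen_extChartAt_target x) hN₁o
  have hFΩ : ContDiffOn ℝ ∞ F Ω := by
    rw [← contMDiffOn_iff_contDiffOn]
    intro u hu
    have h1 : ContMDiffAt J 𝓘(ℝ, EN) ∞ ψ (f (φ.symm u)) :=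
      contMDiffAt_extChartAt' (by simpa [ψ] using hu.2.2)
    have h2 : ContMDiffAt 𝓘(ℝ, EG) 𝓘(ℝ, EG) ∞ φ.symm u :=
      (contMDiffOn_extChartAt_symm x).contMDiffAt ((isOpen_extChartAt_target x).mem_nhds hu.1)
    exact (h1.comp u ((hN₀ _ hu.2.1).comp u h2)).contMDiffWithinAt
  have hxΩ : φ x ∈ Ω := ⟨mem_extChartAt_target x, by
    simp only [mem_preimage, φ, extChartAt_to_inv]
    exact ⟨hxN, mem_extChartAt_source (f x)⟩⟩
  have hFat : ∀ u ∈ Ω, ContDiffAt ℝ ∞ F u := fun u hu => hFΩ.contDiffAt (hΩ.mem_nhds hu)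
  have hmf : mfderiv 𝓘(ℝ, EG) J f x = fderiv ℝ F (φ x) := by
    rw [((hN₀ x hxN).mdifferentiableAt (by simp)).mfderiv]
    simp only [modelWithCornersSelf_coe, range_id, fderivWithin_univ]
    rfl
  let A : EG ≃L[ℝ] EN := ContinuousLinearEquiv.ofBijective (fderiv ℝ F (φ x))
    (LinearMap.ker_eq_bot.2 (by rw [← hmf]; exact hbij.1))
    (LinearMap.range_eq_top.2 (by rw [← hmf]; exact hbij.2))
  have hA : HasFDerivAt F (A : EG →L[ℝ] EN) (φ x) := by
    have : (A : EG →L[ℝ] EN) = fderiv ℝ F (φ x) := ContinuousLinearEquiv.coe_ofBijective _ _ _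
    rw [this]
    exact ((hFat _ hxΩ).differentiableAt (by simp)).hasFDerivAt
  let e := (hFat _ hxΩ).toOpenPartialHomeomorph F hA (by simp)
  have heF : ∀ u, e u = F u := fun u => rfl
  have hdc : ContinuousOn (fderiv ℝ F) Ω := hFΩ.continuousOn_fderiv_of_isOpen hΩ (by simp)
  -- Smoothness of the local inverse is known at images of points where the derivative is
  -- invertible. That is an open condition, so the homeomorphism is restricted to it and the inverse
  -- is smooth on the whole image.
  set s : Set EG := (Ω ∩ fderiv ℝ F ⁻¹' range ((↑) : (EG ≃L[ℝ] EN) → EG →L[ℝ] EN)) ∩ e.source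
  have hs : IsOpen s := (hdc.isOpen_inter_preimage hΩ (ContinuousLinearEquiv.isOpen)).inter
    e.open_source
  have hxs : φ x ∈ s := ⟨⟨hxΩ, ⟨A, hA.fderiv.symm⟩⟩,
    (hFat _ hxΩ).mem_toOpenPartialHomeomorph_source hA (by simp)⟩
  have hes : IsOpen (e '' s) := e.isOpen_image_of_subset_source hs inter_subset_right
  have hsymm : ContDiffOn ℝ ∞ e.symm (e '' s) := by
    rintro _ ⟨u, hu, rfl⟩
    obtain ⟨B, hB⟩ := hu.1.2
    have e1 : e.symm (e u) = u := e.left_inv hu.2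
    refine (e.contDiffAt_symm (f₀' := B) (e.map_source hu.2) ?_ ?_).contDiffWithinAt
    · rw [e1, hB]
      exact ((hFat _ hu.1.1).differentiableAt (by simp)).hasFDerivAt
    · rw [e1]; exact hFat _ hu.1.1
  refine ⟨{ toFun := f
            invFun := φ.symm ∘ e.symm ∘ ψ
            source := φ.source ∩ φ ⁻¹' s
            target := ψ.source ∩ ψ ⁻¹' (e '' s)
            map_source' := ?_
            map_target' := ?_
            left_inv' := ?_
            right_inv' := ?_
            open_source := ?_
            open_target := ?_
            contMDiffOn_toFun := ?_
            contMDiffOn_invFun := ?_ }, ⟨mem_extChartAt_source x, hxs⟩, fun y hy => rfl⟩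
  · rintro y ⟨hy, hys⟩
    have e1 : φ.symm (φ y) = y := φ.left_inv hy
    have h2 := hys.1.1.2.2
    simp only [mem_preimage, e1] at h2
    exact ⟨h2, ⟨φ y, hys, by rw [heF]; simp [F, e1]⟩⟩
  · rintro z ⟨hz, u, hu, huz⟩
    have e2 : e.symm (ψ z) = u := by rw [← huz]; exact e.left_inv hu.2
    simp only [Function.comp_apply, e2]
    exact ⟨φ.map_target hu.1.1.1, by simp only [mem_preimage, φ.right_inv hu.1.1.1]; exact hu⟩
  · rintro y ⟨hy, hys⟩
    have e1 : φ.symm (φ y) = y := φ.left_inv hy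
    have e2 : ψ (f y) = e (φ y) := by rw [heF]; simp [F, e1]
    simp only [Function.comp_apply, e2, e.left_inv hys.2, e1]
  · rintro z ⟨hz, u, hu, huz⟩
    have e2 : e.symm (ψ z) = u := by rw [← huz]; exact e.left_inv hu.2
    simp only [Function.comp_apply, e2]
    refine ψ.injOn hu.1.1.2.2 hz ?_
    rw [← huz, heF]; rfl
  · exact (continuousOn_extChartAt x).isOpen_inter_preimage (isOpen_extChartAt_source x) hs
  · exact (continuousOn_extChartAt (f x)).isOpen_inter_preimage (isOpen_extChartAt_source _) hes
  · rintro y ⟨hy, hys⟩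
    have h2 := hys.1.1.2.1
    simp only [φ.left_inv hy] at h2
    exact (hN₀ y h2).contMDiffWithinAt
  · have h1 : ContMDiffOn J 𝓘(ℝ, EN) ∞ ψ (ψ.source ∩ ψ ⁻¹' (e '' s)) :=
      (contMDiffOn_extChartAt (x := f x)).mono (by simp [ψ])
    have h2 : ContMDiffOn J 𝓘(ℝ, EG) ∞ (e.symm ∘ ψ) (ψ.source ∩ ψ ⁻¹' (e '' s)) :=
      (contMDiffOn_iff_contDiffOn.2 hsymm).comp h1 (fun z hz => hz.2)
    refine (contMDiffOn_extChartAt_symm x).comp h2 ?_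
    rintro z ⟨hz, u, hu, huz⟩
    have e2 : e.symm (ψ z) = u := by rw [← huz]; exact e.left_inv hu.2
    simp only [mem_preimage, Function.comp_apply, e2]
    exact hu.1.1.1

end Calculus

/-! ### Charts adapted to the fibres of a submersion. -/

section FibreChart

variable {EG EM : Type*} [NormedAddCommGroup EG] [NormedSpace ℝ EG]
  [NormedAddCommGroup EM] [NormedSpace ℝ EM]
  {G M : Type*} [TopologicalSpace G] [ChartedSpace EG G] [IsManifold 𝓘(ℝ, EG) ∞ G]
  [TopologicalSpace M] [ChartedSpace EM M] [IsManifold 𝓘(ℝ, EM) ∞ M]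

theorem mfderiv_clm_comp_apply {E E' : Type*} [NormedAddCommGroup E] [NormedSpace ℝ E]
    [NormedAddCommGroup E'] [NormedSpace ℝ E'] (l : E →L[ℝ] E') {χ : G → E} {k : G}
    (hχ : MDifferentiableAt 𝓘(ℝ, EG) 𝓘(ℝ, E) χ k) (v : TangentSpace 𝓘(ℝ, EG) k) :
    mfderiv 𝓘(ℝ, EG) 𝓘(ℝ, E') (l ∘ χ) k v = l (mfderiv 𝓘(ℝ, EG) 𝓘(ℝ, E) χ k v) := by
  rw [mfderiv_comp (I' := 𝓘(ℝ, E)) k l.mdifferentiableAt hχ, l.mfderiv_eq]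
  rfl

variable (EG EM) in
/-- A smooth family of parametrizations, over the vector space `V`, of the fibres of `f : G → M`
near the point `k₀`: `param (k, ·)` parametrizes the fibre through `k`, and `coord` is a function
whose restriction to each fibre inverts the parametrization up to a translation. -/
structure FibreChart (V : Type*) [NormedAddCommGroup V] [NormedSpace ℝ V] (f : G → M)
    (k₀ : G) where
  dom : Set G
  ball : Set V
  param : G × V → G
  coord : G → V
  isOpen_dom : IsOpen dom
  mem_dom : k₀ ∈ dom
  isOpen_ball : IsOpen ball
  zero_mem_ball : (0 : V) ∈ ball
  contMDiffOn_param : ContMDiffOn (𝓘(ℝ, EG).prod 𝓘(ℝ, V)) 𝓘(ℝ, EG) ∞ param (dom ×ˢ ball)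
  contMDiffOn_coord : ContMDiffOn 𝓘(ℝ, EG) 𝓘(ℝ, V) ∞ coord dom
  param_zero : ∀ k ∈ dom, param (k, 0) = k
  map_param : ∀ k ∈ dom, ∀ w ∈ ball, f (param (k, w)) = f k
  coord_param : ∀ k ∈ dom, ∀ w ∈ ball, coord (param (k, w)) = coord k + w
  eq_zero : ∀ k ∈ dom, ∀ v : TangentSpace 𝓘(ℝ, EG) k, mfderiv 𝓘(ℝ, EG) 𝓘(ℝ, EM) f k v = 0 →
    mfderiv 𝓘(ℝ, EG) 𝓘(ℝ, V) coord k v = 0 → v = 0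

/-- In suitable charts a submersion is the projection `EM × F → EM`. Translating the `F`-component
by `w` parametrizes the fibres, and reading that component off is `coord`. A dimension count
identifies `F` with the model fibre of `AG`. -/
theorem nonempty_fibreChart [FiniteDimensional ℝ EG] [FiniteDimensional ℝ EM] {f : G → M}
    (hf : IsSubmersion 𝓘(ℝ, EG) 𝓘(ℝ, EM) ∞ f) (k₀ : G) :
    Nonempty (FibreChart EG EM (LieGroupoid.AlgModel EG EM) f k₀) := by
  obtain ⟨F, _, _, hF⟩ := hf.isSubmersionAt k₀
  have hsm : ∀ k, MDifferentiableAt 𝓘(ℝ, EG) 𝓘(ℝ, EM) f k :=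
    fun k => hf.contMDiff.mdifferentiableAt (by simp)
  let e := hF.equiv
  have hfd : FiniteDimensional ℝ F := by
    have : FiniteDimensional ℝ (EM × F) := e.toLinearEquiv.finiteDimensional
    exact FiniteDimensional.of_surjective (LinearMap.snd ℝ EM F) LinearMap.snd_surjective
  have hrank : Module.finrank ℝ F = Module.finrank ℝ (LieGroupoid.AlgModel EG EM) := by
    have := e.toLinearEquiv.finrank_eq
    rw [Module.finrank_prod] at this
    rw [finrank_euclideanSpace_fin]; omega
  let a : F ≃L[ℝ] LieGroupoid.AlgModel EG EM := ContinuousLinearEquiv.ofFinrankEq hrank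
  set χ := hF.domChart with hχ
  set ψ := hF.codChart with hψ
  have hχs : ContMDiffOn 𝓘(ℝ, EG) 𝓘(ℝ, EG) ∞ χ χ.source :=
    contMDiffOn_of_mem_maximalAtlas hF.domChart_mem_maximalAtlas
  have hχt : ContMDiffOn 𝓘(ℝ, EG) 𝓘(ℝ, EG) ∞ χ.symm χ.target :=
    contMDiffOn_symm_of_mem_maximalAtlas hF.domChart_mem_maximalAtlas
  have hψs : ContMDiffOn 𝓘(ℝ, EM) 𝓘(ℝ, EM) ∞ ψ ψ.source :=
    contMDiffOn_of_mem_maximalAtlas hF.codChart_mem_maximalAtlas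
  have hk₀ : k₀ ∈ χ.source := hF.mem_domChart_source
  have hfs : ∀ k ∈ χ.source, f k ∈ ψ.source := fun k hk => hF.mapsto_domChart_source_codChart_source hk
  have hw : ∀ u ∈ χ.target, ψ (f (χ.symm u)) = (e u).1 := by
    intro u hu
    have hu' : u ∈ (hF.domChart.extend 𝓘(ℝ, EG)).target := by simpa [χ] using hu
    simpa [χ, ψ] using hF.writtenInCharts hu'
  let j : LieGroupoid.AlgModel EG EM →L[ℝ] EG := (e.symm : EM × F →L[ℝ] EG).comp
    ((ContinuousLinearMap.inr ℝ EM F).comp (a.symm : LieGroupoid.AlgModel EG EM →L[ℝ] F))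
  let cl : EG →L[ℝ] LieGroupoid.AlgModel EG EM := (a : F →L[ℝ] LieGroupoid.AlgModel EG EM).comp
    ((ContinuousLinearMap.snd ℝ EM F).comp (e : EG →L[ℝ] EM × F))
  have hej : ∀ w, e (j w) = (0, a.symm w) := fun w => e.apply_symm_apply _
  have hclj : ∀ w, cl (j w) = w := fun w => by
    change a (e (j w)).2 = w
    rw [hej]; exact a.apply_symm_apply w
  have hcont : ContinuousOn (fun p : G × LieGroupoid.AlgModel EG EM => χ p.1 + j p.2)
      (χ.source ×ˢ univ) :=
    (χ.continuousOn.comp continuousOn_fst (fun p hp => hp.1)).add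
      (j.continuous.comp_continuousOn continuousOn_snd)
  have hopen := hcont.isOpen_inter_preimage (χ.open_source.prod isOpen_univ) χ.open_target
  have hmem : (k₀, (0 : LieGroupoid.AlgModel EG EM)) ∈ (χ.source ×ˢ univ) ∩
      (fun p : G × LieGroupoid.AlgModel EG EM => χ p.1 + j p.2) ⁻¹' χ.target := by
    refine ⟨⟨hk₀, mem_univ _⟩, ?_⟩
    simpa using χ.map_source hk₀
  -- A product neighbourhood on which the translated point `χ k + j w` stays in the image of the
  -- chart, uniformly in `k` and `w`.
  obtain ⟨N, O, hN, hO, hkN, h0O, hNO⟩ := isOpen_prod_iff.1 hopen _ _ hmem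
  have hNs : ∀ k ∈ N, k ∈ χ.source := fun k hk => (hNO (show (k, 0) ∈ N ×ˢ O from ⟨hk, h0O⟩)).1.1
  have hNt : ∀ k ∈ N, ∀ w ∈ O, χ k + j w ∈ χ.target := fun k hk w hw =>
    (hNO (show (k, w) ∈ N ×ˢ O from ⟨hk, hw⟩)).2
  refine ⟨{ dom := N
            ball := O
            param := fun p => χ.symm (χ p.1 + j p.2)
            coord := fun k => cl (χ k)
            isOpen_dom := hN
            mem_dom := hkN
            isOpen_ball := hO
            zero_mem_ball := h0O
            contMDiffOn_param := ?_
            contMDiffOn_coord := ?_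
            param_zero := ?_
            map_param := ?_
            coord_param := ?_
            eq_zero := ?_ }⟩
  · refine hχt.comp ?_ (fun p hp => hNt p.1 hp.1 p.2 hp.2)
    exact (hχs.comp contMDiffOn_fst (fun p hp => hNs p.1 hp.1)).add
      (j.contMDiff.comp_contMDiffOn contMDiffOn_snd)
  · exact cl.contMDiff.comp_contMDiffOn (hχs.mono hNs)
  · intro k hk
    simp only [map_zero, add_zero]
    exact χ.left_inv (hNs k hk)
  · intro k hk w hw'
    have hu := hNt k hk w hw'
    refine ψ.injOn (hfs _ (χ.map_target hu)) (hfs k (hNs k hk)) ?_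
    have h1 := hw _ (χ.map_source (hNs k hk))
    rw [χ.left_inv (hNs k hk)] at h1
    rw [hw _ hu, h1, map_add, hej]
    simp
  · intro k hk w hw'
    simp only [χ.right_inv (hNt k hk w hw'), map_add, hclj]
  · intro k hk v hv1 hv2
    have hks := hNs k hk
    have hχd : MDifferentiableAt 𝓘(ℝ, EG) 𝓘(ℝ, EG) χ k :=
      (hχs.contMDiffAt (χ.open_source.mem_nhds hks)).mdifferentiableAt (by simp)
    have hχd' : MDifferentiableAt 𝓘(ℝ, EG) 𝓘(ℝ, EG) χ.symm (χ k) :=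
      (hχt.contMDiffAt (χ.open_target.mem_nhds (χ.map_source hks))).mdifferentiableAt (by simp)
    have hψd : MDifferentiableAt 𝓘(ℝ, EM) 𝓘(ℝ, EM) ψ (f k) :=
      (hψs.contMDiffAt (ψ.open_source.mem_nhds (hfs k hks))).mdifferentiableAt (by simp)
    have e2 : cl (mfderiv 𝓘(ℝ, EG) 𝓘(ℝ, EG) χ k v) = 0 := (mfderiv_clm_comp_apply cl hχd v).symm.trans hv2
    have hev : (ψ ∘ f) =ᶠ[𝓝 k] (((ContinuousLinearMap.fst ℝ EM F).comp (e : EG →L[ℝ] EM × F)) ∘ χ) := by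
      filter_upwards [χ.open_source.mem_nhds hks] with y hy
      have := hw _ (χ.map_source hy)
      rw [χ.left_inv hy] at this
      simpa using this
    have e1 : ((ContinuousLinearMap.fst ℝ EM F).comp (e : EG →L[ℝ] EM × F))
        (mfderiv 𝓘(ℝ, EG) 𝓘(ℝ, EG) χ k v) = 0 := by
      refine (mfderiv_clm_comp_apply _ hχd v).symm.trans ?_
      rw [← hev.mfderiv_eq, mfderiv_comp (I' := 𝓘(ℝ, EM)) k hψd (hsm k)]
      exact (congrArg (mfderiv 𝓘(ℝ, EM) 𝓘(ℝ, EM) ψ (f k)) hv1).trans (map_zero _)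
    have e3 : e (mfderiv 𝓘(ℝ, EG) 𝓘(ℝ, EG) χ k v) = 0 :=
      Prod.ext e1 (a.map_eq_zero_iff.1 e2)
    have e4 := e.map_eq_zero_iff.1 e3
    have hid : (χ.symm ∘ χ) =ᶠ[𝓝 k] id := by
      filter_upwards [χ.open_source.mem_nhds hks] with y hy
      exact χ.left_inv hy
    have h5 := hid.mfderiv_eq (I := 𝓘(ℝ, EG)) (I' := 𝓘(ℝ, EG))
    rw [mfderiv_comp (I' := 𝓘(ℝ, EG)) k hχd' hχd, mfderiv_id] at h5
    have h6 := congrArg (fun A => A v) h5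
    exact h6.symm.trans
      ((congrArg (mfderiv 𝓘(ℝ, EG) 𝓘(ℝ, EG) χ.symm (χ k)) e4).trans (map_zero _))

namespace FibreChart

variable {V : Type*} [NormedAddCommGroup V] [NormedSpace ℝ V] {f : G → M} {k₀ : G}
  (S : FibreChart EG EM V f k₀)

theorem contMDiffAt_param {k : G} (hk : k ∈ S.dom) {w : V} (hw : w ∈ S.ball) :
    ContMDiffAt (𝓘(ℝ, EG).prod 𝓘(ℝ, V)) 𝓘(ℝ, EG) ∞ S.param (k, w) :=
  S.contMDiffOn_param.contMDiffAt ((S.isOpen_dom.prod S.isOpen_ball).mem_nhds ⟨hk, hw⟩)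

theorem contMDiffAt_coord {k : G} (hk : k ∈ S.dom) :
    ContMDiffAt 𝓘(ℝ, EG) 𝓘(ℝ, V) ∞ S.coord k :=
  S.contMDiffOn_coord.contMDiffAt (S.isOpen_dom.mem_nhds hk)

theorem contMDiffAt_param_right {k : G} (hk : k ∈ S.dom) {w : V} (hw : w ∈ S.ball) :
    ContMDiffAt 𝓘(ℝ, V) 𝓘(ℝ, EG) ∞ (fun w => S.param (k, w)) w :=
  (S.contMDiffAt_param hk hw).comp w (contMDiffAt_const.prodMk contMDiffAt_id)

theorem eventually_map_param {k : G} (hk : k ∈ S.dom) :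
    ∀ᶠ w in 𝓝 (0 : V), f (S.param (k, w)) = f k := by
  filter_upwards [S.isOpen_ball.mem_nhds S.zero_mem_ball] with w hw
  exact S.map_param k hk w hw

theorem mfderiv_coord_param {k : G} (hk : k ∈ S.dom) (w : V) :
    mfderiv 𝓘(ℝ, EG) 𝓘(ℝ, V) S.coord k
      (mfderiv 𝓘(ℝ, V) 𝓘(ℝ, EG) (fun w => S.param (k, w)) 0 w) = w := by
  have h0 := S.param_zero k hk
  have hc : MDifferentiableAt 𝓘(ℝ, EG) 𝓘(ℝ, V) S.coord (S.param (k, 0)) := by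
    rw [h0]; exact (S.contMDiffAt_coord hk).mdifferentiableAt (by simp)
  have hp := (S.contMDiffAt_param_right hk S.zero_mem_ball).mdifferentiableAt (by simp)
  have h1 := mfderiv_comp (I' := 𝓘(ℝ, EG)) (0 : V) hc hp
  have hev : (S.coord ∘ fun w => S.param (k, w)) =ᶠ[𝓝 0] fun w => S.coord k + w := by
    filter_upwards [S.isOpen_ball.mem_nhds S.zero_mem_ball] with w hw
    exact S.coord_param k hk w hw
  rw [hev.mfderiv_eq, mfderiv_eq_fderiv, fderiv_const_add, fderiv_fun_id] at h1
  have h2 := congrArg (fun A => A w) h1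
  -- `S.param (k, 0)` equals `k` only propositionally, so the two derivatives have different tangent
  -- spaces as domains. Every tangent space unfolds to `EG`, so the base point is replaced with the
  -- vector kept in `EG`. The same transport recurs below.
  have h3 : ∀ (y : G) (_ : y = k) (u : EG), (mfderiv 𝓘(ℝ, EG) 𝓘(ℝ, V) S.coord k u : V) =
      mfderiv 𝓘(ℝ, EG) 𝓘(ℝ, V) S.coord y u := by rintro _ rfl u; rfl
  exact (h3 _ h0 _).trans h2.symm

theorem mfderiv_map_param {k : G} (hk : k ∈ S.dom)
    (hf : MDifferentiableAt 𝓘(ℝ, EG) 𝓘(ℝ, EM) f k) (w : V) :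
    mfderiv 𝓘(ℝ, EG) 𝓘(ℝ, EM) f k
      (mfderiv 𝓘(ℝ, V) 𝓘(ℝ, EG) (fun w => S.param (k, w)) 0 w) = 0 := by
  have h0 := S.param_zero k hk
  have hc : MDifferentiableAt 𝓘(ℝ, EG) 𝓘(ℝ, EM) f (S.param (k, 0)) := by
    rw [h0]; exact hf
  have hp := (S.contMDiffAt_param_right hk S.zero_mem_ball).mdifferentiableAt (by simp)
  have h1 := mfderiv_comp (I' := 𝓘(ℝ, EG)) (0 : V) hc hp
  have hev : (f ∘ fun w => S.param (k, w)) =ᶠ[𝓝 0] fun _ => f k := S.eventually_map_param hk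
  rw [hev.mfderiv_eq, mfderiv_const] at h1
  have h2 := congrArg (fun A => A w) h1
  have h3 : ∀ (y : G) (_ : y = k) (u : EG), (mfderiv 𝓘(ℝ, EG) 𝓘(ℝ, EM) f k u : EM) =
      mfderiv 𝓘(ℝ, EG) 𝓘(ℝ, EM) f y u := by rintro _ rfl u; rfl
  exact (h3 _ h0 _).trans h2.symm

/-- Vectors tangent to the fibres are velocities of the parametrization. -/
theorem mfderiv_param_coord {k : G} (hk : k ∈ S.dom)
    (hf : MDifferentiableAt 𝓘(ℝ, EG) 𝓘(ℝ, EM) f k) (v : TangentSpace 𝓘(ℝ, EG) k)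
    (hv : mfderiv 𝓘(ℝ, EG) 𝓘(ℝ, EM) f k v = 0) :
    mfderiv 𝓘(ℝ, V) 𝓘(ℝ, EG) (fun w => S.param (k, w)) 0
      (mfderiv 𝓘(ℝ, EG) 𝓘(ℝ, V) S.coord k v) = v := by
  refine sub_eq_zero.1 (S.eq_zero k hk _ ?_ ?_)
  · exact (map_sub _ _ _).trans (by rw [hv]; exact (sub_zero _).trans (S.mfderiv_map_param hk hf _))
  · refine (map_sub _ _ _).trans (sub_eq_zero.2 ?_)
    exact S.mfderiv_coord_param hk _

end FibreChart
end FibreChart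

/-! ### Extension of vertical vectors to global vertical fields. -/

section VerticalField

variable {EG EM : Type*} [NormedAddCommGroup EG] [NormedSpace ℝ EG] [FiniteDimensional ℝ EG]
  [NormedAddCommGroup EM] [NormedSpace ℝ EM] [FiniteDimensional ℝ EM]
  {G M : Type*} [TopologicalSpace G] [ChartedSpace EG G] [IsManifold 𝓘(ℝ, EG) ∞ G] [T2Space G]
  [TopologicalSpace M] [ChartedSpace EM M] [IsManifold 𝓘(ℝ, EM) ∞ M]

/-- A vector tangent to a fibre of a submersion extends to a smooth vector field tangent to the
fibres. -/
theorem exists_vertical_field {f : G → M} (hf : IsSubmersion 𝓘(ℝ, EG) 𝓘(ℝ, EM) ∞ f) (g : G)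
    (v : TangentSpace 𝓘(ℝ, EG) g) (hv : mfderiv 𝓘(ℝ, EG) 𝓘(ℝ, EM) f g v = 0) :
    ∃ Y : ∀ x : G, TangentSpace 𝓘(ℝ, EG) x,
      ContMDiff 𝓘(ℝ, EG) (𝓘(ℝ, EG).prod 𝓘(ℝ, EG)) ∞
        (fun x => (⟨x, Y x⟩ : TangentBundle 𝓘(ℝ, EG) G)) ∧
      (∀ x, mfderiv 𝓘(ℝ, EG) 𝓘(ℝ, EM) f x (Y x) = 0) ∧ Y g = v := by
  obtain ⟨S⟩ := nonempty_fibreChart hf g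
  have hfd : ∀ k, MDifferentiableAt 𝓘(ℝ, EG) 𝓘(ℝ, EM) f k :=
    fun k => hf.contMDiff.mdifferentiableAt (by simp)
  obtain ⟨φ, -, hφ⟩ := (SmoothBumpFunction.nhds_basis_tsupport (I := 𝓘(ℝ, EG)) g).mem_iff.1
    (S.isOpen_dom.mem_nhds S.mem_dom)
  have hφs : ContMDiff 𝓘(ℝ, EG) 𝓘(ℝ, ℝ) ∞ φ := φ.contMDiff
  set w₀ : LieGroupoid.AlgModel EG EM :=
    mfderiv 𝓘(ℝ, EG) 𝓘(ℝ, LieGroupoid.AlgModel EG EM) S.coord g v with hw₀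
  -- The field with the constant coefficient `w₀` in the fibre coordinates, cut off by a bump
  -- function supported in the adapted chart; the cut-off keeps it tangent to the fibres.
  let Y : ∀ x : G, TangentSpace 𝓘(ℝ, EG) x := fun x =>
    mfderiv 𝓘(ℝ, LieGroupoid.AlgModel EG EM) 𝓘(ℝ, EG) (fun w => S.param (x, w)) 0 (φ x • w₀)
  have hY0 : ∀ x, φ x = 0 → Y x = 0 := by
    intro x hx
    change mfderiv 𝓘(ℝ, LieGroupoid.AlgModel EG EM) 𝓘(ℝ, EG) (fun w => S.param (x, w)) 0
      (φ x • w₀) = 0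
    rw [hx, zero_smul]; exact map_zero _
  refine ⟨Y, fun x => ?_, fun x => ?_, ?_⟩
  · by_cases hx : x ∈ tsupport φ
    · have hxd := hφ hx
      refine contMDiffAt_field_of_param (S := S.param) (v₀ := 0) (w := fun x => φ x • w₀)
        (S.contMDiffAt_param hxd S.zero_mem_ball) ?_ ?_ ?_
      · exact (hφs x).smul contMDiffAt_const
      · filter_upwards [S.isOpen_dom.mem_nhds hxd] with y hy using S.param_zero y hy
      · exact Filter.Eventually.of_forall fun y => rfl
    · have h0 := Bundle.contMDiff_zeroSection ℝ (TangentSpace 𝓘(ℝ, EG) : G → Type _) (F := EG)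
        (IB := 𝓘(ℝ, EG)) (n := ∞) x
      refine h0.congr_of_eventuallyEq ?_
      filter_upwards [(isClosed_tsupport φ).isOpen_compl.mem_nhds hx] with y hy
      exact congrArg (TotalSpace.mk y) (hY0 y (image_eq_zero_of_notMem_tsupport hy))
  · by_cases hx : x ∈ tsupport φ
    · exact S.mfderiv_map_param (hφ hx) (hfd x) _
    · rw [hY0 x (image_eq_zero_of_notMem_tsupport hx)]; exact map_zero _
  · change mfderiv 𝓘(ℝ, LieGroupoid.AlgModel EG EM) 𝓘(ℝ, EG) (fun w => S.param (g, w)) 0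
      (φ g • w₀) = v
    rw [φ.eq_one, one_smul]
    exact S.mfderiv_param_coord S.mem_dom (hfd g) v hv

end VerticalField

namespace LieGroupoid

variable {EG EM G M : Type*}
  [NormedAddCommGroup EG] [NormedSpace ℝ EG] [FiniteDimensional ℝ EG]
  [NormedAddCommGroup EM] [NormedSpace ℝ EM] [FiniteDimensional ℝ EM]
  [TopologicalSpace G] [ChartedSpace EG G] [IsManifold 𝓘(ℝ, EG) ∞ G]
  [TopologicalSpace M] [ChartedSpace EM M] [IsManifold 𝓘(ℝ, EM) ∞ M]
  (𝒢 : LieGroupoid EG EM G M)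

/-! ### Groupoid algebra -/

/-- The opposite groupoid, with source and target exchanged. -/
def op : LieGroupoid EG EM G M where
  src := 𝒢.tgt
  tgt := 𝒢.src
  unit := 𝒢.unit
  inv := 𝒢.inv
  mul g h := 𝒢.mul h g
  src_unit := 𝒢.tgt_unit
  tgt_unit := 𝒢.src_unit
  src_mul g h e := 𝒢.tgt_mul h g e.symm
  tgt_mul g h e := 𝒢.src_mul h g e.symm
  mul_assoc g h k e e' := (𝒢.mul_assoc k h g e'.symm e.symm).symm
  unit_mul := 𝒢.mul_unit
  mul_unit := 𝒢.unit_mul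
  src_inv := 𝒢.tgt_inv
  tgt_inv := 𝒢.src_inv
  inv_mul := 𝒢.mul_inv
  mul_inv := 𝒢.inv_mul
  isSubmersion_src := 𝒢.isSubmersion_tgt
  isSubmersion_tgt := 𝒢.isSubmersion_src
  contMDiff_unit := 𝒢.contMDiff_unit
  contMDiff_inv := 𝒢.contMDiff_inv
  contMDiffOn_mul := 𝒢.contMDiffOn_mul.comp
    (contMDiff_snd.prodMk contMDiff_fst).contMDiffOn (fun _ h => Eq.symm h)

theorem contMDiff_tgt : ContMDiff 𝓘(ℝ, EG) 𝓘(ℝ, EM) ∞ 𝒢.tgt := 𝒢.isSubmersion_tgt.contMDiff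

variable {g h k : G}

theorem inv_mul_cancel_left (e : 𝒢.tgt g = 𝒢.src k) : 𝒢.mul (𝒢.inv g) (𝒢.mul g k) = k := by
  rw [𝒢.mul_assoc _ _ _ (𝒢.tgt_inv g) e, 𝒢.inv_mul, e, 𝒢.unit_mul]

theorem mul_inv_cancel_left (e : 𝒢.src g = 𝒢.src k) : 𝒢.mul g (𝒢.mul (𝒢.inv g) k) = k := by
  rw [𝒢.mul_assoc _ _ _ (𝒢.src_inv g).symm ((𝒢.tgt_inv g).trans e), 𝒢.mul_inv, e, 𝒢.unit_mul]

theorem inv_inv (g : G) : 𝒢.inv (𝒢.inv g) = g := by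
  have h1 := 𝒢.inv_mul_cancel_left (g := 𝒢.inv g) (k := g) (𝒢.tgt_inv g)
  have h2 := 𝒢.mul_unit (𝒢.inv (𝒢.inv g))
  rw [𝒢.tgt_inv, 𝒢.src_inv] at h2
  rw [𝒢.inv_mul] at h1
  exact h2.symm.trans h1

theorem inv_mul_rev (e : 𝒢.tgt g = 𝒢.src h) :
    𝒢.inv (𝒢.mul g h) = 𝒢.mul (𝒢.inv h) (𝒢.inv g) := by
  have e1 : 𝒢.tgt (𝒢.inv h) = 𝒢.src (𝒢.inv g) := by rw [𝒢.tgt_inv, 𝒢.src_inv, e]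
  have h1 := 𝒢.inv_mul_cancel_left (g := 𝒢.mul g h) (k := 𝒢.mul (𝒢.inv h) (𝒢.inv g))
    (by rw [𝒢.tgt_mul _ _ e, 𝒢.src_mul _ _ e1, 𝒢.src_inv])
  have h2 : 𝒢.mul (𝒢.mul g h) (𝒢.mul (𝒢.inv h) (𝒢.inv g)) = 𝒢.unit (𝒢.src (𝒢.mul g h)) := by
    rw [← 𝒢.mul_assoc _ _ _ e (by rw [𝒢.src_mul _ _ e1, 𝒢.src_inv]),
      𝒢.mul_inv_cancel_left (by rw [𝒢.src_inv, e]), 𝒢.mul_inv, 𝒢.src_mul _ _ e]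
  rw [h2, ← 𝒢.tgt_inv, 𝒢.mul_unit] at h1
  exact h1

/-- The product `a h⁻¹ b`. -/
def tri (a h b : G) : G := 𝒢.mul (𝒢.mul a (𝒢.inv h)) b

variable {a b : G}

theorem tri_eq (ha : 𝒢.tgt a = 𝒢.tgt h) (hb : 𝒢.src b = 𝒢.src h) :
    𝒢.tri a h b = 𝒢.mul a (𝒢.mul (𝒢.inv h) b) :=
  (𝒢.mul_assoc _ _ _ (by rw [ha, 𝒢.src_inv]) (by rw [𝒢.tgt_inv, hb])).symm

/-- Associativity. It lets every result about the `α`-side be reused for the `β`-side through the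
opposite groupoid. -/
theorem op_tri (ha : 𝒢.tgt a = 𝒢.tgt h) (hb : 𝒢.src b = 𝒢.src h) :
    𝒢.op.tri b h a = 𝒢.tri a h b := (𝒢.tri_eq ha hb).symm

theorem tgt_mul_inv (ha : 𝒢.tgt a = 𝒢.tgt h) : 𝒢.tgt (𝒢.mul a (𝒢.inv h)) = 𝒢.src h := by
  rw [𝒢.tgt_mul _ _ (by rw [ha, 𝒢.src_inv]), 𝒢.tgt_inv]

theorem src_inv_mul (hb : 𝒢.src b = 𝒢.src h) : 𝒢.src (𝒢.mul (𝒢.inv h) b) = 𝒢.tgt h := by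
  rw [𝒢.src_mul _ _ (by rw [hb, 𝒢.tgt_inv]), 𝒢.src_inv]

theorem src_tri (ha : 𝒢.tgt a = 𝒢.tgt h) (hb : 𝒢.src b = 𝒢.src h) :
    𝒢.src (𝒢.tri a h b) = 𝒢.src a := by
  rw [tri, 𝒢.src_mul _ _ (by rw [𝒢.tgt_mul_inv ha, hb]), 𝒢.src_mul _ _ (by rw [ha, 𝒢.src_inv])]

theorem tgt_tri (ha : 𝒢.tgt a = 𝒢.tgt h) (hb : 𝒢.src b = 𝒢.src h) :
    𝒢.tgt (𝒢.tri a h b) = 𝒢.tgt b := by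
  rw [tri, 𝒢.tgt_mul _ _ (by rw [𝒢.tgt_mul_inv ha, hb])]

theorem tri_self_left (hb : 𝒢.src b = 𝒢.src h) : 𝒢.tri h h b = b := by
  rw [tri, 𝒢.mul_inv, ← hb, 𝒢.unit_mul]

theorem tri_self_right (ha : 𝒢.tgt a = 𝒢.tgt h) : 𝒢.tri a h h = a := by
  rw [𝒢.tri_eq ha rfl, 𝒢.inv_mul, ← ha, 𝒢.mul_unit]

/-- The right-hand side does not involve `a`: after left translation to the unit, the curves `b ↦ a
h⁻¹ b` coincide for all `a`. This is the source of the formula for `leftConn`. -/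
theorem inv_mul_tri (ha : 𝒢.tgt a = 𝒢.tgt h) (hb : 𝒢.src b = 𝒢.src h) :
    𝒢.mul (𝒢.inv a) (𝒢.tri a h b) = 𝒢.mul (𝒢.inv h) b := by
  rw [𝒢.tri_eq ha hb, 𝒢.inv_mul_cancel_left (by rw [ha, 𝒢.src_inv_mul hb])]

theorem inv_tri (ha : 𝒢.tgt a = 𝒢.tgt h) (hb : 𝒢.src b = 𝒢.src h) :
    𝒢.inv (𝒢.tri a h b) = 𝒢.tri (𝒢.inv b) (𝒢.inv h) (𝒢.inv a) := by
  rw [𝒢.tri_eq ha hb, 𝒢.inv_mul_rev (by rw [ha, 𝒢.src_inv_mul hb]),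
    𝒢.inv_mul_rev (by rw [𝒢.tgt_inv, hb]), tri]

/-- In `(a h⁻¹ b') (a' h⁻¹ b')⁻¹ (a' h⁻¹ b)` the inner factors cancel, leaving `a h⁻¹ b`.
Geometrically, the map `triMap` is unchanged when its centre is moved to another of its values. -/
theorem tri_tri {a' b' : G} (ha : 𝒢.tgt a = 𝒢.tgt h) (hb : 𝒢.src b = 𝒢.src h)
    (ha' : 𝒢.tgt a' = 𝒢.tgt h) (hb' : 𝒢.src b' = 𝒢.src h) :
    𝒢.tri (𝒢.tri a h b') (𝒢.tri a' h b') (𝒢.tri a' h b) = 𝒢.tri a h b := by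
  have e1 : 𝒢.tgt (𝒢.tri a h b') = 𝒢.tgt (𝒢.tri a' h b') := by
    rw [𝒢.tgt_tri ha hb', 𝒢.tgt_tri ha' hb']
  have e2 : 𝒢.src (𝒢.tri a' h b) = 𝒢.src (𝒢.tri a' h b') := by
    rw [𝒢.src_tri ha' hb, 𝒢.src_tri ha' hb']
  have e3 : 𝒢.src (𝒢.mul (𝒢.inv (𝒢.tri a' h b')) (𝒢.tri a' h b)) = 𝒢.src (𝒢.inv b') := by
    rw [𝒢.src_inv_mul e2, 𝒢.tgt_tri ha' hb', 𝒢.src_inv]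
  have e4 : 𝒢.mul (𝒢.inv (𝒢.tri a' h b')) (𝒢.tri a' h b) = 𝒢.mul (𝒢.inv b') b := by
    have c1 : 𝒢.tgt (𝒢.inv b') = 𝒢.src (𝒢.mul h (𝒢.inv a')) := by
      rw [𝒢.tgt_inv, 𝒢.src_mul _ _ (by rw [𝒢.src_inv, ha']), hb']
    rw [𝒢.inv_tri ha' hb', 𝒢.tri_eq (by rw [𝒢.tgt_inv, 𝒢.tgt_inv, hb'])
      (by rw [𝒢.src_inv, 𝒢.src_inv, ha']), 𝒢.inv_inv,
      ← 𝒢.mul_assoc _ _ _ c1 (by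
        rw [𝒢.tgt_mul _ _ (by rw [𝒢.src_inv, ha']), 𝒢.tgt_inv, 𝒢.src_tri ha' hb]),
      ← 𝒢.mul_assoc _ _ _ (by rw [𝒢.src_inv, ha']) (by rw [𝒢.tgt_inv, 𝒢.src_tri ha' hb]),
      𝒢.inv_mul_tri ha' hb, 𝒢.mul_inv_cancel_left hb.symm]
  rw [𝒢.tri_eq e1 e2, e4, tri, tri,
    ← 𝒢.mul_assoc _ _ _ (by rw [𝒢.tgt_mul_inv ha, hb'])
      (by rw [𝒢.src_mul _ _ (by rw [𝒢.tgt_inv, hb, hb']), 𝒢.src_inv]),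
    𝒢.mul_inv_cancel_left (by rw [hb, hb'])]

/-! ### Smoothness and translations -/

section Smooth

variable {EN HN N : Type*} [NormedAddCommGroup EN] [NormedSpace ℝ EN] [TopologicalSpace HN]
  {J : ModelWithCorners ℝ EN HN} [TopologicalSpace N] [ChartedSpace HN N]
  {V W : Type*} [NormedAddCommGroup V] [NormedSpace ℝ V]
  [NormedAddCommGroup W] [NormedSpace ℝ W]

theorem contMDiffAt_mul {a b : N → G} {y : N} (ha : ContMDiffAt J 𝓘(ℝ, EG) ∞ a y)
    (hb : ContMDiffAt J 𝓘(ℝ, EG) ∞ b y) (hab : ∀ᶠ x in 𝓝 y, 𝒢.tgt (a x) = 𝒢.src (b x)) :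
    ContMDiffAt J 𝓘(ℝ, EG) ∞ (fun x => 𝒢.mul (a x) (b x)) y := by
  obtain ⟨t, hts, ht, hyt⟩ := eventually_nhds_iff.1 hab
  have h1 := (𝒢.contMDiffOn_mul (a y, b y) (hts y hyt)).comp y
    (ha.prodMk hb).contMDiffWithinAt (s := t) (fun x hx => hts x hx)
  exact h1.contMDiffAt (ht.mem_nhds hyt)

theorem contMDiffAt_tri {a c b : N → G} {y : N} (ha : ContMDiffAt J 𝓘(ℝ, EG) ∞ a y)
    (hc : ContMDiffAt J 𝓘(ℝ, EG) ∞ c y) (hb : ContMDiffAt J 𝓘(ℝ, EG) ∞ b y)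
    (hac : ∀ᶠ x in 𝓝 y, 𝒢.tgt (a x) = 𝒢.tgt (c x))
    (hbc : ∀ᶠ x in 𝓝 y, 𝒢.src (b x) = 𝒢.src (c x)) :
    ContMDiffAt J 𝓘(ℝ, EG) ∞ (fun x => 𝒢.tri (a x) (c x) (b x)) y := by
  refine 𝒢.contMDiffAt_mul (𝒢.contMDiffAt_mul ha (𝒢.contMDiff_inv.contMDiffAt.comp y hc) ?_) hb ?_
  · filter_upwards [hac] with x hx
    rw [𝒢.src_inv, hx]
  · filter_upwards [hac, hbc] with x hx hx'
    rw [𝒢.tgt_mul_inv hx, hx']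

/-- Multiplication is smooth on composable pairs only, so a left translation is differentiable only
within the `α`-fibre. -/
theorem mdifferentiableWithinAt_mul_left (e : 𝒢.tgt g = 𝒢.src k) :
    MDifferentiableWithinAt 𝓘(ℝ, EG) 𝓘(ℝ, EG) (fun k' => 𝒢.mul g k') (𝒢.src ⁻¹' {𝒢.src k}) k := by
  have h1 := (𝒢.contMDiffOn_mul (g, k) e).comp k
    (f := fun k' => (g, k')) (s := 𝒢.src ⁻¹' {𝒢.src k})
    (contMDiffAt_const.prodMk contMDiffAt_id).contMDiffWithinAt (fun x hx => e.trans hx.symm)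
  exact h1.mdifferentiableWithinAt (by simp)

theorem leftT_mfderiv {c : V → G} {v : V} (hk : c v = k) (e : 𝒢.tgt g = 𝒢.src k)
    (hc : MDifferentiableAt 𝓘(ℝ, V) 𝓘(ℝ, EG) c v) (hs : ∀ᶠ u in 𝓝 v, 𝒢.src (c u) = 𝒢.src k)
    (w : V) :
    (𝒢.leftT g k (mfderiv 𝓘(ℝ, V) 𝓘(ℝ, EG) c v w : EG) : EG) =
      mfderiv 𝓘(ℝ, V) 𝓘(ℝ, EG) (fun u => 𝒢.mul g (c u)) v w := by
  subst hk
  exact mfderivWithin_apply_mfderiv (𝒢.mdifferentiableWithinAt_mul_left e) hc hs w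

end Smooth

end LieGroupoid

/-! ### The map `(p, q) ↦ P(p) h⁻¹ Q(q)` and the connection `leftConn`. -/

namespace LieGroupoid

variable {EG EM G M : Type*}
  [NormedAddCommGroup EG] [NormedSpace ℝ EG] [FiniteDimensional ℝ EG]
  [NormedAddCommGroup EM] [NormedSpace ℝ EM] [FiniteDimensional ℝ EM]
  [TopologicalSpace G] [ChartedSpace EG G] [IsManifold 𝓘(ℝ, EG) ∞ G]
  [TopologicalSpace M] [ChartedSpace EM M] [IsManifold 𝓘(ℝ, EM) ∞ M]
  (𝒢 : LieGroupoid EG EM G M)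
  {V : Type*} [NormedAddCommGroup V] [NormedSpace ℝ V]

/-- `P` and `Q` parametrize pieces of the `β`-fibre and of the `α`-fibre through `h`. -/
structure Biparam (h : G) (P Q : V → G) : Prop where
  left_zero : P 0 = h
  right_zero : Q 0 = h
  smooth_left : ∀ᶠ p in 𝓝 0, ContMDiffAt 𝓘(ℝ, V) 𝓘(ℝ, EG) ∞ P p
  smooth_right : ∀ᶠ q in 𝓝 0, ContMDiffAt 𝓘(ℝ, V) 𝓘(ℝ, EG) ∞ Q q
  tgt_left : ∀ᶠ p in 𝓝 0, 𝒢.tgt (P p) = 𝒢.tgt h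
  src_right : ∀ᶠ q in 𝓝 0, 𝒢.src (Q q) = 𝒢.src h

/-- The map `(p, q) ↦ P(p) h⁻¹ Q(q)`. -/
def triMap (h : G) (P Q : V → G) (y : V × V) : G := 𝒢.tri (P y.1) h (Q y.2)

variable {𝒢}

namespace Biparam

variable {h : G} {P Q : V → G} (bp : 𝒢.Biparam h P Q)
include bp

theorem op : 𝒢.op.Biparam h Q P :=
  ⟨bp.right_zero, bp.left_zero, bp.smooth_right, bp.smooth_left, bp.src_right, bp.tgt_left⟩

theorem contMDiffAt_left : ContMDiffAt 𝓘(ℝ, V) 𝓘(ℝ, EG) ∞ P 0 := bp.smooth_left.self_of_nhds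

theorem contMDiffAt_right : ContMDiffAt 𝓘(ℝ, V) 𝓘(ℝ, EG) ∞ Q 0 := bp.smooth_right.self_of_nhds

theorem eventually_fibres :
    ∀ᶠ y in 𝓝 (0 : V × V), 𝒢.tgt (P y.1) = 𝒢.tgt h ∧ 𝒢.src (Q y.2) = 𝒢.src h := by
  rw [Prod.zero_eq_mk, nhds_prod_eq]
  exact bp.tgt_left.prod_mk bp.src_right

theorem eventually_contMDiffAt_triMap :
    ∀ᶠ y in 𝓝 (0 : V × V), ContMDiffAt 𝓘(ℝ, V × V) 𝓘(ℝ, EG) ∞ (𝒢.triMap h P Q) y := by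
  have h0 : ∀ᶠ y in 𝓝 (0 : V × V), ContMDiffAt 𝓘(ℝ, V) 𝓘(ℝ, EG) ∞ P y.1 ∧
      ContMDiffAt 𝓘(ℝ, V) 𝓘(ℝ, EG) ∞ Q y.2 := by
    rw [Prod.zero_eq_mk, nhds_prod_eq]
    exact bp.smooth_left.prod_mk bp.smooth_right
  filter_upwards [h0, bp.eventually_fibres.eventually_nhds] with y hy hyf
  have h1 : ContMDiffAt 𝓘(ℝ, V × V) 𝓘(ℝ, V) ∞ (Prod.fst : V × V → V) y :=
    contDiffAt_fst.contMDiffAt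
  have h2 : ContMDiffAt 𝓘(ℝ, V × V) 𝓘(ℝ, V) ∞ (Prod.snd : V × V → V) y :=
    contDiffAt_snd.contMDiffAt
  exact 𝒢.contMDiffAt_tri (ContMDiffAt.comp (I' := 𝓘(ℝ, V)) y (g := P) hy.1 h1)
    contMDiffAt_const (ContMDiffAt.comp (I' := 𝓘(ℝ, V)) y (g := Q) hy.2 h2)
    (hyf.mono fun y hy => hy.1) (hyf.mono fun y hy => hy.2)

theorem contMDiffAt_triMap : ContMDiffAt 𝓘(ℝ, V × V) 𝓘(ℝ, EG) ∞ (𝒢.triMap h P Q) 0 :=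
  bp.eventually_contMDiffAt_triMap.self_of_nhds

theorem eventually_mdifferentiableAt :
    ∀ᶠ y in 𝓝 (0 : V × V), MDifferentiableAt 𝓘(ℝ, V × V) 𝓘(ℝ, EG) (𝒢.triMap h P Q) y :=
  bp.eventually_contMDiffAt_triMap.mono fun u hu => hu.mdifferentiableAt (by simp)

theorem op_triMap : ∀ᶠ y in 𝓝 (0 : V × V), 𝒢.op.triMap h Q P y.swap = 𝒢.triMap h P Q y := by
  filter_upwards [bp.eventually_fibres] with y hy
  exact 𝒢.op_tri hy.1 hy.2

theorem triMap_zero : 𝒢.triMap h P Q 0 = h := by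
  simp only [triMap, Prod.fst_zero, Prod.snd_zero, bp.left_zero, bp.right_zero]
  exact 𝒢.tri_self_left rfl

theorem triMap_left : ∀ᶠ p in 𝓝 (0 : V), 𝒢.triMap h P Q (p, 0) = P p := by
  filter_upwards [bp.tgt_left] with p hp
  simp only [triMap, bp.right_zero]
  exact 𝒢.tri_self_right hp

theorem triMap_right : ∀ᶠ q in 𝓝 (0 : V), 𝒢.triMap h P Q (0, q) = Q q := by
  filter_upwards [bp.src_right] with q hq
  simp only [triMap, bp.left_zero]
  exact 𝒢.tri_self_left hq

end Biparam

section

variable {V' : Type*} [NormedAddCommGroup V'] [NormedSpace ℝ V']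

theorem mfderiv_partial_left {F : V × V' → G} {p : V} {q : V'}
    (hF : MDifferentiableAt 𝓘(ℝ, V × V') 𝓘(ℝ, EG) F (p, q)) (w : V) :
    mfderiv 𝓘(ℝ, V) 𝓘(ℝ, EG) (fun p => F (p, q)) p w =
      mfderiv 𝓘(ℝ, V × V') 𝓘(ℝ, EG) F (p, q) (w, 0) := by
  have h1 : HasFDerivAt (fun p : V => (p, q)) (ContinuousLinearMap.inl ℝ V V') p :=
    hasFDerivAt_prodMk_left p q
  have h2 := HasMFDerivAt.comp p (I' := 𝓘(ℝ, V × V')) (f := fun p : V => (p, q))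
    hF.hasMFDerivAt h1.hasMFDerivAt
  have h3 := h2.mfderiv
  exact congrArg (fun A => A w) h3

theorem mfderiv_partial_right {F : V × V' → G} {p : V} {q : V'}
    (hF : MDifferentiableAt 𝓘(ℝ, V × V') 𝓘(ℝ, EG) F (p, q)) (w : V') :
    mfderiv 𝓘(ℝ, V') 𝓘(ℝ, EG) (fun q => F (p, q)) q w =
      mfderiv 𝓘(ℝ, V × V') 𝓘(ℝ, EG) F (p, q) (0, w) := by
  have h1 : HasFDerivAt (fun q : V' => (p, q)) (ContinuousLinearMap.inr ℝ V V') q :=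
    hasFDerivAt_prodMk_right p q
  have h2 := HasMFDerivAt.comp q (I' := 𝓘(ℝ, V × V')) (f := fun q : V' => (p, q))
    hF.hasMFDerivAt h1.hasMFDerivAt
  have h3 := h2.mfderiv
  exact congrArg (fun A => A w) h3

end

namespace Biparam

variable {h : G} {P Q : V → G} (bp : 𝒢.Biparam h P Q)
include bp

theorem mfderiv_left (w : V) : (mfderiv 𝓘(ℝ, V) 𝓘(ℝ, EG) P 0 w : EG) =
    mfderiv 𝓘(ℝ, V × V) 𝓘(ℝ, EG) (𝒢.triMap h P Q) 0 (w, 0) := by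
  have h1 := mfderiv_partial_left (p := (0 : V)) (q := (0 : V))
    (bp.contMDiffAt_triMap.mdifferentiableAt (by simp)) w
  rw [← Prod.zero_eq_mk] at h1
  refine Eq.trans ?_ h1
  rw [Filter.EventuallyEq.mfderiv_eq bp.triMap_left]
  rfl

theorem mfderiv_right (w : V) : (mfderiv 𝓘(ℝ, V) 𝓘(ℝ, EG) Q 0 w : EG) =
    mfderiv 𝓘(ℝ, V × V) 𝓘(ℝ, EG) (𝒢.triMap h P Q) 0 (0, w) := by
  have h1 := mfderiv_partial_right (p := (0 : V)) (q := (0 : V))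
    (bp.contMDiffAt_triMap.mdifferentiableAt (by simp)) w
  rw [← Prod.zero_eq_mk] at h1
  refine Eq.trans ?_ h1
  rw [Filter.EventuallyEq.mfderiv_eq bp.triMap_right]
  rfl

end Biparam

/-- Coordinates, near a unit, of the left translate to the unit of a vertical field. -/
def leftCoord (𝒢 : LieGroupoid EG EM G M) (e : G) (Y : VField EG G) (k : G) : EG :=
  (trivializationAt EG (TangentSpace 𝓘(ℝ, EG) : G → Type _) e).continuousLinearMapAt ℝ
    (𝒢.unit (𝒢.tgt k)) (𝒢.leftToUnit Y k)

/-- Left translation sends the velocity of a map into the fibre to the velocity of the translated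
map, and near `e` the coordinates of the tangent bundle are the derivative of the chart. -/
theorem leftCoord_mfderiv (𝒢 : LieGroupoid EG EM G M) {V : Type*} [NormedAddCommGroup V] [NormedSpace ℝ V]
    {e k : G} (hke : 𝒢.unit (𝒢.tgt k) ∈ (chartAt EG e).source)
    {c : V → G} (hc0 : c 0 = k) (hc : ContMDiffAt 𝓘(ℝ, V) 𝓘(ℝ, EG) ∞ c 0)
    (hs : ∀ᶠ u in 𝓝 0, 𝒢.src (c u) = 𝒢.src k) {Y : VField EG G} {w : V}
    (hY : (Y k : EG) = mfderiv 𝓘(ℝ, V) 𝓘(ℝ, EG) c 0 w) :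
    𝒢.leftCoord e Y k =
      fderiv ℝ (fun u => extChartAt 𝓘(ℝ, EG) e (𝒢.mul (𝒢.inv k) (c u))) 0 w := by
  have hcs : ContMDiffAt 𝓘(ℝ, V) 𝓘(ℝ, EG) ∞ (fun u => 𝒢.mul (𝒢.inv k) (c u)) 0 :=
    𝒢.contMDiffAt_mul contMDiffAt_const hc (hs.mono fun u hu => by rw [𝒢.tgt_inv, hu])
  have e0 : 𝒢.mul (𝒢.inv k) (c 0) = 𝒢.unit (𝒢.tgt k) := by rw [hc0, 𝒢.inv_mul]
  have h1 : (𝒢.leftToUnit Y k : EG) =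
      mfderiv 𝓘(ℝ, V) 𝓘(ℝ, EG) (fun u => 𝒢.mul (𝒢.inv k) (c u)) 0 w := by
    refine Eq.trans ?_ (𝒢.leftT_mfderiv hc0 (𝒢.tgt_inv k) (hc.mdifferentiableAt (by simp)) hs w)
    exact congrArg (fun v : EG => (𝒢.leftT (𝒢.inv k) k v : EG)) hY
  have hφ : MDifferentiableAt 𝓘(ℝ, EG) 𝓘(ℝ, EG) (extChartAt 𝓘(ℝ, EG) e)
      (𝒢.mul (𝒢.inv k) (c 0)) := by
    rw [e0]; exact mdifferentiableAt_extChartAt hke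
  have h2 := mfderiv_comp (I' := 𝓘(ℝ, EG)) (0 : V) hφ (hcs.mdifferentiableAt (by simp))
  rw [mfderiv_eq_fderiv] at h2
  refine Eq.trans ?_ (congrArg (fun A => A w) h2).symm
  have h3 : ∀ (y : G) (_ : y = 𝒢.unit (𝒢.tgt k)) (u : EG),
      (mfderiv 𝓘(ℝ, EG) 𝓘(ℝ, EG) (extChartAt 𝓘(ℝ, EG) e) (𝒢.unit (𝒢.tgt k)) u : EG) =
      mfderiv 𝓘(ℝ, EG) 𝓘(ℝ, EG) (extChartAt 𝓘(ℝ, EG) e) y u := by rintro _ rfl u; rfl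
  refine Eq.trans ?_ (h3 _ e0 _)
  rw [leftCoord, TangentBundle.continuousLinearMapAt_trivializationAt hke]
  exact congrArg (fun v : EG => (mfderiv 𝓘(ℝ, EG) 𝓘(ℝ, EG) (extChartAt 𝓘(ℝ, EG) e)
    (𝒢.unit (𝒢.tgt k)) v : EG)) h1

/-- `leftConn` takes the full derivative of this function on `G`, so restricting it to a `β`-fibre
by the chain rule requires differentiability in all directions. It follows by writing `Y` as a
velocity in a smooth family of parametrized `α`-fibres. -/
theorem contMDiffAt_leftCoord (𝒢 : LieGroupoid EG EM G M) {h : G} {Y : VField EG G}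
    (hYs : ContMDiffAt 𝓘(ℝ, EG) (𝓘(ℝ, EG).prod 𝓘(ℝ, EG)) ∞
      (fun g => (⟨g, Y g⟩ : TangentBundle 𝓘(ℝ, EG) G)) h)
    (hYv : ∀ k, mfderiv 𝓘(ℝ, EG) 𝓘(ℝ, EM) 𝒢.src k (Y k) = 0) :
    ContMDiffAt 𝓘(ℝ, EG) 𝓘(ℝ, EG) ∞ (𝒢.leftCoord (𝒢.unit (𝒢.tgt h)) Y) h := by
  obtain ⟨S⟩ := nonempty_fibreChart 𝒢.isSubmersion_src h
  set e := 𝒢.unit (𝒢.tgt h) with he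
  have hut : Continuous fun k => 𝒢.unit (𝒢.tgt k) :=
    𝒢.contMDiff_unit.continuous.comp 𝒢.contMDiff_tgt.continuous
  have hnear : ∀ᶠ k in 𝓝 h, 𝒢.unit (𝒢.tgt k) ∈ (chartAt EG e).source :=
    hut.continuousAt.eventually ((chartAt EG e).open_source.mem_nhds (mem_chart_source EG e))
  have hD : ∀ᶠ p in 𝓝 (h, (0 : AlgModel EG EM)), p.1 ∈ S.dom ∧ p.2 ∈ S.ball :=
    (S.isOpen_dom.prod S.isOpen_ball).mem_nhds ⟨S.mem_dom, S.zero_mem_ball⟩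
  have h1 : ContMDiffAt (𝓘(ℝ, EG).prod 𝓘(ℝ, AlgModel EG EM)) 𝓘(ℝ, EG) ∞
      (fun p : G × AlgModel EG EM => 𝒢.mul (𝒢.inv p.1) (S.param p)) (h, 0) := by
    refine 𝒢.contMDiffAt_mul (𝒢.contMDiff_inv.contMDiffAt.comp _ contMDiffAt_fst)
      (S.contMDiffAt_param S.mem_dom S.zero_mem_ball) ?_
    filter_upwards [hD] with p hp
    exact (𝒢.tgt_inv _).trans (S.map_param p.1 hp.1 p.2 hp.2).symm
  have e0 : 𝒢.mul (𝒢.inv h) (S.param (h, 0)) = e := by rw [S.param_zero h S.mem_dom, 𝒢.inv_mul]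
  have h2 : ContMDiffAt (𝓘(ℝ, EG).prod 𝓘(ℝ, AlgModel EG EM)) 𝓘(ℝ, EG) ∞
      (fun p : G × AlgModel EG EM => extChartAt 𝓘(ℝ, EG) e (𝒢.mul (𝒢.inv p.1) (S.param p)))
      (h, 0) := by
    refine ContMDiffAt.comp (I' := 𝓘(ℝ, EG)) (h, (0 : AlgModel EG EM))
      (g := extChartAt 𝓘(ℝ, EG) e) ?_ h1
    rw [e0]; exact contMDiffAt_extChartAt
  have h3 := (contMDiffAt_fderiv_snd h2).comp h (f := fun k => (k, (0 : AlgModel EG EM)))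
    (contMDiffAt_id.prodMk contMDiffAt_const)
  have h4 := h3.clm_apply (contMDiffAt_mfderiv_apply_field hYs (S.contMDiffAt_coord S.mem_dom))
  refine h4.congr_of_eventuallyEq ?_
  filter_upwards [S.isOpen_dom.mem_nhds S.mem_dom, hnear] with k hk hke
  exact 𝒢.leftCoord_mfderiv hke (S.param_zero k hk) (S.contMDiffAt_param_right hk S.zero_mem_ball)
    (S.eventually_map_param hk) (S.mfderiv_param_coord hk
      (𝒢.contMDiff_src.mdifferentiableAt (by simp)) (Y k) (hYv k)).symm

/-- At `P(p)` the field `Y` is the velocity of `q ↦ P(p) h⁻¹ Q(q)` in the direction `b(p, 0)`.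
Translated to the unit, this map is `h⁻¹ Q(q)` for every `p`. The function to be differentiated is
thus a fixed linear map applied to `b(p, 0)`, and only the coefficient `b` is differentiated. -/
theorem leftConn_eq {h : G} {P Q : V → G} (bp : 𝒢.Biparam h P Q) {X Y : VField EG G}
    (hYs : ContMDiffAt 𝓘(ℝ, EG) (𝓘(ℝ, EG).prod 𝓘(ℝ, EG)) ∞
      (fun g => (⟨g, Y g⟩ : TangentBundle 𝓘(ℝ, EG) G)) h)
    (hYv : ∀ k, mfderiv 𝓘(ℝ, EG) 𝓘(ℝ, EM) 𝒢.src k (Y k) = 0)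
    {b : V × V → V} (hb : DifferentiableAt ℝ b 0)
    (hY : ∀ᶠ y in 𝓝 (0 : V × V), (Y (𝒢.triMap h P Q y) : EG) =
      mfderiv 𝓘(ℝ, V × V) 𝓘(ℝ, EG) (𝒢.triMap h P Q) y (0, b y))
    {a : V} (hX : (X h : EG) = mfderiv 𝓘(ℝ, V) 𝓘(ℝ, EG) P 0 a) :
    (𝒢.leftConn X Y h : EG) = mfderiv 𝓘(ℝ, V) 𝓘(ℝ, EG) Q 0 (fderiv ℝ b 0 (a, 0)) := by
  set e := 𝒢.unit (𝒢.tgt h) with he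
  set φ := extChartAt 𝓘(ℝ, EG) e with hφ
  set T : V → G := fun q => 𝒢.mul (𝒢.inv h) (Q q) with hT
  have hTs : ContMDiffAt 𝓘(ℝ, V) 𝓘(ℝ, EG) ∞ T 0 :=
    𝒢.contMDiffAt_mul contMDiffAt_const bp.contMDiffAt_right
      (bp.src_right.mono fun u hu => by rw [𝒢.tgt_inv, hu])
  have hT0 : T 0 = e := by simp only [T, bp.right_zero, 𝒢.inv_mul, he]
  have hΨ := 𝒢.contMDiffAt_leftCoord hYs hYv
  have hev : ∀ᶠ p in 𝓝 (0 : V), 𝒢.leftCoord e Y (P p) =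
      fderiv ℝ (fun q => φ (T q)) 0 (b (p, 0)) := by
    have hc0 : Filter.Tendsto (fun p : V => (p, (0 : V))) (𝓝 0) (𝓝 0) := by
      have : ContinuousAt (fun p : V => (p, (0 : V))) 0 := by fun_prop
      exact this
    filter_upwards [hc0.eventually hY, hc0.eventually bp.eventually_contMDiffAt_triMap,
      bp.tgt_left, bp.triMap_left] with p hYp hsp htp hp0
    have hcs : ContMDiffAt 𝓘(ℝ, V) 𝓘(ℝ, EG) ∞ (fun q => 𝒢.triMap h P Q (p, q)) 0 := by
      have h1 : ContMDiffAt 𝓘(ℝ, V) 𝓘(ℝ, V × V) ∞ (fun q : V => (p, q)) 0 :=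
        (contDiff_prodMk_right p).contDiffAt.contMDiffAt
      exact ContMDiffAt.comp (I' := 𝓘(ℝ, V × V)) (0 : V) (g := 𝒢.triMap h P Q) hsp h1
    have hsrc : ∀ᶠ q in 𝓝 (0 : V), 𝒢.src (𝒢.triMap h P Q (p, q)) = 𝒢.src (P p) :=
      bp.src_right.mono fun q hq => 𝒢.src_tri htp hq
    have hYp' : (Y (P p) : EG) =
        mfderiv 𝓘(ℝ, V) 𝓘(ℝ, EG) (fun q => 𝒢.triMap h P Q (p, q)) 0 (b (p, 0)) := by
      have h3 : ∀ (y : G) (_ : y = P p), (Y (P p) : EG) = Y y := by rintro _ rfl; rfl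
      exact ((h3 _ hp0).trans hYp).trans
        (mfderiv_partial_right (hsp.mdifferentiableAt (by simp)) _).symm
    have hke : 𝒢.unit (𝒢.tgt (P p)) ∈ (chartAt EG e).source := by
      rw [htp]; exact mem_chart_source EG e
    rw [𝒢.leftCoord_mfderiv hke hp0 hcs hsrc hYp']
    -- The translated map no longer depends on `p`.
    have hpq : (fun q => φ (𝒢.mul (𝒢.inv (P p)) (𝒢.triMap h P Q (p, q)))) =ᶠ[𝓝 0]
        fun q => φ (T q) := by
      filter_upwards [bp.src_right] with q hq
      exact congrArg φ (𝒢.inv_mul_tri htp hq)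
    exact congrArg (fun A : V →L[ℝ] EG => A (b (p, 0))) hpq.fderiv_eq
  have hΨd : MDifferentiableAt 𝓘(ℝ, EG) 𝓘(ℝ, EG) (𝒢.leftCoord e Y) (P 0) := by
    rw [bp.left_zero]; exact hΨ.mdifferentiableAt (by simp)
  have hPd : MDifferentiableAt 𝓘(ℝ, V) 𝓘(ℝ, EG) P 0 :=
    bp.contMDiffAt_left.mdifferentiableAt (by simp)
  have hchain := mfderiv_comp (I := 𝓘(ℝ, V)) (I' := 𝓘(ℝ, EG)) (I'' := 𝓘(ℝ, EG)) (0 : V) hΨd hPd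
  have hev' : (𝒢.leftCoord e Y ∘ P) =ᶠ[𝓝 0]
      fun p => fderiv ℝ (fun q => φ (T q)) 0 (b (p, 0)) := hev
  rw [hev'.mfderiv_eq, mfderiv_eq_fderiv] at hchain
  have hb1 : HasFDerivAt (fun p : V => b (p, 0))
      ((fderiv ℝ b 0).comp (ContinuousLinearMap.inl ℝ V V)) 0 :=
    HasFDerivAt.comp (0 : V) (f := fun p : V => (p, (0 : V))) hb.hasFDerivAt
      (hasFDerivAt_prodMk_left 0 0)
  have hb2 := ((fderiv ℝ (fun q => φ (T q)) 0).hasFDerivAt.comp (0 : V) hb1).fderiv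
  have hK : (mfderiv 𝓘(ℝ, EG) 𝓘(ℝ, EG) (𝒢.leftCoord e Y) h (X h) : EG) =
      fderiv ℝ (fun q => φ (T q)) 0 (fderiv ℝ b 0 (a, 0)) := by
    have h3 : ∀ (y : G) (_ : y = h) (u : EG),
        (mfderiv 𝓘(ℝ, EG) 𝓘(ℝ, EG) (𝒢.leftCoord e Y) h u : EG) =
        mfderiv 𝓘(ℝ, EG) 𝓘(ℝ, EG) (𝒢.leftCoord e Y) y u := by rintro _ rfl u; rfl
    refine (congrArg (fun u : EG => (mfderiv 𝓘(ℝ, EG) 𝓘(ℝ, EG) (𝒢.leftCoord e Y) h u : EG))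
      hX).trans ?_
    refine (h3 _ bp.left_zero _).trans ?_
    refine (congrArg (fun A => A a) hchain).symm.trans ?_
    exact congrArg (fun A => A a) hb2
  set w : V := fderiv ℝ b 0 (a, 0) with hw
  have hTd := hTs.mdifferentiableAt (n := ∞) (by simp)
  have hφd : MDifferentiableAt 𝓘(ℝ, EG) 𝓘(ℝ, EG) φ (T 0) := by
    rw [hT0]; exact mdifferentiableAt_extChartAt (mem_chart_source EG e)
  have hK2 : fderiv ℝ (fun q => φ (T q)) 0 w =
      (trivializationAt EG (TangentSpace 𝓘(ℝ, EG) : G → Type _) e).continuousLinearMapAt ℝ e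
        (mfderiv 𝓘(ℝ, V) 𝓘(ℝ, EG) T 0 w : EG) := by
    have h2 := mfderiv_comp (I' := 𝓘(ℝ, EG)) (0 : V) hφd hTd
    rw [mfderiv_eq_fderiv] at h2
    refine (congrArg (fun A => A w) h2).trans ?_
    rw [TangentBundle.continuousLinearMapAt_trivializationAt (mem_chart_source EG e)]
    have h3 : ∀ (y : G) (_ : y = e) (u : EG),
        (mfderiv 𝓘(ℝ, EG) 𝓘(ℝ, EG) φ y u : EG) =
        mfderiv 𝓘(ℝ, EG) 𝓘(ℝ, EG) φ e u := by rintro _ rfl u; rfl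
    exact h3 _ hT0 _
  -- Translating back by `h` turns `T = h⁻¹ Q` into `Q`.
  have hfin : (𝒢.leftT h e (mfderiv 𝓘(ℝ, V) 𝓘(ℝ, EG) T 0 w : EG) : EG) =
      mfderiv 𝓘(ℝ, V) 𝓘(ℝ, EG) Q 0 w := by
    refine (𝒢.leftT_mfderiv hT0 (𝒢.src_unit _).symm hTd ?_ w).trans ?_
    · filter_upwards [bp.src_right] with q hq
      rw [𝒢.src_inv_mul hq, he, 𝒢.src_unit]
    · have hev2 : (fun u => 𝒢.mul h (T u)) =ᶠ[𝓝 0] Q := by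
        filter_upwards [bp.src_right] with q hq
        exact 𝒢.mul_inv_cancel_left hq.symm
      rw [hev2.mfderiv_eq]
      rfl
  refine Eq.trans ?_ hfin
  change (𝒢.leftT h e ((trivializationAt EG (TangentSpace 𝓘(ℝ, EG) : G → Type _) e).symmL ℝ e
    (mfderiv 𝓘(ℝ, EG) 𝓘(ℝ, EG) (𝒢.leftCoord e Y) h (X h) : EG)) : EG) = _
  rw [hK, hK2]
  exact congrArg (fun u : EG => (𝒢.leftT h e u : EG))
    (Bundle.Trivialization.symmL_continuousLinearMapAt (R := ℝ)
      (trivializationAt EG (TangentSpace 𝓘(ℝ, EG) : G → Type _) e)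
      (FiberBundle.mem_baseSet_trivializationAt EG (TangentSpace 𝓘(ℝ, EG) : G → Type _) e) _)

end LieGroupoid

/-! ### Sections as vector fields on the parameter space; bracket, anchor and `Ω_L` there. -/

namespace LieGroupoid

variable {EG EM G M : Type*}
  [NormedAddCommGroup EG] [NormedSpace ℝ EG] [FiniteDimensional ℝ EG]
  [NormedAddCommGroup EM] [NormedSpace ℝ EM] [FiniteDimensional ℝ EM]
  [TopologicalSpace G] [ChartedSpace EG G] [IsManifold 𝓘(ℝ, EG) ∞ G]
  [TopologicalSpace M] [ChartedSpace EM M] [IsManifold 𝓘(ℝ, EM) ∞ M]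
  (𝒢 : LieGroupoid EG EM G M)
  {V : Type*} [NormedAddCommGroup V] [NormedSpace ℝ V]

/-- The two components exchanged: a section of `Vβ ⊕ Vα` for the opposite groupoid. -/
def FieldPair.swap (Z : FieldPair EG G) : FieldPair EG G := ⟨Z.aPart, Z.bPart⟩

theorem IsSection.swap {𝒢 : LieGroupoid EG EM G M} {Z : FieldPair EG G} (hZ : 𝒢.IsSection Z) :
    𝒢.op.IsSection Z.swap :=
  ⟨hZ.contMDiff_aPart, hZ.contMDiff_bPart, hZ.src_aPart, hZ.tgt_bPart⟩

/-- The vector field `z` on the parameter space is related to the section `Z`. -/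
structure PullsBack (h : G) (P Q : V → G) (Z : FieldPair EG G) (z : V × V → V × V) : Prop where
  smooth : ∀ᶠ y in 𝓝 0, ContDiffAt ℝ ∞ z y
  bPart : ∀ᶠ y in 𝓝 (0 : V × V), (Z.bPart (𝒢.triMap h P Q y) : EG) =
    mfderiv 𝓘(ℝ, V × V) 𝓘(ℝ, EG) (𝒢.triMap h P Q) y ((z y).1, 0)
  aPart : ∀ᶠ y in 𝓝 (0 : V × V), (Z.aPart (𝒢.triMap h P Q y) : EG) =
    mfderiv 𝓘(ℝ, V × V) 𝓘(ℝ, EG) (𝒢.triMap h P Q) y (0, (z y).2)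

variable {𝒢} {h : G} {P Q : V → G}

theorem Biparam.mfderiv_op_triMap (bp : 𝒢.Biparam h P Q) :
    ∀ᶠ y in 𝓝 (0 : V × V), ∀ v : V × V,
      (mfderiv 𝓘(ℝ, V × V) 𝓘(ℝ, EG) (𝒢.op.triMap h Q P) y v : EG) =
        mfderiv 𝓘(ℝ, V × V) 𝓘(ℝ, EG) (𝒢.triMap h P Q) y.swap v.swap := by
  have hc0 : Filter.Tendsto (Prod.swap : V × V → V × V) (𝓝 0) (𝓝 0) :=
    continuous_swap.tendsto (0 : V × V)
  filter_upwards [bp.op.op_triMap.eventually_nhds, hc0.eventually bp.eventually_mdifferentiableAt]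
    with y hy hd v
  have h1 : (𝒢.triMap h P Q ∘ Prod.swap) =ᶠ[𝓝 y] 𝒢.op.triMap h Q P := hy
  have h2 : HasFDerivAt (Prod.swap : V × V → V × V)
      ((ContinuousLinearMap.snd ℝ V V).prod (ContinuousLinearMap.fst ℝ V V)) y :=
    ((ContinuousLinearMap.snd ℝ V V).prod (ContinuousLinearMap.fst ℝ V V)).hasFDerivAt
  have h3 := (HasMFDerivAt.comp y (I' := 𝓘(ℝ, V × V)) hd.hasMFDerivAt h2.hasMFDerivAt).mfderiv
  rw [h1.mfderiv_eq] at h3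
  exact congrArg (fun A : V × V →L[ℝ] EG => A v) h3

theorem PullsBack.contDiffAt {Z : FieldPair EG G} {z : V × V → V × V}
    (hz : 𝒢.PullsBack h P Q Z z) : ContDiffAt ℝ ∞ z 0 := hz.smooth.self_of_nhds

theorem PullsBack.op {Z : FieldPair EG G} {z : V × V → V × V} (bp : 𝒢.Biparam h P Q)
    (hz : 𝒢.PullsBack h P Q Z z) :
    𝒢.op.PullsBack h Q P Z.swap (fun y => (z y.swap).swap) := by
  have hc0 : Filter.Tendsto (Prod.swap : V × V → V × V) (𝓝 0) (𝓝 0) :=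
    continuous_swap.tendsto (0 : V × V)
  have h3 : ∀ (T : VField EG G) {y y' : G} (_ : y = y'), (T y : EG) = T y' := by
    rintro T y _ rfl; rfl
  refine ⟨?_, ?_, ?_⟩
  · have h0 : ContDiff ℝ ∞ (Prod.swap : V × V → V × V) := contDiff_snd.prodMk contDiff_fst
    filter_upwards [hc0.eventually hz.smooth] with y hy
    exact h0.contDiffAt.comp y (ContDiffAt.comp y (g := z) (f := Prod.swap) hy h0.contDiffAt)
  · filter_upwards [hc0.eventually hz.aPart, bp.op.op_triMap, bp.mfderiv_op_triMap] with y h1 h2 h4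
    exact ((h3 Z.aPart h2.symm).trans h1).trans (h4 ((z y.swap).2, 0)).symm
  · filter_upwards [hc0.eventually hz.bPart, bp.op.op_triMap, bp.mfderiv_op_triMap] with y h1 h2 h4
    exact ((h3 Z.bPart h2.symm).trans h1).trans (h4 (0, (z y.swap).1)).symm

/-- Along the `α`-fibre parametrized by `Q`, the bracket `[Y, Y']` contributes the `q`-derivatives
of the `q`-coefficients. The terms `∇_X Y'` and `∇_{X'} Y` contribute their `p`-derivatives.
Together these make the second component of the Lie bracket of `z` and `w`. -/
theorem aPart_prolBracket_eq (bp : 𝒢.Biparam h P Q) {Z W : FieldPair EG G}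
    (hZ : 𝒢.IsSection Z) (hW : 𝒢.IsSection W) {z w : V × V → V × V}
    (hz : 𝒢.PullsBack h P Q Z z) (hw : 𝒢.PullsBack h P Q W w) :
    ((𝒢.prolBracket Z W).aPart h : EG) = mfderiv 𝓘(ℝ, V) 𝓘(ℝ, EG) Q 0
      (VectorField.lieBracket ℝ z w 0).2 := by
  have hc : Filter.Tendsto (fun q : V => ((0 : V), q)) (𝓝 0) (𝓝 0) := by
    have : ContinuousAt (fun q : V => ((0 : V), q)) 0 := by fun_prop
    exact this
  have hzd := hz.contDiffAt.differentiableAt (by simp)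
  have hwd := hw.contDiffAt.differentiableAt (by simp)
  have h3 : ∀ (T : VField EG G) {y y' : G} (_ : y = y'), (T y : EG) = T y' := by
    rintro T y _ rfl; rfl
  have hX : ∀ {Z : FieldPair EG G} {z : V × V → V × V}, 𝒢.PullsBack h P Q Z z →
      (Z.bPart h : EG) = mfderiv 𝓘(ℝ, V) 𝓘(ℝ, EG) P 0 (z 0).1 := fun {Z z} hz =>
    ((h3 Z.bPart bp.triMap_zero.symm).trans hz.bPart.self_of_nhds).trans (bp.mfderiv_left _).symm
  have c1 := leftConn_eq bp hW.contMDiff_aPart.contMDiffAt hW.src_aPart hwd.snd hw.aPart (hX hz)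
  have c2 := leftConn_eq bp hZ.contMDiff_aPart.contMDiffAt hZ.src_aPart hzd.snd hz.aPart (hX hw)
  have hQY : ∀ {Z : FieldPair EG G} {z : V × V → V × V}, 𝒢.PullsBack h P Q Z z →
      ∀ᶠ u in 𝓝 (0 : V), (Z.aPart (Q u) : EG) =
        mfderiv 𝓘(ℝ, V) 𝓘(ℝ, EG) Q u (z (0, u)).2 := fun {Z z} hz => by
    filter_upwards [hc.eventually hz.aPart, hc.eventually bp.eventually_mdifferentiableAt,
      bp.triMap_right.eventually_nhds] with u h1 h2 h4
    refine ((h3 Z.aPart h4.self_of_nhds.symm).trans h1).trans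
      ((mfderiv_partial_right h2 _).symm.trans ?_)
    have h5 : (fun q => 𝒢.triMap h P Q (0, q)) =ᶠ[𝓝 u] Q := h4
    exact congrArg (fun A : V →L[ℝ] EG => A (z (0, u)).2) h5.mfderiv_eq
  have hd : ∀ {Z : FieldPair EG G}, 𝒢.IsSection Z →
      MDifferentiableAt 𝓘(ℝ, EG) (𝓘(ℝ, EG).prod 𝓘(ℝ, EG))
      (fun x => (⟨x, Z.aPart x⟩ : TangentBundle 𝓘(ℝ, EG) G)) (Q 0) := fun hZ =>
    hZ.contMDiff_aPart.contMDiffAt.mdifferentiableAt (by simp)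
  have hder : ∀ {z : V × V → V × V}, DifferentiableAt ℝ z 0 → HasFDerivAt (fun u : V => (z (0, u)).2)
      (((ContinuousLinearMap.snd ℝ V V).comp (fderiv ℝ z 0)).comp (ContinuousLinearMap.inr ℝ V V))
      0 := fun {z} hz =>
    HasFDerivAt.comp (0 : V) (f := fun q : V => ((0 : V), q)) (g := fun y => (z y).2)
      hz.hasFDerivAt.snd (hasFDerivAt_prodMk_right 0 0)
  have c3 := mlieBracket_eq_of_related bp.contMDiffAt_right (hd hZ) (hd hW)
    (hder hzd).differentiableAt (hder hwd).differentiableAt (hQY hz) (hQY hw)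
  rw [(hder hzd).fderiv, (hder hwd).fderiv] at c3
  have c3' : (VectorField.mlieBracket 𝓘(ℝ, EG) Z.aPart W.aPart h : EG) = _ :=
    (h3 _ bp.right_zero.symm).trans c3
  have c4 : ∀ A B C : EG, (VectorField.mlieBracket 𝓘(ℝ, EG) Z.aPart W.aPart h : EG) = A →
      (𝒢.leftConn Z.bPart W.aPart h : EG) = B → (𝒢.leftConn W.bPart Z.aPart h : EG) = C →
      ((𝒢.prolBracket Z W).aPart h : EG) = A + B - C := by rintro _ _ _ rfl rfl rfl; rfl
  refine (c4 _ _ _ c3' c1 c2).trans ?_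
  set A : V →L[ℝ] EG := mfderiv 𝓘(ℝ, V) 𝓘(ℝ, EG) Q 0
  refine (congrArg₂ (· - ·) (A.map_add _ _).symm rfl).trans ((A.map_sub _ _).symm.trans ?_)
  congr 1
  rw [hzd.hasFDerivAt.snd.fderiv, hwd.hasFDerivAt.snd.fderiv, VectorField.lieBracket]
  have e1 : ∀ T : V × V →L[ℝ] V × V, ∀ v : V × V,
      (T v).2 = (T (v.1, 0)).2 + (T (0, v.2)).2 := by
    intro T v
    rw [← Prod.snd_add, ← map_add]; simp
  rw [Prod.snd_sub, e1 _ (z 0), e1 _ (w 0)]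
  simp only [← Prod.zero_eq_mk, ContinuousLinearMap.comp_apply, ContinuousLinearMap.inr_apply,
    ContinuousLinearMap.coe_snd']
  abel

theorem bPart_prolBracket_eq (bp : 𝒢.Biparam h P Q) {Z W : FieldPair EG G}
    (hZ : 𝒢.IsSection Z) (hW : 𝒢.IsSection W) {z w : V × V → V × V}
    (hz : 𝒢.PullsBack h P Q Z z) (hw : 𝒢.PullsBack h P Q W w) :
    ((𝒢.prolBracket Z W).bPart h : EG) = mfderiv 𝓘(ℝ, V) 𝓘(ℝ, EG) P 0
      (VectorField.lieBracket ℝ z w 0).1 := by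
  have h1 := aPart_prolBracket_eq bp.op hZ.swap hW.swap (hz.op bp) (hw.op bp)
  -- Passing to the opposite groupoid exchanges `leftConn` and `rightConn` by definition, so the
  -- formula for the other component applies with the factors swapped.
  refine Eq.trans (show _ = ((𝒢.op.prolBracket Z.swap W.swap).aPart h : EG) from rfl)
    (h1.trans ?_)
  refine congrArg (mfderiv 𝓘(ℝ, V) 𝓘(ℝ, EG) P 0) ?_
  have hS : HasFDerivAt (Prod.swap : V × V → V × V)
      ((ContinuousLinearMap.snd ℝ V V).prod (ContinuousLinearMap.fst ℝ V V)) 0 :=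
    ((ContinuousLinearMap.snd ℝ V V).prod (ContinuousLinearMap.fst ℝ V V)).hasFDerivAt
  have hder : ∀ {z : V × V → V × V}, ContDiffAt ℝ ∞ z 0 →
      HasFDerivAt (fun y : V × V => (z y.swap).swap)
      (((ContinuousLinearMap.snd ℝ V V).prod (ContinuousLinearMap.fst ℝ V V)).comp
        ((fderiv ℝ z 0).comp
        ((ContinuousLinearMap.snd ℝ V V).prod (ContinuousLinearMap.fst ℝ V V)))) 0 := fun {z} hz =>
    ((ContinuousLinearMap.snd ℝ V V).prod (ContinuousLinearMap.fst ℝ V V)).hasFDerivAt.comp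
      (0 : V × V) (HasFDerivAt.comp (0 : V × V) (f := Prod.swap) (g := z)
      (hz.differentiableAt (by simp)).hasFDerivAt hS)
  rw [VectorField.lieBracket, VectorField.lieBracket, (hder hz.contDiffAt).fderiv,
    (hder hw.contDiffAt).fderiv]
  simp [Prod.swap]
  rfl

/-- The derivative of `triMap` maps `z 0` to the sum of its values on the two components, that is,
to `X + Y`. On the parameter space the anchor is therefore the identity. -/
theorem anchorDeriv_eq (bp : 𝒢.Biparam h P Q) {Z : FieldPair EG G} {z : V × V → V × V}
    (hz : 𝒢.PullsBack h P Q Z z) {f : G → ℝ} (hf : MDifferentiableAt 𝓘(ℝ, EG) 𝓘(ℝ, ℝ) f h) :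
    anchorDeriv Z f h = fderiv ℝ (f ∘ 𝒢.triMap h P Q) 0 (z 0) := by
  set F := 𝒢.triMap h P Q with hF
  have hF0 : F 0 = h := bp.triMap_zero
  have hFd : MDifferentiableAt 𝓘(ℝ, V × V) 𝓘(ℝ, EG) F 0 :=
    bp.eventually_mdifferentiableAt.self_of_nhds
  have h3 : ∀ (T : VField EG G) {y y' : G} (_ : y = y'), (T y : EG) = T y' := by
    rintro T y _ rfl; rfl
  rw [← hF0] at hf
  have h4 := mfderiv_comp (I' := 𝓘(ℝ, EG)) (0 : V × V) hf hFd
  rw [mfderiv_eq_fderiv] at h4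
  refine Eq.trans ?_ (congrArg (fun A : V × V →L[ℝ] ℝ => A (z 0)) h4).symm
  have h5 : (mfderiv 𝓘(ℝ, V × V) 𝓘(ℝ, EG) F 0 (z 0) : EG) = (Z.bPart h : EG) + Z.aPart h := by
    rw [show (Z.bPart h : EG) = _ from (h3 Z.bPart hF0.symm).trans hz.bPart.self_of_nhds,
      show (Z.aPart h : EG) = _ from (h3 Z.aPart hF0.symm).trans hz.aPart.self_of_nhds]
    refine Eq.trans ?_ (ContinuousLinearMap.map_add
      (mfderiv 𝓘(ℝ, V × V) 𝓘(ℝ, EG) F 0 : V × V →L[ℝ] EG) _ _)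
    exact congrArg (mfderiv 𝓘(ℝ, V × V) 𝓘(ℝ, EG) F 0 : V × V →L[ℝ] EG)
      ((Prod.fst_add_snd (z 0)).symm)
  have h6 : ∀ {y y' : G} (_ : y = y') (u : EG), (mfderiv 𝓘(ℝ, EG) 𝓘(ℝ, ℝ) f y u : ℝ) =
    mfderiv 𝓘(ℝ, EG) 𝓘(ℝ, ℝ) f y' u := by rintro y _ rfl u; rfl
  exact (h6 hF0.symm _).trans
    (congrArg (fun u : EG => (mfderiv 𝓘(ℝ, EG) 𝓘(ℝ, ℝ) f (F 0) u : ℝ)) h5.symm)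

/-- The value of `Ω_L` in the coordinates given by `(p, q) ↦ P(p) h⁻¹ Q(q)`. -/
theorem omegaL_eq (bp : 𝒢.Biparam h P Q) {Z W : FieldPair EG G}
    (hZ : 𝒢.IsSection Z) (hW : 𝒢.IsSection W) {z w : V × V → V × V}
    (hz : 𝒢.PullsBack h P Q Z z) (hw : 𝒢.PullsBack h P Q W w)
    {L : G → ℝ} (hL : ContMDiff 𝓘(ℝ, EG) 𝓘(ℝ, ℝ) ∞ L) :
    𝒢.omegaL L Z W h =
      fderiv ℝ (fderiv ℝ (L ∘ 𝒢.triMap h P Q)) 0 ((w 0).1, 0) (0, (z 0).2) -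
      fderiv ℝ (fderiv ℝ (L ∘ 𝒢.triMap h P Q)) 0 ((z 0).1, 0) (0, (w 0).2) := by
  set F := 𝒢.triMap h P Q with hF
  set ℓ : V × V → ℝ := L ∘ F with hℓ
  have hF0 : F 0 = h := bp.triMap_zero
  have hℓs : ContDiffAt ℝ ∞ ℓ 0 :=
    (ContMDiffAt.comp (I' := 𝓘(ℝ, EG)) (0 : V × V) hL.contMDiffAt bp.contMDiffAt_triMap).contDiffAt
  have hLd : ∀ x, MDifferentiableAt 𝓘(ℝ, EG) 𝓘(ℝ, ℝ) L x :=
    fun x => hL.contMDiffAt.mdifferentiableAt (by simp)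
  have hFd : MDifferentiableAt 𝓘(ℝ, V × V) 𝓘(ℝ, EG) F 0 :=
    bp.eventually_mdifferentiableAt.self_of_nhds
  have hdd : DifferentiableAt ℝ (fderiv ℝ ℓ) 0 :=
    (hℓs.fderiv_right (m := ∞) (by simp)).differentiableAt (by simp)
  have h3 : ∀ (T : VField EG G) {y y' : G} (_ : y = y'), (T y : EG) = T y' := by
    rintro T y _ rfl; rfl
  have hθ : ∀ {W : FieldPair EG G} {w : V × V → V × V}, 𝒢.PullsBack h P Q W w →
      (thetaPlus L W ∘ F) =ᶠ[𝓝 0] fun y => fderiv ℝ ℓ y (0, (w y).2) := fun {W w} hw => by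
    filter_upwards [hw.aPart, bp.eventually_mdifferentiableAt] with y h1 h2
    have h4 := mfderiv_comp (I' := 𝓘(ℝ, EG)) y (hLd (F y)) h2
    rw [mfderiv_eq_fderiv] at h4
    refine Eq.trans ?_ (congrArg (fun A : V × V →L[ℝ] ℝ => A (0, (w y).2)) h4).symm
    exact congrArg (fun u : EG => (mfderiv 𝓘(ℝ, EG) 𝓘(ℝ, ℝ) L (F y) u : ℝ)) h1
  have hθd : ∀ {W : FieldPair EG G}, 𝒢.IsSection W →
      MDifferentiableAt 𝓘(ℝ, EG) 𝓘(ℝ, ℝ) (thetaPlus L W) h := fun hW =>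
    (contMDiffAt_mfderiv_apply_field hW.contMDiff_aPart.contMDiffAt hL.contMDiffAt).mdifferentiableAt
      (by simp)
  -- The product rule for `∂_q ℓ` paired with the `q`-coefficient of `w`. The terms with a first
  -- derivative of `ℓ` will cancel against `Θ_L^+` of the bracket.
  have hmain : ∀ {Z W : FieldPair EG G} {z w : V × V → V × V}, 𝒢.PullsBack h P Q Z z →
      𝒢.PullsBack h P Q W w → 𝒢.IsSection W →
      anchorDeriv Z (thetaPlus L W) h = fderiv ℝ (fderiv ℝ ℓ) 0 (z 0) (0, (w 0).2) +
        fderiv ℝ ℓ 0 (0, (fderiv ℝ w 0 (z 0)).2) := fun {Z W z w} hz hw hW => by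
    rw [anchorDeriv_eq bp hz (hθd hW), (hθ hw).fderiv_eq]
    have hw1 : HasFDerivAt (fun y => ((0 : V), (w y).2)) ((0 : V × V →L[ℝ] V).prod
        ((ContinuousLinearMap.snd ℝ V V).comp (fderiv ℝ w 0))) 0 :=
      (hasFDerivAt_const _ _).prodMk (hw.contDiffAt.differentiableAt (by simp)).hasFDerivAt.snd
    rw [fderiv_clm_apply hdd hw1.differentiableAt, hw1.fderiv]
    simp [add_comm]
  have hbr : thetaPlus L (𝒢.prolBracket Z W) h =
      fderiv ℝ ℓ 0 (0, (VectorField.lieBracket ℝ z w 0).2) := by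
    have h4 := mfderiv_comp (I' := 𝓘(ℝ, EG)) (0 : V × V) (hLd (F 0)) hFd
    rw [mfderiv_eq_fderiv] at h4
    refine Eq.trans ?_ (congrArg (fun A : V × V →L[ℝ] ℝ =>
      A (0, (VectorField.lieBracket ℝ z w 0).2)) h4).symm
    have h6 : ∀ {y y' : G} (_ : y = y') (u : EG), (mfderiv 𝓘(ℝ, EG) 𝓘(ℝ, ℝ) L y u : ℝ) =
      mfderiv 𝓘(ℝ, EG) 𝓘(ℝ, ℝ) L y' u := by rintro y _ rfl u; rfl
    refine (h6 hF0.symm _).trans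
      (congrArg (fun u : EG => (mfderiv 𝓘(ℝ, EG) 𝓘(ℝ, ℝ) L (F 0) u : ℝ)) ?_)
    exact (aPart_prolBracket_eq bp hZ hW hz hw).trans (bp.mfderiv_right _)
  have hsymm : IsSymmSndFDerivAt ℝ ℓ 0 := hℓs.isSymmSndFDerivAt
    (by rw [minSmoothness_of_isRCLikeNormedField]; exact ENat.LEInfty.out)
  rw [omegaL, dOne, hmain hz hw hW, hmain hw hz hZ, hbr, VectorField.lieBracket]
  have e1 : ∀ T : V × V →L[ℝ] V × V →L[ℝ] ℝ, ∀ v u : V × V,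
      T v u = T (v.1, 0) u + T (0, v.2) u := by
    intro T v u
    rw [← add_apply, ← map_add]; simp
  have e2 : fderiv ℝ ℓ 0 (0, (fderiv ℝ w 0 (z 0) - fderiv ℝ z 0 (w 0)).2) =
      fderiv ℝ ℓ 0 (0, (fderiv ℝ w 0 (z 0)).2) - fderiv ℝ ℓ 0 (0, (fderiv ℝ z 0 (w 0)).2) := by
    rw [← map_sub]; simp
  -- Split the first argument of the Hessian into its `p`- and `q`-parts. The pure `q`-part is
  -- symmetric and cancels, so only mixed derivatives survive.
  rw [e2, e1 _ (z 0), e1 _ (w 0), hsymm.eq (0, (z 0).2) (0, (w 0).2)]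
  ring

end LieGroupoid

/-! ### Change of centre: from formulas at `h` to formulas near `h`. -/

namespace LieGroupoid

variable {EG EM G M : Type*}
  [NormedAddCommGroup EG] [NormedSpace ℝ EG] [FiniteDimensional ℝ EG]
  [NormedAddCommGroup EM] [NormedSpace ℝ EM] [FiniteDimensional ℝ EM]
  [TopologicalSpace G] [ChartedSpace EG G] [IsManifold 𝓘(ℝ, EG) ∞ G]
  [TopologicalSpace M] [ChartedSpace EM M] [IsManifold 𝓘(ℝ, EM) ∞ M]
  (𝒢 : LieGroupoid EG EM G M)

section Shift

variable {V : Type*} [NormedAddCommGroup V] [NormedSpace ℝ V]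
variable {𝒢} {h : G} {P Q : V → G}

/-- By `tri_tri`, recentring at the value at `y₀` amounts to a translation by `y₀` in `V × V`.
Identities proved at the centre therefore hold at all nearby parameters. -/
theorem Biparam.shift_triMap (bp : 𝒢.Biparam h P Q) :
    ∀ᶠ y₀ in 𝓝 (0 : V × V), ∀ᶠ y in 𝓝 (0 : V × V),
      𝒢.triMap (𝒢.triMap h P Q y₀) (fun s => 𝒢.triMap h P Q (y₀.1 + s, y₀.2))
        (fun t => 𝒢.triMap h P Q (y₀.1, y₀.2 + t)) y = 𝒢.triMap h P Q (y₀ + y) := by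
  filter_upwards [bp.eventually_fibres.eventually_nhds] with y₀ hy
  have hc : Filter.Tendsto (fun y : V × V => y₀ + y) (𝓝 0) (𝓝 y₀) := by
    have : ContinuousAt (fun y : V × V => y₀ + y) 0 := by fun_prop
    simpa [ContinuousAt] using this
  filter_upwards [hc.eventually hy] with y hy'
  exact 𝒢.tri_tri hy'.1 hy'.2 hy.self_of_nhds.1 hy.self_of_nhds.2

theorem Biparam.shift (bp : 𝒢.Biparam h P Q) :
    ∀ᶠ y₀ in 𝓝 (0 : V × V), 𝒢.Biparam (𝒢.triMap h P Q y₀)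
      (fun s => 𝒢.triMap h P Q (y₀.1 + s, y₀.2)) (fun t => 𝒢.triMap h P Q (y₀.1, y₀.2 + t)) := by
  filter_upwards [bp.eventually_fibres.eventually_nhds,
    bp.eventually_contMDiffAt_triMap.eventually_nhds] with y₀ hy hs
  have hc1 : Filter.Tendsto (fun s : V => (y₀.1 + s, y₀.2)) (𝓝 0) (𝓝 y₀) := by
    have : ContinuousAt (fun s : V => (y₀.1 + s, y₀.2)) 0 := by fun_prop
    simpa [ContinuousAt] using this
  have hc2 : Filter.Tendsto (fun s : V => (y₀.1, y₀.2 + s)) (𝓝 0) (𝓝 y₀) := by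
    have : ContinuousAt (fun s : V => (y₀.1, y₀.2 + s)) 0 := by fun_prop
    simpa [ContinuousAt] using this
  refine ⟨by simp, by simp, ?_, ?_, ?_, ?_⟩
  · filter_upwards [hc1.eventually hs] with s hs
    have h1 : ContMDiffAt 𝓘(ℝ, V) 𝓘(ℝ, V × V) ∞ (fun s : V => (y₀.1 + s, y₀.2)) s :=
      (contDiffAt_const.add contDiffAt_id |>.prodMk contDiffAt_const).contMDiffAt
    exact ContMDiffAt.comp (I' := 𝓘(ℝ, V × V)) s (g := 𝒢.triMap h P Q) hs h1
  · filter_upwards [hc2.eventually hs] with s hs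
    have h1 : ContMDiffAt 𝓘(ℝ, V) 𝓘(ℝ, V × V) ∞ (fun s : V => (y₀.1, y₀.2 + s)) s :=
      (contDiffAt_const.prodMk (contDiffAt_const.add contDiffAt_id)).contMDiffAt
    exact ContMDiffAt.comp (I' := 𝓘(ℝ, V × V)) s (g := 𝒢.triMap h P Q) hs h1
  · filter_upwards [hc1.eventually hy] with s hs
    exact (𝒢.tgt_tri hs.1 hs.2).trans (𝒢.tgt_tri hy.self_of_nhds.1 hy.self_of_nhds.2).symm
  · filter_upwards [hc2.eventually hy] with s hs
    exact (𝒢.src_tri hs.1 hs.2).trans (𝒢.src_tri hy.self_of_nhds.1 hy.self_of_nhds.2).symm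

theorem Biparam.mfderiv_shift_triMap (bp : 𝒢.Biparam h P Q) :
    ∀ᶠ y₀ in 𝓝 (0 : V × V), ∀ᶠ y in 𝓝 (0 : V × V), ∀ v : V × V,
      (mfderiv 𝓘(ℝ, V × V) 𝓘(ℝ, EG) (𝒢.triMap (𝒢.triMap h P Q y₀)
        (fun s => 𝒢.triMap h P Q (y₀.1 + s, y₀.2))
        (fun t => 𝒢.triMap h P Q (y₀.1, y₀.2 + t))) y v : EG) =
      mfderiv 𝓘(ℝ, V × V) 𝓘(ℝ, EG) (𝒢.triMap h P Q) (y₀ + y) v := by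
  filter_upwards [bp.shift_triMap, bp.eventually_mdifferentiableAt.eventually_nhds] with y₀ hy hd
  have hc : Filter.Tendsto (fun y : V × V => y₀ + y) (𝓝 0) (𝓝 y₀) := by
    have : ContinuousAt (fun y : V × V => y₀ + y) 0 := by fun_prop
    simpa [ContinuousAt] using this
  filter_upwards [hy.eventually_nhds, hc.eventually hd] with y hy' hd' v
  have h1 : HasFDerivAt (fun y : V × V => y₀ + y) (ContinuousLinearMap.id ℝ (V × V)) y :=
    (hasFDerivAt_id y).const_add y₀
  have h2 := (HasMFDerivAt.comp y (I' := 𝓘(ℝ, V × V)) (f := fun y : V × V => y₀ + y)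
    hd'.hasMFDerivAt h1.hasMFDerivAt).mfderiv
  have h3 : (𝒢.triMap (𝒢.triMap h P Q y₀)
        (fun s => 𝒢.triMap h P Q (y₀.1 + s, y₀.2))
        (fun t => 𝒢.triMap h P Q (y₀.1, y₀.2 + t))) =ᶠ[𝓝 y]
        𝒢.triMap h P Q ∘ fun y : V × V => y₀ + y := hy'
  rw [← h3.mfderiv_eq] at h2
  exact congrArg (fun A : V × V →L[ℝ] EG => A v) h2

theorem PullsBack.shift {Z : FieldPair EG G} {z : V × V → V × V} (bp : 𝒢.Biparam h P Q)
    (hz : 𝒢.PullsBack h P Q Z z) :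
    ∀ᶠ y₀ in 𝓝 (0 : V × V), 𝒢.PullsBack (𝒢.triMap h P Q y₀)
      (fun s => 𝒢.triMap h P Q (y₀.1 + s, y₀.2)) (fun t => 𝒢.triMap h P Q (y₀.1, y₀.2 + t)) Z
      (fun y => z (y₀ + y)) := by
  have h3 : ∀ (T : VField EG G) {y y' : G} (_ : y = y'), (T y : EG) = T y' := by
    rintro T y _ rfl; rfl
  filter_upwards [bp.shift_triMap, bp.mfderiv_shift_triMap, hz.smooth.eventually_nhds,
    hz.bPart.eventually_nhds,
    hz.aPart.eventually_nhds] with y₀ ht hm hs hb ha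
  have hc : Filter.Tendsto (fun y : V × V => y₀ + y) (𝓝 0) (𝓝 y₀) := by
    have : ContinuousAt (fun y : V × V => y₀ + y) 0 := by fun_prop
    simpa [ContinuousAt] using this
  refine ⟨?_, ?_, ?_⟩
  · filter_upwards [hc.eventually hs] with y hs
    refine ContDiffAt.comp y (g := z) (f := fun y => y₀ + y) hs ?_
    fun_prop
  · filter_upwards [ht, hm, hc.eventually hb] with y h1 h2 h4
    exact ((h3 Z.bPart h1).trans h4).trans (h2 _).symm
  · filter_upwards [ht, hm, hc.eventually ha] with y h1 h2 h4
    exact ((h3 Z.aPart h1).trans h4).trans (h2 _).symm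

/-- The formulas for the two components of the bracket hold at a centre. Applied at every shifted
centre, they say that the bracket is lifted by the Lie bracket on a neighbourhood. -/
theorem PullsBack.prolBracket (bp : 𝒢.Biparam h P Q) {Z W : FieldPair EG G}
    (hZ : 𝒢.IsSection Z) (hW : 𝒢.IsSection W) {z w : V × V → V × V}
    (hz : 𝒢.PullsBack h P Q Z z) (hw : 𝒢.PullsBack h P Q W w) :
    𝒢.PullsBack h P Q (𝒢.prolBracket Z W) (VectorField.lieBracket ℝ z w) := by
  have hlie : ∀ (z : V × V → V × V) (y₀ : V × V), fderiv ℝ (fun y => z (y₀ + y)) 0 = fderiv ℝ z y₀ := by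
    intro z y₀
    rw [fderiv_comp_add_left, add_zero]
  have h5 : ∀ {y y' : V × V} (_ : y = y') (v : V × V),
      (mfderiv 𝓘(ℝ, V × V) 𝓘(ℝ, EG) (𝒢.triMap h P Q) y v : EG) =
      mfderiv 𝓘(ℝ, V × V) 𝓘(ℝ, EG) (𝒢.triMap h P Q) y' v := by rintro y _ rfl v; rfl
  refine ⟨?_, ?_, ?_⟩
  · filter_upwards [hz.smooth, hw.smooth] with y h1 h2
    exact ((h2.fderiv_right (m := ∞) (by simp)).clm_apply h1).sub
      ((h1.fderiv_right (m := ∞) (by simp)).clm_apply h2)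
  · filter_upwards [bp.shift, hz.shift bp, hw.shift bp, bp.mfderiv_shift_triMap] with y₀ h1 h2 h3 h4
    refine (bPart_prolBracket_eq h1 hZ hW h2 h3).trans ((h1.mfderiv_left _).trans ?_)
    refine (h4.self_of_nhds _).trans ((h5 (add_zero y₀) _).trans ?_)
    simp only [VectorField.lieBracket, hlie, add_zero]
    rfl
  · filter_upwards [bp.shift, hz.shift bp, hw.shift bp, bp.mfderiv_shift_triMap] with y₀ h1 h2 h3 h4
    refine (aPart_prolBracket_eq h1 hZ hW h2 h3).trans ((h1.mfderiv_right _).trans ?_)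
    refine (h4.self_of_nhds _).trans ((h5 (add_zero y₀) _).trans ?_)
    simp only [VectorField.lieBracket, hlie, add_zero]
    rfl

/-- The formula `omegaL_eq` at all shifted centres; valid on a neighbourhood, it can be
differentiated, as closedness requires. -/
theorem omegaL_triMap (bp : 𝒢.Biparam h P Q) {Z W : FieldPair EG G}
    (hZ : 𝒢.IsSection Z) (hW : 𝒢.IsSection W) {z w : V × V → V × V}
    (hz : 𝒢.PullsBack h P Q Z z) (hw : 𝒢.PullsBack h P Q W w)
    {L : G → ℝ} (hL : ContMDiff 𝓘(ℝ, EG) 𝓘(ℝ, ℝ) ∞ L) :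
    ∀ᶠ y in 𝓝 (0 : V × V), 𝒢.omegaL L Z W (𝒢.triMap h P Q y) =
      fderiv ℝ (fderiv ℝ (L ∘ 𝒢.triMap h P Q)) y ((w y).1, 0) (0, (z y).2) -
      fderiv ℝ (fderiv ℝ (L ∘ 𝒢.triMap h P Q)) y ((z y).1, 0) (0, (w y).2) := by
  filter_upwards [bp.shift, hz.shift bp, hw.shift bp, bp.shift_triMap] with y₀ h1 h2 h3 h4
  have h5 := omegaL_eq h1 hZ hW h2 h3 hL
  have e1 : (L ∘ 𝒢.triMap (𝒢.triMap h P Q y₀) (fun s => 𝒢.triMap h P Q (y₀.1 + s, y₀.2))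
      (fun t => 𝒢.triMap h P Q (y₀.1, y₀.2 + t))) =ᶠ[𝓝 0]
      fun y => (L ∘ 𝒢.triMap h P Q) (y₀ + y) := h4.mono fun y hy => congrArg L hy
  have e2 := e1.fderiv (𝕜 := ℝ)
  rw [e2.fderiv_eq] at h5
  have e3 : (fderiv ℝ fun y => (L ∘ 𝒢.triMap h P Q) (y₀ + y)) =
      fun y => fderiv ℝ (L ∘ 𝒢.triMap h P Q) (y₀ + y) := by
    funext y; rw [fderiv_comp_add_left]
  rw [e3, fderiv_comp_add_left] at h5
  simpa only [add_zero] using h5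

end Shift

end LieGroupoid

/-! ### Smooth families of centres, and lifts of sections. -/

namespace LieGroupoid

variable {EG EM G M : Type*}
  [NormedAddCommGroup EG] [NormedSpace ℝ EG] [FiniteDimensional ℝ EG]
  [NormedAddCommGroup EM] [NormedSpace ℝ EM] [FiniteDimensional ℝ EM]
  [TopologicalSpace G] [ChartedSpace EG G] [IsManifold 𝓘(ℝ, EG) ∞ G]
  [TopologicalSpace M] [ChartedSpace EM M] [IsManifold 𝓘(ℝ, EM) ∞ M]
  (𝒢 : LieGroupoid EG EM G M)

theorem mfderiv_comp_eq_zero {V : Type*} [NormedAddCommGroup V] [NormedSpace ℝ V]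
    {f : G → M} {c : V → G} {v : V} {x : M}
    (hf : MDifferentiableAt 𝓘(ℝ, EG) 𝓘(ℝ, EM) f (c v))
    (hc : MDifferentiableAt 𝓘(ℝ, V) 𝓘(ℝ, EG) c v) (hx : ∀ᶠ u in 𝓝 v, f (c u) = x) (w : V) :
    mfderiv 𝓘(ℝ, EG) 𝓘(ℝ, EM) f (c v) (mfderiv 𝓘(ℝ, V) 𝓘(ℝ, EG) c v w) = 0 := by
  have h1 := mfderiv_comp (I' := 𝓘(ℝ, EG)) v hf hc
  have hev : (f ∘ c) =ᶠ[𝓝 v] fun _ => x := hx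
  rw [hev.mfderiv_eq, mfderiv_const] at h1
  exact (congrArg (fun A : V →L[ℝ] EM => A w) h1).symm

/-- A smooth family, near `n₀`, of parametrizations of pieces of the fibres through `c(n)`. -/
structure BiparamFamily (c : G → G) (P Q : G × AlgModel EG EM → G) (n₀ : G) : Prop where
  smooth_center : ∀ᶠ n in 𝓝 n₀, ContMDiffAt 𝓘(ℝ, EG) 𝓘(ℝ, EG) ∞ c n
  smooth_left : ∀ᶠ p in 𝓝 (n₀, (0 : AlgModel EG EM)),
    ContMDiffAt (𝓘(ℝ, EG).prod 𝓘(ℝ, AlgModel EG EM)) 𝓘(ℝ, EG) ∞ P p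
  smooth_right : ∀ᶠ p in 𝓝 (n₀, (0 : AlgModel EG EM)),
    ContMDiffAt (𝓘(ℝ, EG).prod 𝓘(ℝ, AlgModel EG EM)) 𝓘(ℝ, EG) ∞ Q p
  left_zero : ∀ᶠ n in 𝓝 n₀, P (n, 0) = c n
  right_zero : ∀ᶠ n in 𝓝 n₀, Q (n, 0) = c n
  tgt_left : ∀ᶠ p in 𝓝 (n₀, (0 : AlgModel EG EM)), 𝒢.tgt (P p) = 𝒢.tgt (c p.1)
  src_right : ∀ᶠ p in 𝓝 (n₀, (0 : AlgModel EG EM)), 𝒢.src (Q p) = 𝒢.src (c p.1)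
  injective_left : Function.Injective
    (mfderiv 𝓘(ℝ, AlgModel EG EM) 𝓘(ℝ, EG) (fun v => P (n₀, v)) 0)
  injective_right : Function.Injective
    (mfderiv 𝓘(ℝ, AlgModel EG EM) 𝓘(ℝ, EG) (fun v => Q (n₀, v)) 0)

/-- The map `(n, (p, q)) ↦ P(n, p) c(n)⁻¹ Q(n, q)`. -/
def familyMap (c : G → G) (P Q : G × AlgModel EG EM → G)
    (x : G × (AlgModel EG EM × AlgModel EG EM)) : G :=
  𝒢.triMap (c x.1) (fun v => P (x.1, v)) (fun v => Q (x.1, v)) x.2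

variable {𝒢}

namespace BiparamFamily

variable {c : G → G} {P Q : G × AlgModel EG EM → G} {n₀ : G} (bf : 𝒢.BiparamFamily c P Q n₀)
include bf

theorem op : 𝒢.op.BiparamFamily c Q P n₀ :=
  ⟨bf.smooth_center, bf.smooth_right, bf.smooth_left, bf.right_zero, bf.left_zero, bf.src_right,
    bf.tgt_left, bf.injective_right, bf.injective_left⟩

theorem eventually_biparam :
    ∀ᶠ n in 𝓝 n₀, 𝒢.Biparam (c n) (fun v => P (n, v)) (fun v => Q (n, v)) := by
  have h1 := bf.smooth_left; have h2 := bf.smooth_right; have h3 := bf.tgt_left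
  have h4 := bf.src_right
  rw [nhds_prod_eq] at h1 h2 h3 h4
  have hin : ∀ (n : G) (v : AlgModel EG EM),
      ContMDiffAt 𝓘(ℝ, AlgModel EG EM) (𝓘(ℝ, EG).prod 𝓘(ℝ, AlgModel EG EM)) ∞
      (fun v => (n, v)) v := fun n v => contMDiffAt_const.prodMk contMDiffAt_id
  filter_upwards [h1.curry, h2.curry, h3.curry, h4.curry, bf.left_zero, bf.right_zero]
    with n h1 h2 h3 h4 h5 h6
  exact ⟨h5, h6, h1.mono fun v hv => ContMDiffAt.comp v hv (hin n v),
    h2.mono fun v hv => ContMDiffAt.comp v hv (hin n v), h3, h4⟩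

theorem biparam : 𝒢.Biparam (c n₀) (fun v => P (n₀, v)) (fun v => Q (n₀, v)) :=
  bf.eventually_biparam.self_of_nhds

theorem eventually_fibres : ∀ᶠ x in 𝓝 (n₀, (0 : AlgModel EG EM × AlgModel EG EM)),
    𝒢.tgt (P (x.1, x.2.1)) = 𝒢.tgt (c x.1) ∧ 𝒢.src (Q (x.1, x.2.2)) = 𝒢.src (c x.1) := by
  have hc1 : ContinuousAt (fun x : G × (AlgModel EG EM × AlgModel EG EM) => (x.1, x.2.1))
    (n₀, 0) := by fun_prop
  have hc2 : ContinuousAt (fun x : G × (AlgModel EG EM × AlgModel EG EM) => (x.1, x.2.2))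
    (n₀, 0) := by fun_prop
  exact (hc1.eventually bf.tgt_left).and (hc2.eventually bf.src_right)

theorem eventually_contMDiffAt_familyMap :
    ∀ᶠ x in 𝓝 (n₀, (0 : AlgModel EG EM × AlgModel EG EM)),
      ContMDiffAt (𝓘(ℝ, EG).prod 𝓘(ℝ, AlgModel EG EM × AlgModel EG EM)) 𝓘(ℝ, EG) ∞
        (𝒢.familyMap c P Q) x := by
  have hc0 : ContinuousAt (fun x : G × (AlgModel EG EM × AlgModel EG EM) => x.1)
    (n₀, 0) := by fun_prop
  have hc1 : ContinuousAt (fun x : G × (AlgModel EG EM × AlgModel EG EM) => (x.1, x.2.1))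
    (n₀, 0) := by fun_prop
  have hc2 : ContinuousAt (fun x : G × (AlgModel EG EM × AlgModel EG EM) => (x.1, x.2.2))
    (n₀, 0) := by fun_prop
  filter_upwards [hc0.eventually bf.smooth_center, hc1.eventually bf.smooth_left,
    hc2.eventually bf.smooth_right, bf.eventually_fibres.eventually_nhds] with x h0 h1 h2 h3
  have k1 : ContMDiffAt (𝓘(ℝ, EG).prod 𝓘(ℝ, AlgModel EG EM × AlgModel EG EM))
      𝓘(ℝ, AlgModel EG EM) ∞
      (fun x : G × (AlgModel EG EM × AlgModel EG EM) => x.2.1) x :=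
    ContMDiffAt.comp (I' := 𝓘(ℝ, AlgModel EG EM × AlgModel EG EM)) x (g := Prod.fst)
      contDiffAt_fst.contMDiffAt contMDiffAt_snd
  have k2 : ContMDiffAt (𝓘(ℝ, EG).prod 𝓘(ℝ, AlgModel EG EM × AlgModel EG EM))
      𝓘(ℝ, AlgModel EG EM) ∞
      (fun x : G × (AlgModel EG EM × AlgModel EG EM) => x.2.2) x :=
    ContMDiffAt.comp (I' := 𝓘(ℝ, AlgModel EG EM × AlgModel EG EM)) x (g := Prod.snd)
      contDiffAt_snd.contMDiffAt contMDiffAt_snd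
  exact 𝒢.contMDiffAt_tri (ContMDiffAt.comp x h1 (contMDiffAt_fst.prodMk k1))
    (ContMDiffAt.comp x h0 contMDiffAt_fst) (ContMDiffAt.comp x h2 (contMDiffAt_fst.prodMk k2))
    (h3.mono fun y hy => hy.1) (h3.mono fun y hy => hy.2)

/-- Coordinates of a section of `Vα` in the fibres. -/
theorem exists_right_coord {Y : VField EG G}
    (hYs : ContMDiff 𝓘(ℝ, EG) (𝓘(ℝ, EG).prod 𝓘(ℝ, EG)) ∞
      (fun g => (⟨g, Y g⟩ : TangentBundle 𝓘(ℝ, EG) G)))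
    (hYv : ∀ k, mfderiv 𝓘(ℝ, EG) 𝓘(ℝ, EM) 𝒢.src k (Y k) = 0) :
    ∃ b : G × (AlgModel EG EM × AlgModel EG EM) → AlgModel EG EM,
      (∀ᶠ x in 𝓝 (n₀, (0 : AlgModel EG EM × AlgModel EG EM)),
        ContMDiffAt (𝓘(ℝ, EG).prod 𝓘(ℝ, AlgModel EG EM × AlgModel EG EM)) 𝓘(ℝ, AlgModel EG EM) ∞
          b x) ∧
      ∀ᶠ x in 𝓝 (n₀, (0 : AlgModel EG EM × AlgModel EG EM)),
        (Y (𝒢.familyMap c P Q x) : EG) =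
          mfderiv 𝓘(ℝ, AlgModel EG EM × AlgModel EG EM) 𝓘(ℝ, EG)
            (fun y => 𝒢.familyMap c P Q (x.1, y)) x.2 (0, b x) := by
  set F := 𝒢.familyMap c P Q with hF
  have hF0 : F (n₀, 0) = c n₀ := bf.biparam.triMap_zero
  obtain ⟨S⟩ := nonempty_fibreChart 𝒢.isSubmersion_src (c n₀)
  have hsd : ∀ k, MDifferentiableAt 𝓘(ℝ, EG) 𝓘(ℝ, EM) 𝒢.src k :=
    fun k => 𝒢.contMDiff_src.mdifferentiableAt (by simp)
  have hFs := bf.eventually_contMDiffAt_familyMap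
  have hdom : ∀ᶠ x in 𝓝 (n₀, (0 : AlgModel EG EM × AlgModel EG EM)), F x ∈ S.dom :=
    hFs.self_of_nhds.continuousAt.eventually (by
      rw [← hF, hF0]; exact S.isOpen_dom.mem_nhds S.mem_dom)
  set φ : G × (AlgModel EG EM × AlgModel EG EM) → AlgModel EG EM := fun x => S.coord (F x) with hφ
  -- `A` is the `q`-derivative of `F` read through `coord`. It is invertible at the centre because
  -- `Q` is immersed there, hence also nearby, and the coefficient of `Y` is found by inverting it.
  set A : G × (AlgModel EG EM × AlgModel EG EM) → AlgModel EG EM →L[ℝ] AlgModel EG EM := fun x =>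
    (fderiv ℝ (fun y => φ (x.1, y)) x.2).comp
      (ContinuousLinearMap.inr ℝ (AlgModel EG EM) (AlgModel EG EM)) with hA
  have hφs : ∀ᶠ x in 𝓝 (n₀, (0 : AlgModel EG EM × AlgModel EG EM)),
      ContMDiffAt (𝓘(ℝ, EG).prod 𝓘(ℝ, AlgModel EG EM × AlgModel EG EM)) 𝓘(ℝ, AlgModel EG EM) ∞
        φ x := by
    filter_upwards [hFs, hdom] with x h1 h2
    exact ContMDiffAt.comp x (S.contMDiffAt_coord h2) h1
  have hAs : ∀ᶠ x in 𝓝 (n₀, (0 : AlgModel EG EM × AlgModel EG EM)),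
      ContMDiffAt (𝓘(ℝ, EG).prod 𝓘(ℝ, AlgModel EG EM × AlgModel EG EM))
        𝓘(ℝ, AlgModel EG EM →L[ℝ] AlgModel EG EM) ∞ A x := by
    filter_upwards [hφs] with x h1
    exact (contMDiffAt_fderiv_snd h1).clm_comp contMDiffAt_const
  have hin : ∀ (n : G) (y : AlgModel EG EM × AlgModel EG EM),
      MDifferentiableAt 𝓘(ℝ, AlgModel EG EM × AlgModel EG EM)
      (𝓘(ℝ, EG).prod 𝓘(ℝ, AlgModel EG EM × AlgModel EG EM)) (fun y => (n, y)) y := fun n y =>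
    (contMDiffAt_const.prodMk contMDiffAt_id : ContMDiffAt 𝓘(ℝ, AlgModel EG EM × AlgModel EG EM)
      (𝓘(ℝ, EG).prod 𝓘(ℝ, AlgModel EG EM × AlgModel EG EM)) ∞ (fun y => (n, y)) y).mdifferentiableAt
      (by simp)
  -- the derivative of `F` along the second factor, in the coordinates
  have hFy : ∀ᶠ x in 𝓝 (n₀, (0 : AlgModel EG EM × AlgModel EG EM)),
      MDifferentiableAt 𝓘(ℝ, AlgModel EG EM × AlgModel EG EM) 𝓘(ℝ, EG) (fun y => F (x.1, y)) x.2 ∧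
      ∀ v : AlgModel EG EM, A x v = mfderiv 𝓘(ℝ, EG) 𝓘(ℝ, AlgModel EG EM) S.coord (F x)
        (mfderiv 𝓘(ℝ, AlgModel EG EM × AlgModel EG EM) 𝓘(ℝ, EG)
            (fun y => F (x.1, y)) x.2 (0, v)) ∧
        mfderiv 𝓘(ℝ, EG) 𝓘(ℝ, EM) 𝒢.src (F x)
          (mfderiv 𝓘(ℝ, AlgModel EG EM × AlgModel EG EM) 𝓘(ℝ, EG)
            (fun y => F (x.1, y)) x.2 (0, v)) = 0 := by
    filter_upwards [hFs, hdom, bf.eventually_fibres.eventually_nhds] with x h1 h2 h3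
    have hd : MDifferentiableAt 𝓘(ℝ, AlgModel EG EM × AlgModel EG EM) 𝓘(ℝ, EG)
        (fun y => F (x.1, y)) x.2 :=
      MDifferentiableAt.comp (I' := 𝓘(ℝ, EG).prod 𝓘(ℝ, AlgModel EG EM × AlgModel EG EM)) x.2
        (f := fun y => (x.1, y)) (g := F) (h1.mdifferentiableAt (by simp)) (hin _ _)
    refine ⟨hd, fun v => ⟨?_, ?_⟩⟩
    · have h4 := mfderiv_comp (I' := 𝓘(ℝ, EG)) x.2
        ((S.contMDiffAt_coord h2).mdifferentiableAt (by simp)) hd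
      rw [mfderiv_eq_fderiv] at h4
      exact congrArg (fun B : AlgModel EG EM × AlgModel EG EM →L[ℝ] AlgModel EG EM => B (0, v)) h4
    · have h5 : MDifferentiableAt 𝓘(ℝ, AlgModel EG EM) 𝓘(ℝ, EG)
          (fun q => F (x.1, (x.2.1, q))) x.2.2 := by
        have h6 : MDifferentiableAt 𝓘(ℝ, AlgModel EG EM) 𝓘(ℝ, AlgModel EG EM × AlgModel EG EM)
            (fun q => (x.2.1, q)) x.2.2 :=
          (hasFDerivAt_prodMk_right x.2.1 x.2.2).differentiableAt.mdifferentiableAt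
        exact MDifferentiableAt.comp (I' := 𝓘(ℝ, AlgModel EG EM × AlgModel EG EM)) x.2.2
          (f := fun q => (x.2.1, q)) (g := fun y => F (x.1, y)) hd h6
      have h7 := mfderiv_comp_eq_zero (hsd _) h5 (x := 𝒢.src (P (x.1, x.2.1))) ?_ v
      · rw [mfderiv_partial_right (F := fun y => F (x.1, y)) hd v] at h7
        exact h7
      · have hc : ContinuousAt (fun q : AlgModel EG EM => (x.1, (x.2.1, q))) x.2.2 := by fun_prop
        filter_upwards [hc.eventually h3] with q hq
        exact 𝒢.src_tri hq.1 hq.2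
  have hinv0 : (A (n₀, 0)).IsInvertible := by
    have hinj : Function.Injective (A (n₀, 0)) := by
      rw [injective_iff_map_eq_zero]
      intro v hv
      obtain ⟨h1, h2⟩ := hFy.self_of_nhds
      have h3 := S.eq_zero _ hdom.self_of_nhds _ (h2 v).2 ((h2 v).1.symm.trans hv)
      have h4 := bf.biparam.mfderiv_right v
      exact bf.injective_right ((h4.trans h3).trans (map_zero _).symm)
    exact ⟨(LinearEquiv.ofInjectiveEndo (A (n₀, 0)).toLinearMap hinj).toContinuousLinearEquiv,
      by ext; rfl⟩
  have hinv : ∀ᶠ x in 𝓝 (n₀, (0 : AlgModel EG EM × AlgModel EG EM)), (A x).IsInvertible :=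
    hAs.self_of_nhds.continuousAt.eventually
      ((ContinuousLinearEquiv.isOpen (𝕜 := ℝ) (E := AlgModel EG EM)
        (F := AlgModel EG EM)).mem_nhds hinv0)
  refine ⟨fun x => (A x).inverse
    (mfderiv 𝓘(ℝ, EG) 𝓘(ℝ, AlgModel EG EM) S.coord (F x) (Y (F x)) : AlgModel EG EM), ?_, ?_⟩
  · filter_upwards [hinv, hAs, hFs, hdom] with x h1 h2 h3 h4
    have h5 := (h1.contDiffAt_map_inverse (n := ∞)).contMDiffAt.comp x h2
    have h6 := (contMDiffAt_mfderiv_apply_field (hYs (F x)) (S.contMDiffAt_coord h4)).comp x h3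
    exact ContMDiffAt.clm_apply h5 h6
  · filter_upwards [hinv, hFy, hdom] with x h1 h2 h3
    set b : AlgModel EG EM := (A x).inverse
      (mfderiv 𝓘(ℝ, EG) 𝓘(ℝ, AlgModel EG EM) S.coord (F x) (Y (F x)) : AlgModel EG EM) with hb
    have h4 := h1.self_apply_inverse
      (mfderiv 𝓘(ℝ, EG) 𝓘(ℝ, AlgModel EG EM) S.coord (F x) (Y (F x)) : AlgModel EG EM)
    -- Both vectors are tangent to the `α`-fibre, where a vector is determined by its image under
    -- the derivative of `coord`; `b` was chosen so that these images agree.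
    refine sub_eq_zero.1 (S.eq_zero _ h3 (Y (F x) - _) ?_ ?_)
    · exact (map_sub _ _ _).trans
        ((congrArg₂ (· - ·) (hYv _) (h2.2 b).2).trans (sub_zero _))
    · exact (map_sub _ _ _).trans (sub_eq_zero.2 (h4.symm.trans (h2.2 b).1))

/-- The coefficient of the `α`-component comes from `exists_right_coord`, that of the `β`-component
from the same lemma in the opposite groupoid, with the two parameters swapped. Smoothness is joint
in the centre and the parameters. -/
theorem exists_pullsBack {Z : FieldPair EG G} (hZ : 𝒢.IsSection Z) :
    ∃ z : G × (AlgModel EG EM × AlgModel EG EM) → AlgModel EG EM × AlgModel EG EM,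
      (∀ᶠ x in 𝓝 (n₀, (0 : AlgModel EG EM × AlgModel EG EM)),
        ContMDiffAt (𝓘(ℝ, EG).prod 𝓘(ℝ, AlgModel EG EM × AlgModel EG EM))
          𝓘(ℝ, AlgModel EG EM × AlgModel EG EM) ∞ z x) ∧
      ∀ᶠ n in 𝓝 n₀, 𝒢.PullsBack (c n) (fun v => P (n, v)) (fun v => Q (n, v)) Z
        (fun y => z (n, y)) := by
  obtain ⟨b, hb, hbY⟩ := bf.exists_right_coord hZ.contMDiff_aPart hZ.src_aPart
  obtain ⟨a, ha, haX⟩ := bf.op.exists_right_coord hZ.contMDiff_bPart hZ.tgt_bPart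
  have hsw : Filter.Tendsto (fun x : G × (AlgModel EG EM × AlgModel EG EM) => (x.1, x.2.swap))
      (𝓝 (n₀, 0)) (𝓝 (n₀, 0)) := by
    have : ContinuousAt (fun x : G × (AlgModel EG EM × AlgModel EG EM) => (x.1, x.2.swap))
      (n₀, 0) := by fun_prop
    exact this
  have hzs : ∀ᶠ x in 𝓝 (n₀, (0 : AlgModel EG EM × AlgModel EG EM)),
        ContMDiffAt (𝓘(ℝ, EG).prod 𝓘(ℝ, AlgModel EG EM × AlgModel EG EM))
          𝓘(ℝ, AlgModel EG EM × AlgModel EG EM) ∞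
          (fun x : G × (AlgModel EG EM × AlgModel EG EM) => (a (x.1, x.2.swap), b x)) x := by
    filter_upwards [hb, hsw.eventually ha] with x h1 h2
    have h0 : ContDiff ℝ ∞ (Prod.swap : AlgModel EG EM × AlgModel EG EM → _) :=
      contDiff_snd.prodMk contDiff_fst
    have h3 : ContMDiffAt (𝓘(ℝ, EG).prod 𝓘(ℝ, AlgModel EG EM × AlgModel EG EM))
        (𝓘(ℝ, EG).prod 𝓘(ℝ, AlgModel EG EM × AlgModel EG EM)) ∞
        (fun x : G × (AlgModel EG EM × AlgModel EG EM) => (x.1, x.2.swap)) x :=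
      contMDiffAt_fst.prodMk (ContMDiffAt.comp
        (I' := 𝓘(ℝ, AlgModel EG EM × AlgModel EG EM)) x h0.contMDiff.contMDiffAt contMDiffAt_snd)
    exact (ContMDiffAt.comp x (g := a) (f := fun x : G × (AlgModel EG EM × AlgModel EG EM) =>
      (x.1, x.2.swap)) h2 h3).prodMk_space h1
  refine ⟨fun x => (a (x.1, x.2.swap), b x), hzs, ?_⟩
  rw [nhds_prod_eq] at hzs hbY haX
  filter_upwards [hzs.curry, hbY.curry, haX.curry, bf.eventually_biparam] with n h1 h2 h3 bp
  refine ⟨?_, ?_, h2⟩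
  · filter_upwards [h1] with y hy
    exact (hy.comp y (contMDiffAt_const.prodMk contMDiffAt_id)).contDiffAt
  · have hc0 : Filter.Tendsto (Prod.swap : AlgModel EG EM × AlgModel EG EM → _) (𝓝 0) (𝓝 0) :=
      continuous_swap.tendsto (0 : AlgModel EG EM × AlgModel EG EM)
    have h4 : ∀ (T : VField EG G) {y y' : G} (_ : y = y'), (T y : EG) = T y' := by
      rintro T y _ rfl; rfl
    filter_upwards [hc0.eventually h3, bp.op_triMap, bp.op.mfderiv_op_triMap] with y k1 k2 k3
    exact ((h4 Z.bPart k2.symm).trans k1).trans (k3 (a (n, y.swap), 0)).symm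

end BiparamFamily

end LieGroupoid

/-! ### Regularity of brackets and of `Ω_L` on `G`; closedness. -/

namespace LieGroupoid

variable {EG EM G M : Type*}
  [NormedAddCommGroup EG] [NormedSpace ℝ EG] [FiniteDimensional ℝ EG]
  [NormedAddCommGroup EM] [NormedSpace ℝ EM] [FiniteDimensional ℝ EM]
  [TopologicalSpace G] [ChartedSpace EG G] [IsManifold 𝓘(ℝ, EG) ∞ G]
  [TopologicalSpace M] [ChartedSpace EM M] [IsManifold 𝓘(ℝ, EM) ∞ M]
  (𝒢 : LieGroupoid EG EM G M)

theorem exists_biparamFamily (g : G) :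
    ∃ P Q : G × AlgModel EG EM → G, 𝒢.BiparamFamily id P Q g := by
  obtain ⟨S⟩ := nonempty_fibreChart 𝒢.isSubmersion_tgt g
  obtain ⟨T⟩ := nonempty_fibreChart 𝒢.isSubmersion_src g
  have hS : ∀ᶠ p in 𝓝 (g, (0 : AlgModel EG EM)), p.1 ∈ S.dom ∧ p.2 ∈ S.ball :=
    (S.isOpen_dom.prod S.isOpen_ball).mem_nhds ⟨S.mem_dom, S.zero_mem_ball⟩
  have hT : ∀ᶠ p in 𝓝 (g, (0 : AlgModel EG EM)), p.1 ∈ T.dom ∧ p.2 ∈ T.ball :=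
    (T.isOpen_dom.prod T.isOpen_ball).mem_nhds ⟨T.mem_dom, T.zero_mem_ball⟩
  have hinj : ∀ {f : G → M} (R : FibreChart EG EM (AlgModel EG EM) f g), Function.Injective
      (mfderiv 𝓘(ℝ, AlgModel EG EM) 𝓘(ℝ, EG) (fun v => R.param (g, v)) 0) := by
    intro f R v w hvw
    rw [← R.mfderiv_coord_param R.mem_dom v, ← R.mfderiv_coord_param R.mem_dom w, hvw]
  refine ⟨S.param, T.param, ?_, ?_, ?_, ?_, ?_, ?_, ?_, hinj S, hinj T⟩
  · exact Filter.Eventually.of_forall fun n => contMDiffAt_id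
  · exact hS.mono fun p hp => S.contMDiffAt_param hp.1 hp.2
  · exact hT.mono fun p hp => T.contMDiffAt_param hp.1 hp.2
  · filter_upwards [S.isOpen_dom.mem_nhds S.mem_dom] with n hn using S.param_zero n hn
  · filter_upwards [T.isOpen_dom.mem_nhds T.mem_dom] with n hn using T.param_zero n hn
  · exact hS.mono fun p hp => S.map_param p.1 hp.1 p.2 hp.2
  · exact hT.mono fun p hp => T.map_param p.1 hp.1 p.2 hp.2

/-- A single pair of immersed parametrizations, seen as a constant family. -/
theorem Biparam.family {𝒢 : LieGroupoid EG EM G M} {h : G} {P Q : AlgModel EG EM → G}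
    (bp : 𝒢.Biparam h P Q)
    (hP : Function.Injective (mfderiv 𝓘(ℝ, AlgModel EG EM) 𝓘(ℝ, EG) P 0))
    (hQ : Function.Injective (mfderiv 𝓘(ℝ, AlgModel EG EM) 𝓘(ℝ, EG) Q 0)) :
    𝒢.BiparamFamily (fun _ => h) (fun p => P p.2) (fun p => Q p.2) h := by
  have hc : Filter.Tendsto (Prod.snd : G × AlgModel EG EM → _) (𝓝 (h, 0)) (𝓝 0) :=
    continuous_snd.tendsto (h, (0 : AlgModel EG EM))
  refine ⟨Filter.Eventually.of_forall fun n => contMDiffAt_const, ?_, ?_,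
    Filter.Eventually.of_forall fun n => bp.left_zero,
    Filter.Eventually.of_forall fun n => bp.right_zero, hc.eventually bp.tgt_left,
    hc.eventually bp.src_right, hP, hQ⟩
  · filter_upwards [hc.eventually bp.smooth_left] with p hp
    exact ContMDiffAt.comp (I' := 𝓘(ℝ, AlgModel EG EM)) p (g := P) hp contMDiffAt_snd
  · filter_upwards [hc.eventually bp.smooth_right] with p hp
    exact ContMDiffAt.comp (I' := 𝓘(ℝ, AlgModel EG EM)) p (g := Q) hp contMDiffAt_snd

variable {𝒢}

/-- `dTwo` evaluates `Ω_L` on brackets, and the coordinate formula for `Ω_L` needs smooth sections.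
The bracket at `n` is the velocity of `Q(n, ·)` with a coefficient depending smoothly on the centre
`n`. -/
theorem aPart_prolBracket_isSection {Z W : FieldPair EG G} (hZ : 𝒢.IsSection Z)
    (hW : 𝒢.IsSection W) :
    ContMDiff 𝓘(ℝ, EG) (𝓘(ℝ, EG).prod 𝓘(ℝ, EG)) ∞
      (fun g => (⟨g, (𝒢.prolBracket Z W).aPart g⟩ : TangentBundle 𝓘(ℝ, EG) G)) ∧
    ∀ g, mfderiv 𝓘(ℝ, EG) 𝓘(ℝ, EM) 𝒢.src g ((𝒢.prolBracket Z W).aPart g) = 0 := by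
  rw [ContMDiff, ← forall_and]
  intro g
  obtain ⟨P, Q, bf⟩ := 𝒢.exists_biparamFamily g
  obtain ⟨z, hzs, hz⟩ := bf.exists_pullsBack hZ
  obtain ⟨w, hws, hw⟩ := bf.exists_pullsBack hW
  have hev : ∀ᶠ n in 𝓝 g, ((𝒢.prolBracket Z W).aPart n : EG) =
      mfderiv 𝓘(ℝ, AlgModel EG EM) 𝓘(ℝ, EG) (fun v => Q (n, v)) 0
        (VectorField.lieBracket ℝ (fun y => z (n, y)) (fun y => w (n, y)) 0).2 := by
    filter_upwards [hz, hw, bf.eventually_biparam] with n h1 h2 h3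
    exact aPart_prolBracket_eq h3 hZ hW h1 h2
  constructor
  · refine contMDiffAt_field_of_param (S := Q) (v₀ := 0) bf.smooth_right.self_of_nhds ?_
      bf.right_zero hev
    have hi : ContMDiffAt 𝓘(ℝ, EG) (𝓘(ℝ, EG).prod 𝓘(ℝ, AlgModel EG EM × AlgModel EG EM)) ∞
        (fun n : G => (n, (0 : AlgModel EG EM × AlgModel EG EM))) g :=
      contMDiffAt_id.prodMk contMDiffAt_const
    have k1 := hzs.self_of_nhds.comp g (f := fun n => (n, (0 : AlgModel EG EM × AlgModel EG EM))) hi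
    have k2 := hws.self_of_nhds.comp g (f := fun n => (n, (0 : AlgModel EG EM × AlgModel EG EM))) hi
    have k3 := (contMDiffAt_fderiv_snd hzs.self_of_nhds).comp g
      (f := fun n => (n, (0 : AlgModel EG EM × AlgModel EG EM))) hi
    have k4 := (contMDiffAt_fderiv_snd hws.self_of_nhds).comp g
      (f := fun n => (n, (0 : AlgModel EG EM × AlgModel EG EM))) hi
    exact ContMDiffAt.comp (I' := 𝓘(ℝ, AlgModel EG EM × AlgModel EG EM)) g (g := Prod.snd)
      contDiffAt_snd.contMDiffAt ((k4.clm_apply k1).sub (k3.clm_apply k2))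
  · have bp := bf.biparam
    have h1 := mfderiv_comp_eq_zero (f := 𝒢.src) (c := fun v => Q (g, v)) (v := 0)
      (x := 𝒢.src g) (𝒢.contMDiff_src.mdifferentiableAt (by simp))
      (bp.contMDiffAt_right.mdifferentiableAt (by simp)) bp.src_right
      (VectorField.lieBracket ℝ (fun y => z (g, y)) (fun y => w (g, y)) 0).2
    have h3 : ∀ (y : G) (_ : y = g) (u : EG), (mfderiv 𝓘(ℝ, EG) 𝓘(ℝ, EM) 𝒢.src g u : EM) =
      mfderiv 𝓘(ℝ, EG) 𝓘(ℝ, EM) 𝒢.src y u := by rintro _ rfl u; rfl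
    refine Eq.trans ?_ ((h3 _ bp.right_zero _).trans h1)
    exact congrArg (fun u : EG => (mfderiv 𝓘(ℝ, EG) 𝓘(ℝ, EM) 𝒢.src g u : EM)) hev.self_of_nhds

theorem IsSection.prolBracket {Z W : FieldPair EG G} (hZ : 𝒢.IsSection Z) (hW : 𝒢.IsSection W) :
    𝒢.IsSection (𝒢.prolBracket Z W) :=
  have h1 := aPart_prolBracket_isSection hZ hW
  have h2 := aPart_prolBracket_isSection hZ.swap hW.swap
  ⟨h2.1, h1.1, h2.2, h1.2⟩

variable {L : G → ℝ}

/-- The anchor derivatives in `dTwo` use the full derivative on `G`, so smoothness along the image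
of `triMap` is not enough. Here `omegaL_eq` is read with the centre varying over a neighbourhood in
`G`. -/
theorem mdifferentiableAt_omegaL {Z W : FieldPair EG G} (hZ : 𝒢.IsSection Z)
    (hW : 𝒢.IsSection W) (hL : ContMDiff 𝓘(ℝ, EG) 𝓘(ℝ, ℝ) ∞ L) (g : G) :
    MDifferentiableAt 𝓘(ℝ, EG) 𝓘(ℝ, ℝ) (𝒢.omegaL L Z W) g := by
  obtain ⟨P, Q, bf⟩ := 𝒢.exists_biparamFamily g
  obtain ⟨z, hzs, hz⟩ := bf.exists_pullsBack hZ
  obtain ⟨w, hws, hw⟩ := bf.exists_pullsBack hW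
  have hi : ContMDiffAt 𝓘(ℝ, EG) (𝓘(ℝ, EG).prod 𝓘(ℝ, AlgModel EG EM × AlgModel EG EM)) ∞
      (fun n : G => (n, (0 : AlgModel EG EM × AlgModel EG EM))) g :=
    contMDiffAt_id.prodMk contMDiffAt_const
  have k1 := hzs.self_of_nhds.comp g (f := fun n => (n, (0 : AlgModel EG EM × AlgModel EG EM))) hi
  have k2 := hws.self_of_nhds.comp g (f := fun n => (n, (0 : AlgModel EG EM × AlgModel EG EM))) hi
  have hℓ := ContMDiffAt.comp (I' := 𝓘(ℝ, EG)) (g, (0 : AlgModel EG EM × AlgModel EG EM))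
    hL.contMDiffAt bf.eventually_contMDiffAt_familyMap.self_of_nhds
  have k3 := (contMDiffAt_fderiv_snd (contMDiffAt_fderiv_snd hℓ)).comp g
      (f := fun n => (n, (0 : AlgModel EG EM × AlgModel EG EM))) hi
  have hl : ∀ {z : G → AlgModel EG EM × AlgModel EG EM},
      ContMDiffAt 𝓘(ℝ, EG) 𝓘(ℝ, AlgModel EG EM × AlgModel EG EM) ∞ z g →
      ContMDiffAt 𝓘(ℝ, EG) 𝓘(ℝ, AlgModel EG EM × AlgModel EG EM) ∞
        (fun n => ((z n).1, (0 : AlgModel EG EM))) g := fun h =>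
    ContMDiffAt.comp (I' := 𝓘(ℝ, AlgModel EG EM × AlgModel EG EM)) g
      (g := fun y : AlgModel EG EM × AlgModel EG EM => (y.1, (0 : AlgModel EG EM)))
      (contDiffAt_fst.prodMk contDiffAt_const).contMDiffAt h
  have hr : ∀ {z : G → AlgModel EG EM × AlgModel EG EM},
      ContMDiffAt 𝓘(ℝ, EG) 𝓘(ℝ, AlgModel EG EM × AlgModel EG EM) ∞ z g →
      ContMDiffAt 𝓘(ℝ, EG) 𝓘(ℝ, AlgModel EG EM × AlgModel EG EM) ∞
        (fun n => ((0 : AlgModel EG EM), (z n).2)) g := fun h =>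
    ContMDiffAt.comp (I' := 𝓘(ℝ, AlgModel EG EM × AlgModel EG EM)) g
      (g := fun y : AlgModel EG EM × AlgModel EG EM => ((0 : AlgModel EG EM), y.2))
      (contDiffAt_const.prodMk contDiffAt_snd).contMDiffAt h
  have k4 := ((k3.clm_apply (hl k2)).clm_apply (hr k1)).sub
    ((k3.clm_apply (hl k1)).clm_apply (hr k2))
  refine (k4.congr_of_eventuallyEq ?_).mdifferentiableAt (by simp)
  filter_upwards [hz, hw, bf.eventually_biparam] with n h1 h2 h3
  exact omegaL_eq h3 hZ hW h1 h2 hL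

section ThirdDerivative

variable {V : Type*} [NormedAddCommGroup V] [NormedSpace ℝ V] {ℓ : V → ℝ} {x : V}

theorem third_fderiv_comm_left (hℓ : ContDiffAt ℝ ∞ ℓ x) (u v w : V) :
    fderiv ℝ (fderiv ℝ (fderiv ℝ ℓ)) x u v w = fderiv ℝ (fderiv ℝ (fderiv ℝ ℓ)) x v u w := by
  have h1 : ContDiffAt ℝ ∞ (fderiv ℝ ℓ) x := hℓ.fderiv_right (m := ∞) (by simp)
  have h2 : IsSymmSndFDerivAt ℝ (fderiv ℝ ℓ) x := h1.isSymmSndFDerivAt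
    (by rw [minSmoothness_of_isRCLikeNormedField]; exact ENat.LEInfty.out)
  exact congrArg (fun A : V →L[ℝ] ℝ => A w) (h2.eq u v)

theorem third_fderiv_comm_right (hℓ : ∀ᶠ y in 𝓝 x, ContDiffAt ℝ ∞ ℓ y) (u v w : V) :
    fderiv ℝ (fderiv ℝ (fderiv ℝ ℓ)) x u v w = fderiv ℝ (fderiv ℝ (fderiv ℝ ℓ)) x u w v := by
  have hHd : DifferentiableAt ℝ (fderiv ℝ (fderiv ℝ ℓ)) x :=
    ((hℓ.self_of_nhds.fderiv_right (m := ∞) (by simp)).fderiv_right (m := ∞)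
      (by simp)).differentiableAt (by simp)
  have e : ∀ v w, fderiv ℝ (fun y => fderiv ℝ (fderiv ℝ ℓ) y v w) x u =
      fderiv ℝ (fderiv ℝ (fderiv ℝ ℓ)) x u v w := by
    intro v w
    rw [fderiv_clm_apply (hHd.clm_apply (differentiableAt_const v)) (differentiableAt_const w),
      fderiv_clm_apply hHd (differentiableAt_const v)]
    simp
  rw [← e v w, ← e w v]
  have e2 : (fun y => fderiv ℝ (fderiv ℝ ℓ) y v w) =ᶠ[𝓝 x]
      fun y => fderiv ℝ (fderiv ℝ ℓ) y w v := by
    filter_upwards [hℓ] with y hy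
    have h2 : IsSymmSndFDerivAt ℝ ℓ y := hy.isSymmSndFDerivAt
      (by rw [minSmoothness_of_isRCLikeNormedField]; exact ENat.LEInfty.out)
    exact h2.eq v w
  rw [e2.fderiv_eq]

end ThirdDerivative

section Closed

variable {V : Type*} [NormedAddCommGroup V] [NormedSpace ℝ V] {h : G} {P Q : V → G}

theorem Biparam.contDiffAt_lagrangian (bp : 𝒢.Biparam h P Q)
    (hL : ContMDiff 𝓘(ℝ, EG) 𝓘(ℝ, ℝ) ∞ L) :
    ∀ᶠ y in 𝓝 0, ContDiffAt ℝ ∞ (L ∘ 𝒢.triMap h P Q) y := by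
  filter_upwards [bp.eventually_contMDiffAt_triMap] with y hy
  exact (ContMDiffAt.comp (I' := 𝓘(ℝ, EG)) y hL.contMDiffAt hy).contDiffAt

/-- The product rule for `omegaL_triMap`: the three lines differentiate the Hessian, the
coefficients of `W` and those of `Z`. -/
theorem anchorDeriv_omegaL (bp : 𝒢.Biparam h P Q) {Z W U : FieldPair EG G}
    {z w u : V × V → V × V} (hZ : 𝒢.IsSection Z) (hW : 𝒢.IsSection W)
    (hz : 𝒢.PullsBack h P Q Z z) (hw : 𝒢.PullsBack h P Q W w) (hu : 𝒢.PullsBack h P Q U u)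
    (hL : ContMDiff 𝓘(ℝ, EG) 𝓘(ℝ, ℝ) ∞ L) {H : V × V → V × V →L[ℝ] V × V →L[ℝ] ℝ}
    (hH : H = fderiv ℝ (fderiv ℝ (L ∘ 𝒢.triMap h P Q))) :
    anchorDeriv U (𝒢.omegaL L Z W) h =
      (fderiv ℝ H 0 (u 0) ((w 0).1, 0) (0, (z 0).2) -
        fderiv ℝ H 0 (u 0) ((z 0).1, 0) (0, (w 0).2)) +
      (H 0 ((fderiv ℝ w 0 (u 0)).1, 0) (0, (z 0).2) -
        H 0 ((z 0).1, 0) (0, (fderiv ℝ w 0 (u 0)).2)) +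
      (H 0 ((w 0).1, 0) (0, (fderiv ℝ z 0 (u 0)).2) -
        H 0 ((fderiv ℝ z 0 (u 0)).1, 0) (0, (w 0).2)) := by
  have hHd : DifferentiableAt ℝ H 0 := by
    rw [hH]
    exact (((bp.contDiffAt_lagrangian hL).self_of_nhds.fderiv_right (m := ∞)
      (by simp)).fderiv_right (m := ∞) (by simp)).differentiableAt (by simp)
  rw [anchorDeriv_eq bp hu (mdifferentiableAt_omegaL hZ hW hL h)]
  have e1 : (𝒢.omegaL L Z W ∘ 𝒢.triMap h P Q) =ᶠ[𝓝 0] _ := omegaL_triMap bp hZ hW hz hw hL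
  rw [e1.fderiv_eq, ← hH]
  have hzd := hz.contDiffAt.differentiableAt (by simp)
  have hwd := hw.contDiffAt.differentiableAt (by simp)
  have hl : ∀ {z : V × V → V × V}, DifferentiableAt ℝ z 0 →
      HasFDerivAt (fun y => ((z y).1, (0 : V)))
      (((ContinuousLinearMap.fst ℝ _ _).comp (fderiv ℝ z 0)).prod 0) 0 := fun hz =>
    hz.hasFDerivAt.fst.prodMk (hasFDerivAt_const _ _)
  have hr : ∀ {z : V × V → V × V}, DifferentiableAt ℝ z 0 →
      HasFDerivAt (fun y => ((0 : V), (z y).2))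
      ((0 : V × V →L[ℝ] V).prod ((ContinuousLinearMap.snd ℝ _ _).comp (fderiv ℝ z 0))) 0 :=
    fun hz => (hasFDerivAt_const _ _).prodMk hz.hasFDerivAt.snd
  have e2 := (((hHd.hasFDerivAt.clm_apply (hl hwd)).clm_apply (hr hzd)).sub
    ((hHd.hasFDerivAt.clm_apply (hl hzd)).clm_apply (hr hwd))).fderiv
  refine (congrArg (fun A : V × V →L[ℝ] ℝ => A (u 0)) e2).trans ?_
  simp
  ring

/-- This is `d² = 0` on `V × V`. Derivatives of the coefficients cancel between the anchor terms and
the bracket terms, and the remaining third derivatives of `ℓ` cancel by symmetry. -/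
theorem dTwo_omegaL_eq_zero_of_pullsBack (bp : 𝒢.Biparam h P Q) {Z₀ Z₁ Z₂ : FieldPair EG G}
    (h₀ : 𝒢.IsSection Z₀) (h₁ : 𝒢.IsSection Z₁) (h₂ : 𝒢.IsSection Z₂)
    {x₀ x₁ x₂ : V × V → V × V} (hz₀ : 𝒢.PullsBack h P Q Z₀ x₀) (hz₁ : 𝒢.PullsBack h P Q Z₁ x₁)
    (hz₂ : 𝒢.PullsBack h P Q Z₂ x₂) (hL : ContMDiff 𝓘(ℝ, EG) 𝓘(ℝ, ℝ) ∞ L) :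
    𝒢.dTwo (𝒢.omegaL L) Z₀ Z₁ Z₂ h = 0 := by
  have T1 := third_fderiv_comm_left (bp.contDiffAt_lagrangian hL).self_of_nhds
  have T2 := third_fderiv_comm_right (bp.contDiffAt_lagrangian hL)
  rw [dTwo, anchorDeriv_omegaL bp h₁ h₂ hz₁ hz₂ hz₀ hL rfl,
    anchorDeriv_omegaL bp h₀ h₂ hz₀ hz₂ hz₁ hL rfl,
    anchorDeriv_omegaL bp h₀ h₁ hz₀ hz₁ hz₂ hL rfl,
    omegaL_eq bp (h₀.prolBracket h₁) h₂ (hz₀.prolBracket bp h₀ h₁ hz₁) hz₂ hL,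
    omegaL_eq bp (h₀.prolBracket h₂) h₁ (hz₀.prolBracket bp h₀ h₂ hz₂) hz₁ hL,
    omegaL_eq bp (h₁.prolBracket h₂) h₀ (hz₁.prolBracket bp h₁ h₂ hz₂) hz₀ hL]
  set H := fderiv ℝ (fderiv ℝ (L ∘ 𝒢.triMap h P Q)) 0
  set T := fderiv ℝ (fderiv ℝ (fderiv ℝ (L ∘ 𝒢.triMap h P Q))) 0
  have hsplit : ∀ u v w : V × V, T u v w = T (u.1, 0) v w + T (0, u.2) v w := by
    intro u v w
    have e := T.map_add (u.1, 0) (0, u.2)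
    rw [Prod.mk_add_mk, add_zero, zero_add] at e
    exact congrArg (fun A : V × V →L[ℝ] V × V →L[ℝ] ℝ => A v w) e
  have T3 : ∀ u v w, T u v w = T w v u := fun u v w => by rw [T1, T2, T1]
  have hl : ∀ (x y : V) (c : V × V), H (x - y, 0) c = H (x, 0) c - H (y, 0) c := by
    intro x y c
    rw [← sub_apply, ← ContinuousLinearMap.map_sub]; simp
  have hr : ∀ (x y : V) (c : V × V), H c (0, x - y) = H c (0, x) - H c (0, y) := by
    intro x y c
    rw [← ContinuousLinearMap.map_sub]; simp
  simp only [VectorField.lieBracket, Prod.fst_sub, Prod.snd_sub, hl, hr]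
  -- After the split every argument of the third derivative is a pure `p`- or `q`-vector, and the
  -- terms cancel in pairs after permuting arguments.
  rw [hsplit (x₀ 0), hsplit (x₀ 0), hsplit (x₁ 0), hsplit (x₁ 0), hsplit (x₂ 0), hsplit (x₂ 0)]
  linarith [T1 ((x₀ 0).1, 0) ((x₂ 0).1, 0) (0, (x₁ 0).2),
    T1 ((x₀ 0).1, 0) ((x₁ 0).1, 0) (0, (x₂ 0).2), T1 ((x₁ 0).1, 0) ((x₂ 0).1, 0) (0, (x₀ 0).2),
    T3 (0, (x₀ 0).2) ((x₂ 0).1, 0) (0, (x₁ 0).2), T3 (0, (x₀ 0).2) ((x₁ 0).1, 0) (0, (x₂ 0).2),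
    T3 (0, (x₁ 0).2) ((x₀ 0).1, 0) (0, (x₂ 0).2)]

end Closed

theorem dTwo_omegaL_eq_zero {Z₀ Z₁ Z₂ : FieldPair EG G} (h₀ : 𝒢.IsSection Z₀)
    (h₁ : 𝒢.IsSection Z₁) (h₂ : 𝒢.IsSection Z₂) (hL : ContMDiff 𝓘(ℝ, EG) 𝓘(ℝ, ℝ) ∞ L) (g : G) :
    𝒢.dTwo (𝒢.omegaL L) Z₀ Z₁ Z₂ g = 0 := by
  obtain ⟨P, Q, bf⟩ := 𝒢.exists_biparamFamily g
  obtain ⟨z₀, -, hz₀⟩ := bf.exists_pullsBack h₀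
  obtain ⟨z₁, -, hz₁⟩ := bf.exists_pullsBack h₁
  obtain ⟨z₂, -, hz₂⟩ := bf.exists_pullsBack h₂
  exact dTwo_omegaL_eq_zero_of_pullsBack bf.biparam h₀ h₁ h₂ hz₀.self_of_nhds hz₁.self_of_nhds
    hz₂.self_of_nhds hL

end LieGroupoid

/-! ### Nondegeneracy of `Ω_L` and the mixed Hessian. -/

namespace LieGroupoid

variable {EG EM G M : Type*}
  [NormedAddCommGroup EG] [NormedSpace ℝ EG] [FiniteDimensional ℝ EG]
  [NormedAddCommGroup EM] [NormedSpace ℝ EM] [FiniteDimensional ℝ EM]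
  [TopologicalSpace G] [ChartedSpace EG G] [IsManifold 𝓘(ℝ, EG) ∞ G]
  [TopologicalSpace M] [ChartedSpace EM M] [IsManifold 𝓘(ℝ, EM) ∞ M]

/-- In finite dimension an injective `V → V*` is onto. A vector in the kernel of the transpose is
then annihilated by all linear forms, so it is zero. -/
theorem flip_injective_of_injective {V : Type*} [NormedAddCommGroup V] [NormedSpace ℝ V]
    [FiniteDimensional ℝ V] {B : V →L[ℝ] V →L[ℝ] ℝ} (hB : Function.Injective B) :
    Function.Injective B.flip := by
  have hfr : Module.finrank ℝ V = Module.finrank ℝ (V →L[ℝ] ℝ) := by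
    rw [← (LinearMap.toContinuousLinearMap (𝕜 := ℝ) (E := V) (F' := ℝ)).finrank_eq]
    exact (Subspace.dual_finrank_eq (K := ℝ) (V := V)).symm
  have hs : Function.Surjective B :=
    (LinearMap.injective_iff_surjective_of_finrank_eq_finrank (f := B.toLinearMap) hfr).1 hB
  rw [injective_iff_map_eq_zero]
  intro b hb
  by_contra hne
  obtain ⟨f, hf⟩ := SeparatingDual.exists_ne_zero (R := ℝ) hne
  obtain ⟨a, rfl⟩ := hs f
  exact hf (congrArg (fun A : V →L[ℝ] ℝ => A a) hb)

/-- The mixed second derivative at `h` of `L`, along the fibres of `β` and `α`. -/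
def mixedHessian (𝒢 : LieGroupoid EG EM G M) {V : Type*} [NormedAddCommGroup V] [NormedSpace ℝ V]
    (L : G → ℝ) (h : G) (P Q : V → G) : V →L[ℝ] V →L[ℝ] ℝ :=
  (fderiv ℝ (fderiv ℝ (L ∘ 𝒢.triMap h P Q)) 0).bilinearComp (ContinuousLinearMap.inl ℝ V V)
    (ContinuousLinearMap.inr ℝ V V)

variable {𝒢 : LieGroupoid EG EM G M} {L : G → ℝ} {h : G}

section

variable {V : Type*} [NormedAddCommGroup V] [NormedSpace ℝ V] {P Q : V → G}

theorem mixedHessian_apply (a b : V) : 𝒢.mixedHessian L h P Q a b =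
    fderiv ℝ (fderiv ℝ (L ∘ 𝒢.triMap h P Q)) 0 (a, 0) (0, b) := rfl

theorem PullsBack.bPart_center {Z : FieldPair EG G} {z : V × V → V × V} (bp : 𝒢.Biparam h P Q)
    (hz : 𝒢.PullsBack h P Q Z z) : (Z.bPart h : EG) = mfderiv 𝓘(ℝ, V) 𝓘(ℝ, EG) P 0 (z 0).1 := by
  have h3 : ∀ (T : VField EG G) {y y' : G} (_ : y = y'), (T y : EG) = T y' := by
    rintro T y _ rfl; rfl
  exact ((h3 Z.bPart bp.triMap_zero.symm).trans hz.bPart.self_of_nhds).trans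
    (bp.mfderiv_left _).symm

theorem PullsBack.aPart_center {Z : FieldPair EG G} {z : V × V → V × V} (bp : 𝒢.Biparam h P Q)
    (hz : 𝒢.PullsBack h P Q Z z) : (Z.aPart h : EG) = mfderiv 𝓘(ℝ, V) 𝓘(ℝ, EG) Q 0 (z 0).2 :=
  (hz.op bp).bPart_center bp.op

end

variable {P Q : AlgModel EG EM → G}

/-- Global smooth sections realize every pair of coefficients at `h`, so testing `Ω_L` on sections
is testing a bilinear form on `V × V`. -/
theorem Biparam.exists_section [T2Space G] (bp : 𝒢.Biparam h P Q)
    (hP : Function.Injective (mfderiv 𝓘(ℝ, AlgModel EG EM) 𝓘(ℝ, EG) P 0))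
    (hQ : Function.Injective (mfderiv 𝓘(ℝ, AlgModel EG EM) 𝓘(ℝ, EG) Q 0))
    (a b : AlgModel EG EM) : ∃ (Z : FieldPair EG G) (z : _ → AlgModel EG EM × AlgModel EG EM),
      𝒢.IsSection Z ∧ 𝒢.PullsBack h P Q Z z ∧ z 0 = (a, b) := by
  have h3 : ∀ (f : G → M) (y : G) (_ : y = h) (u : EG),
      (mfderiv 𝓘(ℝ, EG) 𝓘(ℝ, EM) f h u : EM) = mfderiv 𝓘(ℝ, EG) 𝓘(ℝ, EM) f y u := by
    rintro f _ rfl u; rfl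
  obtain ⟨X, hX1, hX2, hX3⟩ := exists_vertical_field 𝒢.isSubmersion_tgt h
    (mfderiv 𝓘(ℝ, AlgModel EG EM) 𝓘(ℝ, EG) P 0 a : EG) ((h3 _ _ bp.left_zero _).trans
      (mfderiv_comp_eq_zero (𝒢.contMDiff_tgt.mdifferentiableAt (by simp))
        (bp.contMDiffAt_left.mdifferentiableAt (by simp)) bp.tgt_left a))
  obtain ⟨Y, hY1, hY2, hY3⟩ := exists_vertical_field 𝒢.isSubmersion_src h
    (mfderiv 𝓘(ℝ, AlgModel EG EM) 𝓘(ℝ, EG) Q 0 b : EG) ((h3 _ _ bp.right_zero _).trans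
      (mfderiv_comp_eq_zero (𝒢.contMDiff_src.mdifferentiableAt (by simp))
        (bp.contMDiffAt_right.mdifferentiableAt (by simp)) bp.src_right b))
  have hZ : 𝒢.IsSection ⟨X, Y⟩ := ⟨hX1, hY1, hX2, hY2⟩
  obtain ⟨z, -, hz⟩ := (bp.family hP hQ).exists_pullsBack hZ
  refine ⟨⟨X, Y⟩, _, hZ, hz.self_of_nhds, Prod.ext ?_ ?_⟩
  · exact hP ((hz.self_of_nhds.bPart_center bp).symm.trans hX3)
  · exact hQ ((hz.self_of_nhds.aPart_center bp).symm.trans hY3)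

/-- With `H` the mixed Hessian, `Ω_L` is `((a, b), (a', b')) ↦ H(a', b) - H(a, b')`. Its kernel is
the sum of the kernels of `H` and of its transpose. -/
theorem Biparam.omegaL_nondegenerate_iff [T2Space G] (bp : 𝒢.Biparam h P Q)
    (hP : Function.Injective (mfderiv 𝓘(ℝ, AlgModel EG EM) 𝓘(ℝ, EG) P 0))
    (hQ : Function.Injective (mfderiv 𝓘(ℝ, AlgModel EG EM) 𝓘(ℝ, EG) Q 0))
    (hL : ContMDiff 𝓘(ℝ, EG) 𝓘(ℝ, ℝ) ∞ L) :
    (∀ Z : FieldPair EG G, 𝒢.IsSection Z →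
      (∀ W : FieldPair EG G, 𝒢.IsSection W → 𝒢.omegaL L Z W h = 0) →
        Z.bPart h = 0 ∧ Z.aPart h = 0) ↔ Function.Injective (𝒢.mixedHessian L h P Q) := by
  constructor
  · intro hnd
    rw [injective_iff_map_eq_zero]
    intro a ha
    obtain ⟨Z, z, hZ, hz, hz0⟩ := bp.exists_section hP hQ a 0
    have h1 := (hnd Z hZ fun W hW => by
      obtain ⟨w, -, hw⟩ := (bp.family hP hQ).exists_pullsBack hW
      rw [omegaL_eq bp hZ hW hz hw.self_of_nhds hL, hz0, ← mixedHessian_apply, ← mixedHessian_apply,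
        ha]
      simp).1
    have h2 := (hz.bPart_center bp).symm.trans h1
    rw [hz0] at h2
    exact hP (h2.trans (map_zero _).symm)
  · intro hinj Z hZ hZW
    obtain ⟨z, -, hz⟩ := (bp.family hP hQ).exists_pullsBack hZ
    replace hz := hz.self_of_nhds
    have key : ∀ a b, 𝒢.mixedHessian L h P Q a (z (h, 0)).2 -
        𝒢.mixedHessian L h P Q (z (h, 0)).1 b = 0 := by
      intro a b
      obtain ⟨W, w, hW, hw, hw0⟩ := bp.exists_section hP hQ a b
      have h1 := hZW W hW
      rw [omegaL_eq bp hZ hW hz hw hL, hw0] at h1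
      exact h1
    have ha : (z (h, 0)).1 = 0 := by
      refine (injective_iff_map_eq_zero _).1 hinj _ (ContinuousLinearMap.ext fun b => ?_)
      have := key 0 b
      simpa using this
    have hb : (z (h, 0)).2 = 0 := by
      refine (injective_iff_map_eq_zero _).1 (flip_injective_of_injective hinj) _
        (ContinuousLinearMap.ext fun a => ?_)
      have := key a 0
      simpa using this
    constructor
    · have h1 := hz.bPart_center bp
      simp only [ha] at h1
      exact h1.trans (map_zero _)
    · have h1 := hz.aPart_center bp
      simp only [hb] at h1
      exact h1.trans (map_zero _)

/-- Regularity in terms of one pair of immersed parametrizations through each point. -/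
theorem isRegular_iff [T2Space G] (hL : ContMDiff 𝓘(ℝ, EG) 𝓘(ℝ, ℝ) ∞ L)
    (P Q : G → AlgModel EG EM → G) (bp : ∀ g, 𝒢.Biparam g (P g) (Q g))
    (hP : ∀ g, Function.Injective (mfderiv 𝓘(ℝ, AlgModel EG EM) 𝓘(ℝ, EG) (P g) 0))
    (hQ : ∀ g, Function.Injective (mfderiv 𝓘(ℝ, AlgModel EG EM) 𝓘(ℝ, EG) (Q g) 0)) :
    𝒢.IsRegular L ↔ ∀ g, Function.Injective (𝒢.mixedHessian L g (P g) (Q g)) := by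
  have h1 := fun g => (bp g).omegaL_nondegenerate_iff (hP g) (hQ g) hL
  constructor
  · exact fun hreg g => (h1 g).1 (hreg.1 g)
  · exact fun hnd => ⟨fun g => (h1 g).2 (hnd g), fun _ _ _ h₀ h₁ h₂ => dTwo_omegaL_eq_zero h₀ h₁ h₂ hL⟩

end LieGroupoid

namespace LieGroupoid

variable {EG EM G M : Type*}
  [NormedAddCommGroup EG] [NormedSpace ℝ EG] [FiniteDimensional ℝ EG]
  [NormedAddCommGroup EM] [NormedSpace ℝ EM] [FiniteDimensional ℝ EM]
  [TopologicalSpace G] [ChartedSpace EG G] [IsManifold 𝓘(ℝ, EG) ∞ G]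
  [TopologicalSpace M] [ChartedSpace EM M] [IsManifold 𝓘(ℝ, EM) ∞ M]
  (𝒢 : LieGroupoid EG EM G M)

/-! ### The Legendre transformation in coordinates -/

theorem mem_trivializationAt_baseSet {i x : M} (hx : x ∈ 𝒢.baseSet i) :
    x ∈ (trivializationAt (AlgModel EG EM) 𝒢.Alg i).baseSet := hx

theorem incl_symmL {i x : M} (hx : x ∈ 𝒢.baseSet i) (w : AlgModel EG EM) :
    𝒢.incl x ((trivializationAt (AlgModel EG EM) 𝒢.Alg i).symmL ℝ x w) = 𝒢.bwd i x w := by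
  set v := (trivializationAt (AlgModel EG EM) 𝒢.Alg i).symmL ℝ x w with hv
  have h1 : (trivializationAt (AlgModel EG EM) 𝒢.Alg i).continuousLinearMapAt ℝ x v = w :=
    Trivialization.continuousLinearMapAt_symmL _ (𝒢.mem_trivializationAt_baseSet hx) w
  rw [Trivialization.continuousLinearMapAt_apply_of_mem ℝ _ (𝒢.mem_trivializationAt_baseSet hx)]
    at h1
  have h2 : 𝒢.fwd i x v = w := h1
  rw [← 𝒢.bwd_fwd hx v, h2]

variable {i : M}

/-- The passage from the coordinates on `A_x G` given by the trivialization around `i` to those given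
by a chart adapted to the fibres of `α`. -/
def fibreCoord (S : FibreChart EG EM (AlgModel EG EM) 𝒢.src (𝒢.unit i)) (x : M) :
    AlgModel EG EM →L[ℝ] AlgModel EG EM :=
  (mfderiv 𝓘(ℝ, EG) 𝓘(ℝ, AlgModel EG EM) S.coord (𝒢.unit x)).comp (𝒢.bwd i x)

variable (S : FibreChart EG EM (AlgModel EG EM) 𝒢.src (𝒢.unit i))

/-- In the tangent coordinates at `ε(i)`, `bwd` is the inverse of the smooth family `split`, and
inversion of continuous linear maps is smooth. -/
theorem contMDiffAt_fibreCoord :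
    ContMDiffAt 𝓘(ℝ, EM) 𝓘(ℝ, AlgModel EG EM →L[ℝ] AlgModel EG EM) ∞ (𝒢.fibreCoord S) i := by
  have h1 := ((S.contMDiffAt_coord S.mem_dom).mfderiv_const (m := ∞) (by simp)).comp i
    𝒢.contMDiff_unit.contMDiffAt
  have ha : ContMDiffAt 𝓘(ℝ, EM) 𝓘(ℝ, EG →L[ℝ] EM × AlgModel EG EM) ∞ (𝒢.split i) i :=
    (𝒢.contMDiffOn_split i).contMDiffAt ((𝒢.isOpen_chartDom i).mem_nhds (𝒢.mem_chartDom i))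
  have h2 := (((𝒢.mem_baseSet i).2.contDiffAt_map_inverse (n := ∞)).contMDiffAt.comp i ha)
  refine (h1.clm_comp (h2.clm_comp (contMDiffAt_const
    (c := ContinuousLinearMap.inr ℝ EM (AlgModel EG EM))))).congr_of_eventuallyEq
    (f₁ := 𝒢.fibreCoord S) (Filter.Eventually.of_forall fun x => ?_)
  simp only [Function.comp_apply, inTangentCoordinates, ContinuousLinearMap.inCoordinates,
    TangentBundle.continuousLinearMapAt_model_space]
  rfl

theorem bwd_eq_mfderiv_param {x : M} (hx : x ∈ 𝒢.baseSet i) (hS : 𝒢.unit x ∈ S.dom)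
    (w : AlgModel EG EM) : (𝒢.bwd i x w : EG) =
      mfderiv 𝓘(ℝ, AlgModel EG EM) 𝓘(ℝ, EG) (fun u => S.param (𝒢.unit x, u)) 0
        (𝒢.fibreCoord S x w) :=
  (S.mfderiv_param_coord hS (𝒢.contMDiff_src.mdifferentiableAt (by simp)) _
    (𝒢.bwd_mem hx w)).symm

theorem surjective_fibreCoord : Function.Surjective (𝒢.fibreCoord S i) := by
  have hinj : Function.Injective (𝒢.fibreCoord S i) := by
    rw [injective_iff_map_eq_zero]
    intro w hw
    have h1 := 𝒢.bwd_eq_mfderiv_param S (𝒢.mem_baseSet i) S.mem_dom w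
    rw [hw] at h1
    have h2 : 𝒢.bwd i i w = 0 := h1.trans (map_zero _)
    have h3 := 𝒢.tcoord_bwd (𝒢.mem_baseSet i) w
    rw [h2, map_zero] at h3
    have h4 := (𝒢.split_inverse (𝒢.mem_baseSet i) w).2
    rw [← h3, map_zero] at h4
    exact h4.symm
  exact LinearMap.surjective_of_injective (f := (𝒢.fibreCoord S i).toLinearMap) hinj

/-- The derivative of `L` along the left translates of the fibres of `α`. -/
def fibreDeriv (L : G → ℝ) (g : G) : AlgModel EG EM →L[ℝ] ℝ :=
  fderiv ℝ (fun u => L (𝒢.mul g (S.param (𝒢.unit (𝒢.tgt g), u)))) 0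

variable {𝒢} {L : G → ℝ}

theorem contMDiffAt_mul_param {g : G} (hg : 𝒢.unit (𝒢.tgt g) ∈ S.dom) {u : AlgModel EG EM}
    (hu : u ∈ S.ball) :
    ContMDiffAt (𝓘(ℝ, EG).prod 𝓘(ℝ, AlgModel EG EM)) 𝓘(ℝ, EG) ∞
      (fun p : G × AlgModel EG EM => 𝒢.mul p.1 (S.param (𝒢.unit (𝒢.tgt p.1), p.2))) (g, u) := by
  have hut : Continuous fun k => 𝒢.unit (𝒢.tgt k) :=
    𝒢.contMDiff_unit.continuous.comp 𝒢.contMDiff_tgt.continuous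
  have h1 : ContMDiffAt (𝓘(ℝ, EG).prod 𝓘(ℝ, AlgModel EG EM))
      (𝓘(ℝ, EG).prod 𝓘(ℝ, AlgModel EG EM)) ∞
      (fun p : G × AlgModel EG EM => (𝒢.unit (𝒢.tgt p.1), p.2)) (g, u) :=
    ((𝒢.contMDiff_unit.comp 𝒢.contMDiff_tgt).contMDiffAt.comp (g, u) contMDiffAt_fst).prodMk
      contMDiffAt_snd
  refine 𝒢.contMDiffAt_mul contMDiffAt_fst
    (ContMDiffAt.comp (g, u) (g := S.param) (S.contMDiffAt_param hg hu) h1) ?_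
  have hc : ContinuousAt (fun p : G × AlgModel EG EM => (𝒢.unit (𝒢.tgt p.1), p.2)) (g, u) :=
    h1.continuousAt
  filter_upwards [hc.eventually ((S.isOpen_dom.prod S.isOpen_ball).mem_nhds ⟨hg, hu⟩)] with p hp
  have h2 := S.map_param _ hp.1 _ hp.2
  rw [h2, 𝒢.src_unit]

theorem contMDiffAt_fibreDeriv (hL : ContMDiff 𝓘(ℝ, EG) 𝓘(ℝ, ℝ) ∞ L) {g : G}
    (hg : 𝒢.unit (𝒢.tgt g) ∈ S.dom) :
    ContMDiffAt 𝓘(ℝ, EG) 𝓘(ℝ, AlgModel EG EM →L[ℝ] ℝ) ∞ (𝒢.fibreDeriv S L) g := by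
  have h1 := ContMDiffAt.comp (I' := 𝓘(ℝ, EG)) (g, (0 : AlgModel EG EM)) hL.contMDiffAt
    (contMDiffAt_mul_param S hg S.zero_mem_ball)
  exact (contMDiffAt_fderiv_snd h1).comp g (f := fun k => (k, (0 : AlgModel EG EM)))
    (contMDiffAt_id.prodMk contMDiffAt_const)

theorem inCoordinates_dual_apply {i x : M} (φ : 𝒢.DualAlg x) (w : AlgModel EG EM) :
    ContinuousLinearMap.inCoordinates (AlgModel EG EM) 𝒢.Alg ℝ (Bundle.Trivial M ℝ) i x i x φ w =
      φ ((trivializationAt (AlgModel EG EM) 𝒢.Alg i).symmL ℝ x w) := by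
  have h1 : (Bundle.Trivial.trivialization M ℝ).linearMapAt ℝ x = LinearMap.id :=
    Bundle.Trivial.linearMapAt_trivialization ℝ M ℝ x
  exact congrArg (fun A : ℝ →ₗ[ℝ] ℝ =>
    A (φ ((trivializationAt (AlgModel EG EM) 𝒢.Alg i).symmL ℝ x w))) h1

/-- A frame vector of `AG` is a velocity of the fibre chart, with coefficient given by `fibreCoord`.
Evaluating `F⁺L` on it is therefore an ordinary derivative in the fibre parameter. -/
theorem legendrePlus_inCoordinates (hL : ContMDiff 𝓘(ℝ, EG) 𝓘(ℝ, ℝ) ∞ L) {g : G}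
    (hx : 𝒢.tgt g ∈ 𝒢.baseSet i) (hg : 𝒢.unit (𝒢.tgt g) ∈ S.dom) :
    ContinuousLinearMap.inCoordinates (AlgModel EG EM) 𝒢.Alg ℝ (Bundle.Trivial M ℝ) i (𝒢.tgt g) i
      (𝒢.tgt g) (𝒢.legendrePlus L g).2 = (𝒢.fibreDeriv S L g).comp (𝒢.fibreCoord S (𝒢.tgt g)) := by
  ext w
  set x := 𝒢.tgt g with hxg
  have h0 : S.param (𝒢.unit x, 0) = 𝒢.unit x := S.param_zero _ hg
  have h1 : MDifferentiableWithinAt 𝓘(ℝ, EG) 𝓘(ℝ, ℝ) (fun k => L (𝒢.mul g k))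
      (𝒢.src ⁻¹' {x}) (S.param (𝒢.unit x, 0)) := by
    rw [h0]
    have h2 := 𝒢.mdifferentiableWithinAt_mul_left (g := g) (k := 𝒢.unit x) (𝒢.src_unit _).symm
    rw [𝒢.src_unit] at h2
    exact MDifferentiableAt.comp_mdifferentiableWithinAt (I' := 𝓘(ℝ, EG)) (𝒢.unit x)
      (hL.contMDiffAt.mdifferentiableAt (by simp)) h2
  have h3 := mfderivWithin_apply_mfderiv (J := 𝓘(ℝ, ℝ))
    (c := fun u => S.param (𝒢.unit x, u)) (v := 0) h1
    ((S.contMDiffAt_param_right hg S.zero_mem_ball).mdifferentiableAt (by simp))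
    ((S.eventually_map_param hg).mono fun u hu => hu.trans (𝒢.src_unit x))
    (𝒢.fibreCoord S x w)
  rw [mfderiv_eq_fderiv] at h3
  refine Eq.trans ?_ h3
  have h4 : ∀ (y : G) (_ : y = 𝒢.unit x) (u : EG),
      (mfderivWithin 𝓘(ℝ, EG) 𝓘(ℝ, ℝ) (fun k => L (𝒢.mul g k)) (𝒢.src ⁻¹' {x}) (𝒢.unit x) u : ℝ) =
      mfderivWithin 𝓘(ℝ, EG) 𝓘(ℝ, ℝ) (fun k => L (𝒢.mul g k)) (𝒢.src ⁻¹' {x}) y u := by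
    rintro _ rfl u; rfl
  refine Eq.trans ?_ (h4 _ h0 _)
  refine (inCoordinates_dual_apply (i := i) (x := x) (𝒢.legendrePlus L g).2 w).trans ?_
  change mfderivWithin 𝓘(ℝ, EG) 𝓘(ℝ, ℝ) (fun k => L (𝒢.mul g k)) (𝒢.src ⁻¹' {x}) (𝒢.unit x)
    (𝒢.incl x ((trivializationAt (AlgModel EG EM) 𝒢.Alg i).symmL ℝ x w)) = _
  rw [𝒢.incl_symmL hx]
  exact congrArg (fun u : EG => (mfderivWithin 𝓘(ℝ, EG) 𝓘(ℝ, ℝ) (fun k => L (𝒢.mul g k))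
    (𝒢.src ⁻¹' {x}) (𝒢.unit x) u : ℝ)) (𝒢.bwd_eq_mfderiv_param S hx hg w)

theorem contMDiff_legendrePlus (hL : ContMDiff 𝓘(ℝ, EG) 𝓘(ℝ, ℝ) ∞ L) :
    ContMDiff 𝓘(ℝ, EG) (𝓘(ℝ, EM).prod 𝓘(ℝ, AlgModel EG EM →L[ℝ] ℝ)) ∞ (𝒢.legendrePlus L) := by
  intro g
  obtain ⟨S⟩ := nonempty_fibreChart 𝒢.isSubmersion_src (𝒢.unit (𝒢.tgt g))
  refine (contMDiffAt_hom_bundle _).2 ⟨𝒢.contMDiff_tgt.contMDiffAt, ?_⟩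
  have hut : Continuous fun k => 𝒢.unit (𝒢.tgt k) :=
    𝒢.contMDiff_unit.continuous.comp 𝒢.contMDiff_tgt.continuous
  have h1 := (contMDiffAt_fibreDeriv S hL (g := g) S.mem_dom).clm_comp
    ((𝒢.contMDiffAt_fibreCoord S).comp g 𝒢.contMDiff_tgt.contMDiffAt)
  refine h1.congr_of_eventuallyEq ?_
  filter_upwards [hut.continuousAt.eventually (S.isOpen_dom.mem_nhds S.mem_dom),
    𝒢.contMDiff_tgt.continuous.continuousAt.eventually
      ((𝒢.isOpen_baseSet (𝒢.tgt g)).mem_nhds (𝒢.mem_baseSet _))] with k hk hk'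
  exact legendrePlus_inCoordinates S hL hk' hk

end LieGroupoid

/-! ### The differential of `F⁺L` and regularity. -/

namespace LieGroupoid

variable {EG EM G M : Type*}
  [NormedAddCommGroup EG] [NormedSpace ℝ EG] [FiniteDimensional ℝ EG]
  [NormedAddCommGroup EM] [NormedSpace ℝ EM] [FiniteDimensional ℝ EM]
  [TopologicalSpace G] [ChartedSpace EG G] [IsManifold 𝓘(ℝ, EG) ∞ G]
  [TopologicalSpace M] [ChartedSpace EM M] [IsManifold 𝓘(ℝ, EM) ∞ M]
  {𝒢 : LieGroupoid EG EM G M} {L : G → ℝ} {g : G}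
  (S : FibreChart EG EM (AlgModel EG EM) 𝒢.src (𝒢.unit (𝒢.tgt g)))
  (R : FibreChart EG EM (AlgModel EG EM) 𝒢.tgt g)

/-- The `α`-fibre through `g`, parametrized by left translation from the unit. -/
def translateParam (u : AlgModel EG EM) : G := 𝒢.mul g (S.param (𝒢.unit (𝒢.tgt g), u))

theorem biparam_translateParam :
    𝒢.Biparam g (fun v => R.param (g, v)) (translateParam S) := by
  have hR : ∀ᶠ v in 𝓝 (0 : AlgModel EG EM), v ∈ R.ball := R.isOpen_ball.mem_nhds R.zero_mem_ball
  have hS : ∀ᶠ v in 𝓝 (0 : AlgModel EG EM), v ∈ S.ball := S.isOpen_ball.mem_nhds S.zero_mem_ball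
  refine ⟨R.param_zero _ R.mem_dom, ?_, ?_, ?_, R.eventually_map_param R.mem_dom, ?_⟩
  · rw [translateParam, S.param_zero _ S.mem_dom, 𝒢.mul_unit]
  · exact hR.mono fun v hv => R.contMDiffAt_param_right R.mem_dom hv
  · filter_upwards [hS] with u hu
    exact (contMDiffAt_mul_param S (g := g) S.mem_dom hu).comp u
      (contMDiffAt_const.prodMk contMDiffAt_id)
  · filter_upwards [S.eventually_map_param S.mem_dom] with u hu
    exact 𝒢.src_mul _ _ (hu.trans (𝒢.src_unit _)).symm

theorem injective_mfderiv_param : Function.Injective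
    (mfderiv 𝓘(ℝ, AlgModel EG EM) 𝓘(ℝ, EG) (fun v => R.param (g, v)) 0) := by
  intro v w hvw
  rw [← R.mfderiv_coord_param R.mem_dom v, ← R.mfderiv_coord_param R.mem_dom w, hvw]

/-- Left translation by `g⁻¹` turns this map back into the parametrization at the unit, which
`coord` shows to be immersed. -/
theorem injective_mfderiv_translateParam : Function.Injective
    (mfderiv 𝓘(ℝ, AlgModel EG EM) 𝓘(ℝ, EG) (translateParam S) 0) := by
  obtain ⟨R⟩ := nonempty_fibreChart 𝒢.isSubmersion_tgt g
  have bp := biparam_translateParam S R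
  have h1 : ∀ v : AlgModel EG EM,
      (𝒢.leftT (𝒢.inv g) g
        (mfderiv 𝓘(ℝ, AlgModel EG EM) 𝓘(ℝ, EG) (translateParam S) 0 v : EG) : EG) =
      mfderiv 𝓘(ℝ, AlgModel EG EM) 𝓘(ℝ, EG) (fun u => S.param (𝒢.unit (𝒢.tgt g), u)) 0 v := by
    intro v
    refine (𝒢.leftT_mfderiv bp.right_zero (𝒢.tgt_inv g)
      (bp.contMDiffAt_right.mdifferentiableAt (by simp)) bp.src_right v).trans ?_
    have hev : (fun u => 𝒢.mul (𝒢.inv g) (translateParam S u)) =ᶠ[𝓝 0]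
        fun u => S.param (𝒢.unit (𝒢.tgt g), u) := by
      filter_upwards [S.eventually_map_param S.mem_dom] with u hu
      exact 𝒢.inv_mul_cancel_left (hu.trans (𝒢.src_unit _)).symm
    exact congrArg (fun A : AlgModel EG EM →L[ℝ] EG => A v) hev.mfderiv_eq
  intro v w hvw
  have h2 := (h1 v).symm.trans ((congrArg (fun u : EG => (𝒢.leftT (𝒢.inv g) g u : EG)) hvw).trans
    (h1 w))
  rw [← S.mfderiv_coord_param S.mem_dom v, ← S.mfderiv_coord_param S.mem_dom w]
  exact congrArg (mfderiv 𝓘(ℝ, EG) 𝓘(ℝ, AlgModel EG EM) S.coord (𝒢.unit (𝒢.tgt g))) h2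

/-- The derivative of the Legendre transformation along the `β`-fibres, in coordinates. -/
theorem fderiv_fibreDeriv (hL : ContMDiff 𝓘(ℝ, EG) 𝓘(ℝ, ℝ) ∞ L) :
    HasFDerivAt (fun s => (𝒢.fibreDeriv S L (R.param (g, s))).comp (𝒢.fibreCoord S (𝒢.tgt g)))
      ((((ContinuousLinearMap.compL ℝ (AlgModel EG EM) (AlgModel EG EM) ℝ).flip
        (𝒢.fibreCoord S (𝒢.tgt g)))).comp
        (𝒢.mixedHessian L g (fun v => R.param (g, v)) (translateParam S))) 0 := by
  have bp := biparam_translateParam S R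
  set ℓ := L ∘ 𝒢.triMap g (fun v => R.param (g, v)) (translateParam S) with hℓ
  have hℓs := bp.contDiffAt_lagrangian hL
  have hdd : HasFDerivAt (fderiv ℝ ℓ) (fderiv ℝ (fderiv ℝ ℓ) 0)
      ((0 : AlgModel EG EM), (0 : AlgModel EG EM)) :=
    ((hℓs.self_of_nhds.fderiv_right (m := ∞) (by simp)).differentiableAt (by simp)).hasFDerivAt
  have hc : Filter.Tendsto (fun s : AlgModel EG EM => (s, (0 : AlgModel EG EM))) (𝓝 0) (𝓝 0) := by
    have : ContinuousAt (fun s : AlgModel EG EM => (s, (0 : AlgModel EG EM))) 0 := by fun_prop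
    exact this
  -- The target is constant along the `β`-fibre, so the same unit serves for all `s`. With the
  -- `α`-fibre parametrized as `g S(u)`, the product `P(s) g⁻¹ g S(u)` is `P(s) S(u)`, and
  -- `fibreDeriv` is the `q`-derivative of `ℓ` at `(s, 0)`.
  have hev : (fun s => 𝒢.fibreDeriv S L (R.param (g, s))) =ᶠ[𝓝 0] fun s =>
      (fderiv ℝ ℓ (s, 0)).comp (ContinuousLinearMap.inr ℝ (AlgModel EG EM) (AlgModel EG EM)) := by
    filter_upwards [hc.eventually hℓs, R.eventually_map_param R.mem_dom] with s hs ht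
    have h1 := (HasFDerivAt.comp (0 : AlgModel EG EM) (f := fun u : AlgModel EG EM => (s, u))
      (hs.differentiableAt (by simp)).hasFDerivAt (hasFDerivAt_prodMk_right s 0)).fderiv
    refine Eq.trans ?_ h1
    refine Filter.EventuallyEq.fderiv_eq ?_
    filter_upwards [S.eventually_map_param S.mem_dom] with u hu
    refine congrArg L ?_
    rw [ht]
    have e1 : 𝒢.tgt g = 𝒢.src (S.param (𝒢.unit (𝒢.tgt g), u)) := (hu.trans (𝒢.src_unit _)).symm
    have e2 := 𝒢.tri_eq ht (𝒢.src_mul _ _ e1)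
    rw [𝒢.inv_mul_cancel_left e1] at e2
    exact e2.symm
  have h2 := HasFDerivAt.comp (0 : AlgModel EG EM) (f := fun s : AlgModel EG EM =>
    (s, (0 : AlgModel EG EM))) hdd (hasFDerivAt_prodMk_left 0 0)
  have h3 := (((ContinuousLinearMap.compL ℝ (AlgModel EG EM) (AlgModel EG EM × AlgModel EG EM) ℝ).flip
    ((ContinuousLinearMap.inr ℝ (AlgModel EG EM) (AlgModel EG EM)).comp
      (𝒢.fibreCoord S (𝒢.tgt g))))).hasFDerivAt.comp (0 : AlgModel EG EM) h2
  refine (h3.congr_of_eventuallyEq ?_)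
  filter_upwards [hev] with s hs
  rw [hs]
  rfl

/-- Along a `β`-fibre the base point of `F⁺L` is fixed, so in a trivialization only the fibre part
`Ψ` moves. Its derivative is the mixed Hessian composed with the surjective map `N`, which loses no
information. -/
theorem mfderiv_legendrePlus_eq_zero_iff (hL : ContMDiff 𝓘(ℝ, EG) 𝓘(ℝ, ℝ) ∞ L)
    (a : AlgModel EG EM) :
    mfderiv 𝓘(ℝ, AlgModel EG EM) (𝓘(ℝ, EM).prod 𝓘(ℝ, AlgModel EG EM →L[ℝ] ℝ))
      (fun s => 𝒢.legendrePlus L (R.param (g, s))) 0 a = 0 ↔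
      𝒢.mixedHessian L g (fun v => R.param (g, v)) (translateParam S) a = 0 := by
  let x := 𝒢.tgt g
  set F : AlgModel EG EM → 𝒢.DualTotal := fun s => 𝒢.legendrePlus L (R.param (g, s)) with hF
  set e := trivializationAt (AlgModel EG EM →L[ℝ] ℝ) 𝒢.DualAlg x with he
  set N := 𝒢.fibreCoord S x with hN
  set Ψ : AlgModel EG EM → AlgModel EG EM →L[ℝ] ℝ := fun s =>
    (𝒢.fibreDeriv S L (R.param (g, s))).comp N with hΨ
  have hΨd := fderiv_fibreDeriv S R hL
  have hΨ0 : 𝒢.mixedHessian L g (fun v => R.param (g, v)) (translateParam S) a = 0 →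
      (mfderiv 𝓘(ℝ, AlgModel EG EM) 𝓘(ℝ, AlgModel EG EM →L[ℝ] ℝ) Ψ 0 a :
        AlgModel EG EM →L[ℝ] ℝ) = 0 := by
    intro h0
    rw [mfderiv_eq_fderiv, hΨd.fderiv]
    change (𝒢.mixedHessian L g (fun v => R.param (g, v)) (translateParam S) a).comp N = 0
    rw [h0, ContinuousLinearMap.zero_comp]
  have hxe : x ∈ e.baseSet := FiberBundle.mem_baseSet_trivializationAt' x
  have hFx : ∀ᶠ s in 𝓝 (0 : AlgModel EG EM), (F s).proj = x := R.eventually_map_param R.mem_dom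
  have hF0 : (F 0).proj = x := hFx.self_of_nhds
  have hRs := R.contMDiffAt_param_right R.mem_dom R.zero_mem_ball
  have hFs : ContMDiffAt 𝓘(ℝ, AlgModel EG EM) (𝓘(ℝ, EM).prod 𝓘(ℝ, AlgModel EG EM →L[ℝ] ℝ)) ∞ F 0 :=
    (contMDiff_legendrePlus hL).contMDiffAt.comp (0 : AlgModel EG EM) hRs
  have heF : ∀ᶠ s in 𝓝 (0 : AlgModel EG EM), e (F s) = (x, Ψ s) := by
    filter_upwards [R.eventually_map_param R.mem_dom] with s hs
    have hb : 𝒢.tgt (R.param (g, s)) ∈ 𝒢.baseSet x := by rw [hs]; exact 𝒢.mem_baseSet x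
    have hd : 𝒢.unit (𝒢.tgt (R.param (g, s))) ∈ S.dom := by rw [hs]; exact S.mem_dom
    refine Prod.ext hs ?_
    have h1 := legendrePlus_inCoordinates S hL hb hd
    refine Eq.trans h1 ?_
    rw [hs]
  have hsrc : F 0 ∈ e.source := e.mem_source.2 (by rw [hF0]; exact hxe)
  have hes : ContMDiffAt (𝓘(ℝ, EM).prod 𝓘(ℝ, AlgModel EG EM →L[ℝ] ℝ))
      (𝓘(ℝ, EM).prod 𝓘(ℝ, AlgModel EG EM →L[ℝ] ℝ)) ∞ e (F 0) :=
    (Trivialization.contMDiffOn (IB := 𝓘(ℝ, EM)) e).contMDiffAt (e.open_source.mem_nhds hsrc)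
  constructor
  · intro h0
    have h1 : ContMDiffAt (𝓘(ℝ, EM).prod 𝓘(ℝ, AlgModel EG EM →L[ℝ] ℝ))
      𝓘(ℝ, AlgModel EG EM →L[ℝ] ℝ) ∞ (fun p => (e p).2) (F 0) := contMDiffAt_snd.comp _ hes
    have h2 := mfderiv_comp (I' := 𝓘(ℝ, EM).prod 𝓘(ℝ, AlgModel EG EM →L[ℝ] ℝ))
      (0 : AlgModel EG EM) (h1.mdifferentiableAt (by simp)) (hFs.mdifferentiableAt (by simp))
    have hev : ((fun p => (e p).2) ∘ F) =ᶠ[𝓝 0] Ψ := by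
      filter_upwards [heF] with s hs
      simp [hs]
    rw [hev.mfderiv_eq, mfderiv_eq_fderiv, hΨd.fderiv] at h2
    have h3 := congrArg (fun A : AlgModel EG EM →L[ℝ] AlgModel EG EM →L[ℝ] ℝ => A a) h2
    have h4 : ((𝒢.mixedHessian L g (fun v => R.param (g, v)) (translateParam S)) a).comp N = 0 :=
      h3.trans ((congrArg (mfderiv (𝓘(ℝ, EM).prod 𝓘(ℝ, AlgModel EG EM →L[ℝ] ℝ))
        𝓘(ℝ, AlgModel EG EM →L[ℝ] ℝ) (fun p => (e p).2) (F 0)) h0).trans (ContinuousLinearMap.map_zero _))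
    refine ContinuousLinearMap.ext fun b => ?_
    obtain ⟨w, rfl⟩ := 𝒢.surjective_fibreCoord S b
    exact congrArg (fun A : AlgModel EG EM →L[ℝ] ℝ => A w) h4
  · intro h0
    -- The inclusion of the fibre over `x`, through which `F` factors near `0` as `j ∘ Ψ`.
    set j : (AlgModel EG EM →L[ℝ] ℝ) → 𝒢.DualTotal := fun φ =>
      e.toOpenPartialHomeomorph.symm (x, φ) with hj
    have h1 : ContMDiffAt 𝓘(ℝ, AlgModel EG EM →L[ℝ] ℝ)
        (𝓘(ℝ, EM).prod 𝓘(ℝ, AlgModel EG EM →L[ℝ] ℝ)) ∞ j (Ψ 0) := by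
      have h2 : ContMDiffAt (𝓘(ℝ, EM).prod 𝓘(ℝ, AlgModel EG EM →L[ℝ] ℝ))
        (𝓘(ℝ, EM).prod 𝓘(ℝ, AlgModel EG EM →L[ℝ] ℝ)) ∞ e.toOpenPartialHomeomorph.symm (x, Ψ 0) :=
        (Trivialization.contMDiffOn_symm (IB := 𝓘(ℝ, EM)) e).contMDiffAt
          (e.open_target.mem_nhds (e.mem_target.2 hxe))
      exact ContMDiffAt.comp (Ψ 0) (f := fun φ => (x, φ)) h2
        (contMDiffAt_const.prodMk contMDiffAt_id)
    have h2 := mfderiv_comp (I' := 𝓘(ℝ, AlgModel EG EM →L[ℝ] ℝ))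
      (0 : AlgModel EG EM) (f := Ψ) (h1.mdifferentiableAt (by simp))
      hΨd.differentiableAt.mdifferentiableAt
    have hev : j ∘ Ψ =ᶠ[𝓝 0] F := by
      filter_upwards [heF, hFx] with s hs hs'
      have : F s ∈ e.source := e.mem_source.2 (by rw [hs']; exact hxe)
      rw [Function.comp_apply, hj]
      simp only
      rw [← hs]
      exact e.toOpenPartialHomeomorph.left_inv this
    rw [hev.mfderiv_eq] at h2
    have h3 := congrArg (fun A : AlgModel EG EM →L[ℝ] EM × (AlgModel EG EM →L[ℝ] ℝ) => A a) h2
    refine h3.trans ?_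
    refine (congrArg (mfderiv 𝓘(ℝ, AlgModel EG EM →L[ℝ] ℝ)
      (𝓘(ℝ, EM).prod 𝓘(ℝ, AlgModel EG EM →L[ℝ] ℝ)) j (Ψ 0)) (hΨ0 h0)).trans (ContinuousLinearMap.map_zero _)

/-- Since `F⁺L` covers `β`, a vector killed by its differential is tangent to the `β`-fibre, where
the mixed Hessian decides. Equality of dimensions upgrades injectivity to bijectivity. -/
theorem isLocalDiffeomorphAt_legendrePlus_iff (hL : ContMDiff 𝓘(ℝ, EG) 𝓘(ℝ, ℝ) ∞ L) :
    IsLocalDiffeomorphAt 𝓘(ℝ, EG) (𝓘(ℝ, EM).prod 𝓘(ℝ, AlgModel EG EM →L[ℝ] ℝ)) ∞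
      (𝒢.legendrePlus L) g ↔
    Function.Injective (𝒢.mixedHessian L g (fun v => R.param (g, v)) (translateParam S)) := by
  have hs := contMDiff_legendrePlus (𝒢 := 𝒢) hL
  have hR0 : R.param (g, 0) = g := R.param_zero g R.mem_dom
  have hRd := (R.contMDiffAt_param_right R.mem_dom R.zero_mem_ball).mdifferentiableAt
    (n := ∞) (by simp)
  have hFd : ∀ k, MDifferentiableAt 𝓘(ℝ, EG) (𝓘(ℝ, EM).prod 𝓘(ℝ, AlgModel EG EM →L[ℝ] ℝ))
      (𝒢.legendrePlus L) k := fun k => hs.contMDiffAt.mdifferentiableAt (by simp)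
  have hchain : ∀ a, (mfderiv 𝓘(ℝ, AlgModel EG EM) (𝓘(ℝ, EM).prod 𝓘(ℝ, AlgModel EG EM →L[ℝ] ℝ))
      (fun s => 𝒢.legendrePlus L (R.param (g, s))) 0 a : EM × (AlgModel EG EM →L[ℝ] ℝ)) =
      mfderiv 𝓘(ℝ, EG) (𝓘(ℝ, EM).prod 𝓘(ℝ, AlgModel EG EM →L[ℝ] ℝ)) (𝒢.legendrePlus L) g
        (mfderiv 𝓘(ℝ, AlgModel EG EM) 𝓘(ℝ, EG) (fun v => R.param (g, v)) 0 a : EG) := by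
    intro a
    have h1 := mfderiv_comp (I' := 𝓘(ℝ, EG)) (0 : AlgModel EG EM) (hFd _) hRd
    refine (congrArg (fun A : AlgModel EG EM →L[ℝ] EM × (AlgModel EG EM →L[ℝ] ℝ) => A a) h1).trans ?_
    have h3 : ∀ (y : G) (_ : y = g) (u : EG),
        (mfderiv 𝓘(ℝ, EG) (𝓘(ℝ, EM).prod 𝓘(ℝ, AlgModel EG EM →L[ℝ] ℝ)) (𝒢.legendrePlus L) y u :
          EM × (AlgModel EG EM →L[ℝ] ℝ)) =
        mfderiv 𝓘(ℝ, EG) (𝓘(ℝ, EM).prod 𝓘(ℝ, AlgModel EG EM →L[ℝ] ℝ)) (𝒢.legendrePlus L) g u := by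
      rintro _ rfl u; rfl
    exact h3 _ hR0 _
  constructor
  · intro hloc
    have hinj : Function.Injective (mfderiv 𝓘(ℝ, EG) (𝓘(ℝ, EM).prod 𝓘(ℝ, AlgModel EG EM →L[ℝ] ℝ))
        (𝒢.legendrePlus L) g) := by
      rw [← hloc.mfderivToContinuousLinearEquiv_coe (by simp)]
      exact (hloc.mfderivToContinuousLinearEquiv (by simp)).injective
    rw [injective_iff_map_eq_zero]
    intro a ha
    have h1 := (mfderiv_legendrePlus_eq_zero_iff S R hL a).2 ha
    have h2 := hinj (((hchain a).symm.trans h1).trans (ContinuousLinearMap.map_zero _).symm)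
    exact injective_mfderiv_param R (h2.trans (ContinuousLinearMap.map_zero _).symm)
  · intro hinj
    refine isLocalDiffeomorphAt_of_bijective_mfderiv (Filter.Eventually.of_forall hs) ?_
    set T : EG →L[ℝ] EM × (AlgModel EG EM →L[ℝ] ℝ) :=
      mfderiv 𝓘(ℝ, EG) (𝓘(ℝ, EM).prod 𝓘(ℝ, AlgModel EG EM →L[ℝ] ℝ)) (𝒢.legendrePlus L) g with hT
    have hTinj : Function.Injective T := by
      rw [injective_iff_map_eq_zero]
      intro X hX
      have h1 : mfderiv 𝓘(ℝ, EG) 𝓘(ℝ, EM) 𝒢.tgt g X = 0 := by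
        have h2 := mfderiv_comp (I' := 𝓘(ℝ, EM).prod 𝓘(ℝ, AlgModel EG EM →L[ℝ] ℝ)) g
          ((Bundle.contMDiff_proj (n := ∞) (IB := 𝓘(ℝ, EM)) 𝒢.DualAlg).contMDiffAt.mdifferentiableAt
            (by simp)) (hFd g)
        refine (congrArg (fun A : EG →L[ℝ] EM => A X) h2).trans ?_
        exact (congrArg (mfderiv (𝓘(ℝ, EM).prod 𝓘(ℝ, AlgModel EG EM →L[ℝ] ℝ)) 𝓘(ℝ, EM)
          (π (AlgModel EG EM →L[ℝ] ℝ) 𝒢.DualAlg) (𝒢.legendrePlus L g)) hX).trans (ContinuousLinearMap.map_zero _)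
      have h2 := R.mfderiv_param_coord R.mem_dom (𝒢.contMDiff_tgt.mdifferentiableAt (by simp)) X h1
      set a : AlgModel EG EM := mfderiv 𝓘(ℝ, EG) 𝓘(ℝ, AlgModel EG EM) R.coord g X
      have h3 : (𝒢.mixedHessian L g (fun v => R.param (g, v)) (translateParam S)) a = 0 :=
        (mfderiv_legendrePlus_eq_zero_iff S R hL a).1
          ((hchain a).trans ((congrArg T h2).trans hX))
      have h4 : a = 0 := hinj (h3.trans (ContinuousLinearMap.map_zero _).symm)
      rw [h4] at h2
      exact h2.symm.trans (ContinuousLinearMap.map_zero _)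
    -- The rank of the model fibre is a difference of natural numbers; this inequality rules out
    -- truncation.
    have hle : Module.finrank ℝ EM ≤ Module.finrank ℝ EG :=
      LinearMap.finrank_le_finrank_of_surjective (f := (𝒢.dsrc (𝒢.tgt g) (𝒢.tgt g)).toLinearMap)
        (𝒢.dsrc_surjective _)
    have hfr : Module.finrank ℝ EG = Module.finrank ℝ (EM × (AlgModel EG EM →L[ℝ] ℝ)) := by
      rw [Module.finrank_prod, ← (LinearMap.toContinuousLinearMap (𝕜 := ℝ) (E := AlgModel EG EM)
        (F' := ℝ)).finrank_eq, show Module.finrank ℝ (AlgModel EG EM →ₗ[ℝ] ℝ) =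
          Module.finrank ℝ (AlgModel EG EM) from Subspace.dual_finrank_eq, finrank_euclideanSpace_fin]
      omega
    exact ⟨hTinj, (LinearMap.injective_iff_surjective_of_finrank_eq_finrank
      (f := T.toLinearMap) hfr).1 hTinj⟩

theorem isRegular_iff_legendrePlus [T2Space G] (hL : ContMDiff 𝓘(ℝ, EG) 𝓘(ℝ, ℝ) ∞ L) :
    𝒢.IsRegular L ↔
      IsLocalDiffeomorph 𝓘(ℝ, EG) (𝓘(ℝ, EM).prod 𝓘(ℝ, AlgModel EG EM →L[ℝ] ℝ)) ∞
        (𝒢.legendrePlus L) := by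
  have S := fun g => (nonempty_fibreChart 𝒢.isSubmersion_src (𝒢.unit (𝒢.tgt g))).some
  have R := fun g => (nonempty_fibreChart 𝒢.isSubmersion_tgt g).some
  rw [isRegular_iff hL (fun g v => (R g).param (g, v)) (fun g => translateParam (S g))
    (fun g => biparam_translateParam (S g) (R g)) (fun g => injective_mfderiv_param (R g))
    (fun g => injective_mfderiv_translateParam (S g))]
  exact forall_congr' fun g => (isLocalDiffeomorphAt_legendrePlus_iff (S g) (R g) hL).symm

end LieGroupoid

/-! ### Inversion, and the passage from `F⁺L` to `F⁻L`. -/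

namespace LieGroupoid

variable {EG EM G M : Type*}
  [NormedAddCommGroup EG] [NormedSpace ℝ EG] [FiniteDimensional ℝ EG]
  [NormedAddCommGroup EM] [NormedSpace ℝ EM] [FiniteDimensional ℝ EM]
  [TopologicalSpace G] [ChartedSpace EG G] [IsManifold 𝓘(ℝ, EG) ∞ G]
  [TopologicalSpace M] [ChartedSpace EM M] [IsManifold 𝓘(ℝ, EM) ∞ M]

/-- Inversion, as a diffeomorphism. -/
def invDiffeomorph (𝒢 : LieGroupoid EG EM G M) : Diffeomorph 𝓘(ℝ, EG) 𝓘(ℝ, EG) G G ∞ where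
  toFun := 𝒢.inv
  invFun := 𝒢.inv
  left_inv := 𝒢.inv_inv
  right_inv := 𝒢.inv_inv
  contMDiff_toFun := 𝒢.contMDiff_inv
  contMDiff_invFun := 𝒢.contMDiff_inv

/-- Multiplication by `-1` in the fibres of `A*G`. -/
def fibreNeg (𝒢 : LieGroupoid EG EM G M) (p : 𝒢.DualTotal) : 𝒢.DualTotal := ⟨p.1, -p.2⟩

theorem fibreNeg_fibreNeg (𝒢 : LieGroupoid EG EM G M) (p : 𝒢.DualTotal) :
    𝒢.fibreNeg (𝒢.fibreNeg p) = p :=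
  congrArg (TotalSpace.mk p.1) (neg_neg p.2)

theorem contMDiff_fibreNeg (𝒢 : LieGroupoid EG EM G M) :
    ContMDiff (𝓘(ℝ, EM).prod 𝓘(ℝ, AlgModel EG EM →L[ℝ] ℝ))
      (𝓘(ℝ, EM).prod 𝓘(ℝ, AlgModel EG EM →L[ℝ] ℝ)) ∞ 𝒢.fibreNeg := by
  intro p
  have h := (contMDiffAt_hom_bundle (fun p : 𝒢.DualTotal => p) (n := ∞) (IB := 𝓘(ℝ, EM))
    (x₀ := p)).1 contMDiffAt_id
  refine (contMDiffAt_hom_bundle _).2 ⟨h.1, ?_⟩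
  refine (h.2.neg).congr_of_eventuallyEq (Filter.Eventually.of_forall fun q => ?_)
  refine ContinuousLinearMap.ext fun w => ?_
  exact (inCoordinates_dual_apply (-q.2) w).trans
    (congrArg Neg.neg (inCoordinates_dual_apply q.2 w).symm)

/-- `fibreNeg`, as a diffeomorphism. -/
def fibreNegDiffeomorph (𝒢 : LieGroupoid EG EM G M) :
    Diffeomorph (𝓘(ℝ, EM).prod 𝓘(ℝ, AlgModel EG EM →L[ℝ] ℝ))
      (𝓘(ℝ, EM).prod 𝓘(ℝ, AlgModel EG EM →L[ℝ] ℝ)) 𝒢.DualTotal 𝒢.DualTotal ∞ where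
  toFun := 𝒢.fibreNeg
  invFun := 𝒢.fibreNeg
  left_inv := 𝒢.fibreNeg_fibreNeg
  right_inv := 𝒢.fibreNeg_fibreNeg
  contMDiff_toFun := 𝒢.contMDiff_fibreNeg
  contMDiff_invFun := 𝒢.contMDiff_fibreNeg

variable {𝒢 : LieGroupoid EG EM G M} {L : G → ℝ}

/-- The Legendre transformations are exchanged by inversion. -/
theorem fibreNeg_legendrePlus (h : G) :
    𝒢.fibreNeg (𝒢.legendrePlus (L ∘ 𝒢.inv) (𝒢.inv h)) = 𝒢.legendreMinus L h := by
  set c : M → (G → ℝ) → 𝒢.DualTotal := fun x f => ⟨x, -((mfderivWithin 𝓘(ℝ, EG) 𝓘(ℝ, ℝ) f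
    (𝒢.src ⁻¹' {x}) (𝒢.unit x)).comp (𝒢.incl x))⟩ with hc
  have h1 : c (𝒢.tgt (𝒢.inv h)) (fun k => L (𝒢.inv (𝒢.mul (𝒢.inv h) k))) =
      c (𝒢.src h) (fun k => L (𝒢.inv (𝒢.mul (𝒢.inv h) k))) := by rw [𝒢.tgt_inv]
  refine h1.trans ?_
  have hf : ∀ k ∈ 𝒢.src ⁻¹' {𝒢.src h}, L (𝒢.inv (𝒢.mul (𝒢.inv h) k)) = L (𝒢.mul (𝒢.inv k) h) := by
    intro k hk
    rw [𝒢.inv_mul_rev ((𝒢.tgt_inv h).trans (Eq.symm hk)), 𝒢.inv_inv]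
  have h2 : mfderivWithin 𝓘(ℝ, EG) 𝓘(ℝ, ℝ) (fun k => L (𝒢.inv (𝒢.mul (𝒢.inv h) k)))
      (𝒢.src ⁻¹' {𝒢.src h}) (𝒢.unit (𝒢.src h)) = mfderivWithin 𝓘(ℝ, EG) 𝓘(ℝ, ℝ)
      (fun k => L (𝒢.mul (𝒢.inv k) h)) (𝒢.src ⁻¹' {𝒢.src h}) (𝒢.unit (𝒢.src h)) :=
    mfderivWithin_congr hf (hf _ (𝒢.src_unit _))
  exact congrArg (fun A : EG →L[ℝ] ℝ => (⟨𝒢.src h, -(A.comp (𝒢.incl (𝒢.src h)))⟩ : 𝒢.DualTotal)) h2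

theorem isLocalDiffeomorph_legendreMinus_iff :
    IsLocalDiffeomorph 𝓘(ℝ, EG) (𝓘(ℝ, EM).prod 𝓘(ℝ, AlgModel EG EM →L[ℝ] ℝ)) ∞
      (𝒢.legendreMinus L) ↔
    IsLocalDiffeomorph 𝓘(ℝ, EG) (𝓘(ℝ, EM).prod 𝓘(ℝ, AlgModel EG EM →L[ℝ] ℝ)) ∞
      (𝒢.legendrePlus (L ∘ 𝒢.inv)) := by
  have key : ∀ {F F' : G → 𝒢.DualTotal}, (∀ h, F' h = 𝒢.fibreNeg (F (𝒢.inv h))) →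
      IsLocalDiffeomorph 𝓘(ℝ, EG) (𝓘(ℝ, EM).prod 𝓘(ℝ, AlgModel EG EM →L[ℝ] ℝ)) ∞ F →
      IsLocalDiffeomorph 𝓘(ℝ, EG) (𝓘(ℝ, EM).prod 𝓘(ℝ, AlgModel EG EM →L[ℝ] ℝ)) ∞ F' := by
    intro F F' hFF hF h
    have e : F' = 𝒢.fibreNegDiffeomorph ∘ (F ∘ 𝒢.invDiffeomorph) := funext hFF
    rw [e]
    exact ((𝒢.invDiffeomorph.isLocalDiffeomorph h).comp _ _ (hF _)).comp _ _
      (𝒢.fibreNegDiffeomorph.isLocalDiffeomorph _)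
  refine ⟨key fun h => ?_, key fun h => (fibreNeg_legendrePlus h).symm⟩
  rw [← fibreNeg_legendrePlus, 𝒢.inv_inv, 𝒢.fibreNeg_fibreNeg]

section

variable {V : Type*} [NormedAddCommGroup V] [NormedSpace ℝ V] {h : G} {P Q : V → G}

theorem Biparam.inv_comp (bp : 𝒢.Biparam (𝒢.inv h) P Q) :
    𝒢.Biparam h (𝒢.inv ∘ Q) (𝒢.inv ∘ P) where
  left_zero := by rw [Function.comp_apply, bp.right_zero, 𝒢.inv_inv]
  right_zero := by rw [Function.comp_apply, bp.left_zero, 𝒢.inv_inv]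
  smooth_left := bp.smooth_right.mono fun q hq => 𝒢.contMDiff_inv.contMDiffAt.comp q hq
  smooth_right := bp.smooth_left.mono fun p hp => 𝒢.contMDiff_inv.contMDiffAt.comp p hp
  tgt_left := bp.src_right.mono fun q hq => by
    rw [Function.comp_apply, 𝒢.tgt_inv, hq, 𝒢.src_inv]
  src_right := bp.tgt_left.mono fun p hp => by
    rw [Function.comp_apply, 𝒢.src_inv, hp, 𝒢.tgt_inv]

theorem injective_mfderiv_inv_comp {c : V → G} (hc : MDifferentiableAt 𝓘(ℝ, V) 𝓘(ℝ, EG) c 0)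
    (hinj : Function.Injective (mfderiv 𝓘(ℝ, V) 𝓘(ℝ, EG) c 0)) :
    Function.Injective (mfderiv 𝓘(ℝ, V) 𝓘(ℝ, EG) (𝒢.inv ∘ c) 0) := by
  have hd : ∀ k, MDifferentiableAt 𝓘(ℝ, EG) 𝓘(ℝ, EG) 𝒢.inv k := fun k =>
    𝒢.contMDiff_inv.contMDiffAt.mdifferentiableAt (by simp)
  have h1 := mfderiv_comp (I' := 𝓘(ℝ, EG)) (0 : V) (hd _) ((hd _).comp (0 : V) hc)
  have h2 : 𝒢.inv ∘ (𝒢.inv ∘ c) = c := funext fun v => 𝒢.inv_inv (c v)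
  rw [h2] at h1
  intro v w hvw
  refine hinj ((congrArg (fun A : V →L[ℝ] EG => A v) h1).trans (Eq.trans ?_
    (congrArg (fun A : V →L[ℝ] EG => A w) h1).symm))
  exact congrArg (mfderiv 𝓘(ℝ, EG) 𝓘(ℝ, EG) 𝒢.inv ((𝒢.inv ∘ c) 0)) hvw

/-- Inversion reverses the product `P(p) h Q(q)` into `Q(q)⁻¹ h⁻¹ P(p)⁻¹`, exchanging the two
variables. Symmetry of the second derivative then transposes the mixed block. -/
theorem mixedHessian_inv (bp : 𝒢.Biparam (𝒢.inv h) P Q) (hL : ContMDiff 𝓘(ℝ, EG) 𝓘(ℝ, ℝ) ∞ L) :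
    𝒢.mixedHessian (L ∘ 𝒢.inv) h (𝒢.inv ∘ Q) (𝒢.inv ∘ P) =
      (𝒢.mixedHessian L (𝒢.inv h) P Q).flip := by
  set ℓ := L ∘ 𝒢.triMap (𝒢.inv h) P Q with hℓ
  set A : (V × V) ≃L[ℝ] (V × V) := ContinuousLinearEquiv.prodComm ℝ V V with hA
  have hℓs : ContDiffAt ℝ ∞ ℓ 0 := (bp.contDiffAt_lagrangian hL).self_of_nhds
  have hswap : Filter.Tendsto A (𝓝 (0 : V × V)) (𝓝 (0 : V × V)) := by
    have := A.continuous.tendsto 0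
    rwa [map_zero] at this
  have hev : (L ∘ 𝒢.inv) ∘ 𝒢.triMap h (𝒢.inv ∘ Q) (𝒢.inv ∘ P) =ᶠ[𝓝 0] ℓ ∘ A := by
    filter_upwards [hswap.eventually bp.eventually_fibres] with y hy
    refine congrArg L ?_
    have h1 := 𝒢.inv_tri hy.1 hy.2
    rw [𝒢.inv_inv] at h1
    exact ((congrArg 𝒢.inv h1).symm).trans (𝒢.inv_inv _)
  have h1 : fderiv ℝ (ℓ ∘ A) = (fun B : V × V →L[ℝ] ℝ => B.comp (A : V × V →L[ℝ] V × V)) ∘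
      (fderiv ℝ ℓ ∘ A) := funext fun y => A.comp_right_fderiv
  have hdd : DifferentiableAt ℝ (fderiv ℝ ℓ) (A 0) := by
    rw [map_zero]
    exact (hℓs.fderiv_right (m := ∞) (by simp)).differentiableAt (by simp)
  have h2 := (((ContinuousLinearMap.compL ℝ (V × V) (V × V) ℝ).flip
    (A : V × V →L[ℝ] V × V)).hasFDerivAt.comp (0 : V × V)
      (hdd.hasFDerivAt.comp (0 : V × V) A.hasFDerivAt)).fderiv
  have hsymm : IsSymmSndFDerivAt ℝ ℓ 0 := hℓs.isSymmSndFDerivAt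
    (by rw [minSmoothness_of_isRCLikeNormedField]; exact WithTop.coe_le_coe.2 le_top)
  ext a b
  rw [ContinuousLinearMap.flip_apply, mixedHessian_apply, mixedHessian_apply,
    hev.fderiv.fderiv_eq, h1]
  have h3 := congrArg (fun B : V × V →L[ℝ] V × V →L[ℝ] ℝ => B (a, 0) (0, b)) h2
  refine Eq.trans h3 ?_
  change fderiv ℝ (fderiv ℝ ℓ) (A 0) (0, a) (b, 0) = _
  rw [map_zero]
  exact hsymm _ _

end

/-- `isRegular_iff` allows any immersed parametrizations, so `L ∘ i` is tested on the inverted ones,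
where its mixed Hessian is the transpose of that of `L`. -/
theorem isRegular_inv_iff [T2Space G] (hL : ContMDiff 𝓘(ℝ, EG) 𝓘(ℝ, ℝ) ∞ L) :
    𝒢.IsRegular (L ∘ 𝒢.inv) ↔ 𝒢.IsRegular L := by
  have S := fun g => (nonempty_fibreChart 𝒢.isSubmersion_src (𝒢.unit (𝒢.tgt g))).some
  have R := fun g => (nonempty_fibreChart 𝒢.isSubmersion_tgt g).some
  have bp := fun g => biparam_translateParam (S g) (R g)
  rw [isRegular_iff hL _ _ bp (fun g => injective_mfderiv_param (R g))
    (fun g => injective_mfderiv_translateParam (S g)),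
    isRegular_iff (hL.comp 𝒢.contMDiff_inv) _ _ (fun g => (bp (𝒢.inv g)).inv_comp)
    (fun g => injective_mfderiv_inv_comp ((bp _).contMDiffAt_right.mdifferentiableAt (by simp))
      (injective_mfderiv_translateParam (S _)))
    (fun g => injective_mfderiv_inv_comp ((bp _).contMDiffAt_left.mdifferentiableAt (by simp))
      (injective_mfderiv_param (R _)))]
  simp only [mixedHessian_inv (bp _) hL]
  constructor
  · intro h g
    have h1 := flip_injective_of_injective (h (𝒢.inv g))
    rwa [ContinuousLinearMap.flip_flip, 𝒢.inv_inv] at h1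
  · exact fun h g => flip_injective_of_injective (h (𝒢.inv g))

theorem isRegular_iff_legendreMinus [T2Space G] (hL : ContMDiff 𝓘(ℝ, EG) 𝓘(ℝ, ℝ) ∞ L) :
    𝒢.IsRegular L ↔
      IsLocalDiffeomorph 𝓘(ℝ, EG) (𝓘(ℝ, EM).prod 𝓘(ℝ, AlgModel EG EM →L[ℝ] ℝ)) ∞
        (𝒢.legendreMinus L) := by
  rw [isLocalDiffeomorph_legendreMinus_iff, ← isRegular_inv_iff hL]
  exact isRegular_iff_legendrePlus (hL.comp 𝒢.contMDiff_inv)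

end LieGroupoid

/-! ### The discrete Euler–Lagrange equations as an equality of Legendre transforms. -/

namespace LieGroupoid

variable {EG EM G M : Type*}
  [NormedAddCommGroup EG] [NormedSpace ℝ EG] [FiniteDimensional ℝ EG]
  [NormedAddCommGroup EM] [NormedSpace ℝ EM] [FiniteDimensional ℝ EM]
  [TopologicalSpace G] [ChartedSpace EG G] [IsManifold 𝓘(ℝ, EG) ∞ G]
  [TopologicalSpace M] [ChartedSpace EM M] [IsManifold 𝓘(ℝ, EM) ∞ M]
  {𝒢 : LieGroupoid EG EM G M} {L : G → ℝ} {g h : G}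

/-- The restriction to `A_x G` of the differential at `ε(x)` of a function on the `α`-fibre. -/
def algDifferential (𝒢 : LieGroupoid EG EM G M) (f : G → ℝ) (x : M) : 𝒢.Alg x →L[ℝ] ℝ :=
  (mfderivWithin 𝓘(ℝ, EG) 𝓘(ℝ, ℝ) f (𝒢.src ⁻¹' {x}) (𝒢.unit x)).comp (𝒢.incl x)

/-- Additivity holds on `A_x G`, although derivatives within the fibre are not unique. -/
theorem algDifferential_add {x : M} {f₁ f₂ : G → ℝ}
    (h₁ : MDifferentiableWithinAt 𝓘(ℝ, EG) 𝓘(ℝ, ℝ) f₁ (𝒢.src ⁻¹' {x}) (𝒢.unit x))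
    (h₂ : MDifferentiableWithinAt 𝓘(ℝ, EG) 𝓘(ℝ, ℝ) f₂ (𝒢.src ⁻¹' {x}) (𝒢.unit x)) :
    𝒢.algDifferential (fun k => f₁ k + f₂ k) x =
      𝒢.algDifferential f₁ x + 𝒢.algDifferential f₂ x := by
  obtain ⟨S⟩ := nonempty_fibreChart 𝒢.isSubmersion_src (𝒢.unit x)
  refine ContinuousLinearMap.ext fun v => ?_
  set c : AlgModel EG EM → G := fun u => S.param (𝒢.unit x, u) with hc
  have hc0 : c 0 = 𝒢.unit x := S.param_zero _ S.mem_dom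
  have hcd : MDifferentiableAt 𝓘(ℝ, AlgModel EG EM) 𝓘(ℝ, EG) c 0 :=
    (S.contMDiffAt_param_right S.mem_dom S.zero_mem_ball).mdifferentiableAt (by simp)
  have hcs : ∀ᶠ u in 𝓝 0, c u ∈ 𝒢.src ⁻¹' {x} :=
    (S.eventually_map_param S.mem_dom).mono fun u hu => hu.trans (𝒢.src_unit x)
  have hw := S.mfderiv_param_coord S.mem_dom (𝒢.contMDiff_src.mdifferentiableAt (by simp))
    (𝒢.incl x v) v.2
  set w : AlgModel EG EM :=
    mfderiv 𝓘(ℝ, EG) 𝓘(ℝ, AlgModel EG EM) S.coord (𝒢.unit x) (𝒢.incl x v)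
  -- Elements of `A_x G` are velocities of the fibre parametrization `c`, so each derivative within
  -- the fibre is replaced by a genuine derivative of `f ∘ c`, which is additive.
  have key : ∀ f : G → ℝ,
      MDifferentiableWithinAt 𝓘(ℝ, EG) 𝓘(ℝ, ℝ) f (𝒢.src ⁻¹' {x}) (𝒢.unit x) →
      DifferentiableAt ℝ (f ∘ c) 0 ∧
      (mfderivWithin 𝓘(ℝ, EG) 𝓘(ℝ, ℝ) f (𝒢.src ⁻¹' {x}) (𝒢.unit x) (𝒢.incl x v) : ℝ) =
        fderiv ℝ (f ∘ c) 0 w := by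
    intro f hf
    have hf' := hf
    rw [← hc0] at hf'
    constructor
    · exact ((hf'.comp_of_preimage_mem_nhdsWithin (0 : AlgModel EG EM) (s := univ)
        hcd.mdifferentiableWithinAt (by rw [nhdsWithin_univ]; exact hcs)).mdifferentiableAt
          Filter.univ_mem).differentiableAt
    · have h3 := mfderivWithin_apply_mfderiv (J := 𝓘(ℝ, ℝ)) hf' hcd hcs w
      rw [mfderiv_eq_fderiv] at h3
      have h4 : ∀ (y : G) (_ : y = 𝒢.unit x) (u : EG),
          (mfderivWithin 𝓘(ℝ, EG) 𝓘(ℝ, ℝ) f (𝒢.src ⁻¹' {x}) (𝒢.unit x) u : ℝ) =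
          mfderivWithin 𝓘(ℝ, EG) 𝓘(ℝ, ℝ) f (𝒢.src ⁻¹' {x}) y u := by
        rintro _ rfl u; rfl
      refine Eq.trans ?_ ((h4 _ hc0 _).trans h3)
      exact congrArg (fun u : EG =>
        (mfderivWithin 𝓘(ℝ, EG) 𝓘(ℝ, ℝ) f (𝒢.src ⁻¹' {x}) (𝒢.unit x) u : ℝ)) hw.symm
  obtain ⟨d₁, e₁⟩ := key f₁ h₁
  obtain ⟨d₂, e₂⟩ := key f₂ h₂
  refine ((key _ (h₁.add h₂)).2.trans ?_).trans (congrArg₂ (fun a b : ℝ => a + b) e₁ e₂).symm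
  exact congrArg (fun A : AlgModel EG EM →L[ℝ] ℝ => A w) (fderiv_add d₁ d₂)

/-- The discrete Euler-Lagrange equations in terms of the Legendre transformations. -/
theorem isDELSolution_iff (hL : ContMDiff 𝓘(ℝ, EG) 𝓘(ℝ, ℝ) ∞ L) :
    𝒢.IsDELSolution L g h ↔ 𝒢.legendrePlus L g = 𝒢.legendreMinus L h := by
  by_cases e : 𝒢.tgt g = 𝒢.src h
  · have hLd : ∀ k, MDifferentiableAt 𝓘(ℝ, EG) 𝓘(ℝ, ℝ) L k := fun k =>
      hL.contMDiffAt.mdifferentiableAt (by simp)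
    have h₁ : MDifferentiableWithinAt 𝓘(ℝ, EG) 𝓘(ℝ, ℝ) (fun k => L (𝒢.mul g k))
        (𝒢.src ⁻¹' {𝒢.tgt g}) (𝒢.unit (𝒢.tgt g)) := by
      have h2 := 𝒢.mdifferentiableWithinAt_mul_left (g := g) (k := 𝒢.unit (𝒢.tgt g))
        (𝒢.src_unit _).symm
      rw [𝒢.src_unit] at h2
      exact (hLd _).comp_mdifferentiableWithinAt (I' := 𝓘(ℝ, EG)) _ h2
    have h₂ : MDifferentiableWithinAt 𝓘(ℝ, EG) 𝓘(ℝ, ℝ) (fun k => L (𝒢.mul (𝒢.inv k) h))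
        (𝒢.src ⁻¹' {𝒢.tgt g}) (𝒢.unit (𝒢.tgt g)) := by
      have hs : ∀ k ∈ 𝒢.src ⁻¹' {𝒢.tgt g}, 𝒢.tgt (𝒢.inv k) = 𝒢.src h := fun k hk =>
        (𝒢.tgt_inv k).trans (Eq.trans hk e)
      have h3 := (𝒢.contMDiffOn_mul (𝒢.inv (𝒢.unit (𝒢.tgt g)), h) (hs _ (𝒢.src_unit _))).comp
        (𝒢.unit (𝒢.tgt g)) (f := fun k => (𝒢.inv k, h)) (s := 𝒢.src ⁻¹' {𝒢.tgt g})
        (𝒢.contMDiff_inv.contMDiffAt.prodMk contMDiffAt_const).contMDiffWithinAt hs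
      exact (hLd _).comp_mdifferentiableWithinAt (I' := 𝓘(ℝ, EG)) _
        (h3.mdifferentiableWithinAt (by simp))
    have h3 : 𝒢.legendreMinus L h =
        ⟨𝒢.tgt g, -𝒢.algDifferential (fun k => L (𝒢.mul (𝒢.inv k) h)) (𝒢.tgt g)⟩ := by
      rw [e]; rfl
    have h4 : 𝒢.IsDELSolution L g h ↔ 𝒢.algDifferential (fun k => L (𝒢.mul g k)) (𝒢.tgt g) +
        𝒢.algDifferential (fun k => L (𝒢.mul (𝒢.inv k) h)) (𝒢.tgt g) = 0 := by
      rw [← algDifferential_add h₁ h₂]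
      exact and_iff_right e
    rw [h4, h3, add_eq_zero_iff_eq_neg]
    exact (TotalSpace.mk_inj (F := AlgModel EG EM →L[ℝ] ℝ) (E := 𝒢.DualAlg)
      (y := 𝒢.algDifferential (fun k => L (𝒢.mul g k)) (𝒢.tgt g))).symm
  · exact ⟨fun h1 => absurd h1.1 e, fun h1 => absurd (congrArg TotalSpace.proj h1) e⟩

end LieGroupoid

end

/-! ### The theorem. -/

theorem theorem5p13 {EG EM G M : Type*}
    [NormedAddCommGroup EG] [NormedSpace ℝ EG] [FiniteDimensional ℝ EG]
    [NormedAddCommGroup EM] [NormedSpace ℝ EM] [FiniteDimensional ℝ EM]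
    [TopologicalSpace G] [ChartedSpace EG G] [IsManifold 𝓘(ℝ, EG) ∞ G] [T2Space G]
    [TopologicalSpace M] [ChartedSpace EM M] [IsManifold 𝓘(ℝ, EM) ∞ M] [T2Space M]
    (𝒢 : LieGroupoid EG EM G M) (L : G → ℝ) (hL : ContMDiff 𝓘(ℝ, EG) 𝓘(ℝ, ℝ) ∞ L) :
    ((𝒢.IsRegular L ↔
        IsLocalDiffeomorph 𝓘(ℝ, EG) (𝓘(ℝ, EM).prod 𝓘(ℝ, LieGroupoid.AlgModel EG EM →L[ℝ] ℝ)) ∞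
          (𝒢.legendreMinus L)) ∧
      (𝒢.IsRegular L ↔
        IsLocalDiffeomorph 𝓘(ℝ, EG) (𝓘(ℝ, EM).prod 𝓘(ℝ, LieGroupoid.AlgModel EG EM →L[ℝ] ℝ)) ∞
          (𝒢.legendrePlus L))) ∧
    (𝒢.IsRegular L → ∀ g₀ h₀ : G, 𝒢.IsDELSolution L g₀ h₀ →
      ∃ ξ : PartialDiffeomorph 𝓘(ℝ, EG) 𝓘(ℝ, EG) G G ∞,
        g₀ ∈ ξ.source ∧ h₀ ∈ ξ.target ∧ ξ g₀ = h₀ ∧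
        𝒢.IsEvolutionOperatorOn L ξ.source ξ ∧
        (∀ (U' : Set G) (ξ' : G → G), IsOpen U' → g₀ ∈ U' →
          𝒢.IsEvolutionOperatorOn L U' ξ' → ξ' g₀ = h₀ →
          EqOn ξ' ξ (connectedComponentIn (ξ.source ∩ U') g₀)) ∧
        (∀ (U' : Set G) (ξ' : G → G), IsOpen U' →
          𝒢.IsEvolutionOperatorOn L U' ξ' → MapsTo ξ' (ξ.source ∩ U') ξ.target →
          EqOn ξ' ξ (ξ.source ∩ U'))) := by
  refine ⟨⟨LieGroupoid.isRegular_iff_legendreMinus hL,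
    LieGroupoid.isRegular_iff_legendrePlus hL⟩, fun hreg g₀ h₀ h => ?_⟩
  obtain ⟨Φ, hgΦ, hΦ⟩ := (LieGroupoid.isRegular_iff_legendrePlus hL).1 hreg g₀
  obtain ⟨Ψ, hhΨ, hΨ⟩ := (LieGroupoid.isRegular_iff_legendreMinus hL).1 hreg h₀
  have h0 : Φ g₀ = Ψ h₀ :=
    (hΦ hgΦ).symm.trans (((LieGroupoid.isDELSolution_iff hL).1 h).trans (hΨ hhΨ))
  -- The evolution operator is `(F⁻L)⁻¹ ∘ F⁺L`, with `Φ` and `Ψ` the local diffeomorphisms that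
  -- represent `F⁺L` near `g₀` and `F⁻L` near `h₀`. They can be composed at `g₀` because `(g₀, h₀)`
  -- is a solution.
  set ξ := Φ.trans Ψ.symm with hξ
  have hsrc : ∀ {g : G}, g ∈ ξ.source → g ∈ Φ.source ∧ Φ g ∈ Ψ.target := fun hg => hg
  have htgt : ∀ {k : G}, k ∈ ξ.target → k ∈ Ψ.source := fun hk => hk.1
  have hξΨ : ∀ {g : G}, g ∈ ξ.source → ξ g ∈ Ψ.source := fun hg => Ψ.map_target (hsrc hg).2
  have hg₀ : g₀ ∈ ξ.source := ⟨hgΦ, show Φ g₀ ∈ Ψ.target by rw [h0]; exact Ψ.map_source hhΨ⟩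
  have hξ₀ : ξ g₀ = h₀ := (congrArg Ψ.invFun h0).trans (Ψ.left_inv hhΨ)
  have hDEL : ∀ g ∈ ξ.source, 𝒢.IsDELSolution L g (ξ g) := fun g hg =>
    (LieGroupoid.isDELSolution_iff hL).2 <| (hΦ (hsrc hg).1).trans <|
      (Ψ.right_inv (hsrc hg).2).symm.trans (hΨ (hξΨ hg)).symm
  -- All solutions `k` for a given `g` have the same image `F⁺L(g)` under `F⁻L`, which is injective
  -- on `Ψ.source`.
  have huniq : ∀ {g k : G}, g ∈ ξ.source → k ∈ Ψ.source → 𝒢.IsDELSolution L g k → k = ξ g := by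
    intro g k hg hk hgk
    refine Ψ.injOn hk (hξΨ hg) ?_
    have h1 := (LieGroupoid.isDELSolution_iff hL).1 hgk
    have h2 := (LieGroupoid.isDELSolution_iff hL).1 (hDEL g hg)
    exact (hΨ hk).symm.trans ((h1.symm.trans h2).trans (hΨ (hξΨ hg)))
  refine ⟨ξ, hg₀, hξ₀ ▸ ξ.map_source hg₀, hξ₀, ⟨ξ.contMDiffOn, hDEL⟩, ?_, ?_⟩
  · intro U' ξ' hU' hgU hξ' h₁
    set D := ξ.source ∩ U' with hD
    have hDo : IsOpen D := ξ.open_source.inter hU'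
    have hc' : ContinuousOn ξ' D := hξ'.1.continuousOn.mono inter_subset_right
    have hc : ContinuousOn ξ D := ξ.contMDiffOn.continuousOn.mono inter_subset_left
    have hu : IsOpen (D ∩ ξ' ⁻¹' Ψ.source) := hc'.isOpen_inter_preimage hDo Ψ.open_source
    have hv : IsOpen (D ∩ (fun g => (ξ' g, ξ g)) ⁻¹' (diagonal G)ᶜ) :=
      (hc'.prodMk hc).isOpen_inter_preimage hDo isClosed_diagonal.isOpen_compl
    have heq : ∀ g ∈ D ∩ ξ' ⁻¹' Ψ.source, ξ' g = ξ g := fun g hg =>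
      huniq hg.1.1 hg.2 (hξ'.2 g hg.1.2)
    have hgD : g₀ ∈ D := ⟨hg₀, hgU⟩
    -- On `D`, either `ξ'` lands in `Ψ.source`, and then it agrees with `ξ`, or it differs from `ξ`.
    -- Both conditions are open (the second because `G` is Hausdorff), they exclude each other and
    -- they cover `D`. The component of `g₀`, where the first holds, lies in the first set.
    have hsub : connectedComponentIn D g₀ ⊆ D ∩ ξ' ⁻¹' Ψ.source := by
      refine isPreconnected_connectedComponentIn.subset_left_of_subset_union hu hv ?_ ?_ ?_
      · exact disjoint_left.2 fun g hg hg' => hg'.2 (heq g hg)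
      · intro g hg
        have hgD := connectedComponentIn_subset D g₀ hg
        by_cases he : ξ' g = ξ g
        · exact Or.inl ⟨hgD, show ξ' g ∈ Ψ.source by rw [he]; exact hξΨ hgD.1⟩
        · exact Or.inr ⟨hgD, he⟩
      · exact ⟨g₀, mem_connectedComponentIn hgD, hgD, show ξ' g₀ ∈ Ψ.source by rw [h₁]; exact hhΨ⟩
    exact fun g hg => heq g (hsub hg)
  · exact fun U' ξ' _ hξ' hmaps g hg => huniq hg.1 (htgt (hmaps hg)) (hξ'.2 g hg.2)
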